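/- Let $b:[0,\infty)\to\mathbb R$ be regularly varying at $+\infty$ with index $\alpha\le-\tfrac12$, i.e. $b(x)=x^{\alpha}\ell(x)$ for $x>0$, where $\ell:(0,\infty)\to\mathbb R$ is measurable, eventually positive and $\ell(cx)/\ell(x)\to1$ as $x\to+\infty$ for every $c>0$. If $\alpha=-\tfrac12$, assume in addition $\sum_{k\ge0}b^2(k)<\infty$ (for $\alpha<-\tfrac12$ this holds automatically). Let $\xi_0,\xi_1,\dots$ be independent, identically distributed complex random variables with $\mathbb E[\xi_0]=0$, $\sigma_1^2:=\mathbb E[(\operatorname{Re}\xi_0)^2]<\infty$, $\sigma_2^2:=\mathbb E[(\operatorname{Im}\xi_0)^2]<\infty$, $\sigma^2:=\sigma_1^2+\sigma_2^2>0$ and $\operatorname{Cov}[\operatorname{Re}\xi_0,\operatorname{Im}\xi_0]=0$. Put $$P_n(z)=\sum_{k=0}^n b(k)\xi_kz^k,\qquad P_\infty(z)=\sum_{k\ge0}b(k)\xi_kz^k=\lim_{n\to\infty}P_n(z),$$ and fix $0\le\psi_1<\dots<\psi_m<2\pi$. Let $W_{-1}$ be the secondary real branch of the Lambert function: for $x\in[-e^{-1},0)$,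 $w=W_{-1}(x)$ is the unique $w\le-1$ with $we^w=x$. Let $\mathcal A(\mathbb C)$ be the space of entire functions with the topology of locally uniform convergence. For all sufficiently large $n$ one has $-nb^2(n)\in[-e^{-1},0)$, so that $a_n=-W_{-1}(-nb^2(n))$ is well defined; put $$z_n(\psi,u)=\exp\Big(\frac{a_n}{2n}+\frac un+i\psi\Big),\qquad u\in\mathbb C .$$ For each $j$ the series $P_\infty(e^{i\psi_j})$ converges almost surely. On a suitable extension of the probability space there is a centred (jointly) Gaussian random vector $(N_1,\dots,N_m)$ in $\mathbb C^m$, independent of $P_\infty$ (indeed of $(\xi_k)_{k\ge0}$), with $$\mathbb E[N_i\overline{N_j}]=\sigma^2\mathbf 1_{\{i=j\}},\qquad \mathbb E[N_iN_j]=(\sigma_1^2-\sigma_2^2)\,\mathbf 1_{\{\psi_i+\psi_j\in\{0,2\pi\}\}},\qquad 1\le i,j\le m,$$ such that, as $n\to\infty$, in distribution on $\mathcal A(\mathbb C)^m$, $$\big(P_n(z_n(\psi_j,u))\big)_{u\in\mathbb C,\;1\le j\le m}\Longrightarrow\big(P_\infty(e^{i\psi_j})+e^uN_j\big)_{u\in\mathbb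 C,\;1\le j\le m}.$$ Consequently, in distribution on the $m$-fold product of the space of locally finite integer-valued measures on $\mathbb C$ with the vague topology, the point processes of zeros (with multiplicities) of $u\mapsto P_n(z_n(\psi_j,u))$, $1\le j\le m$, converge jointly to the point processes of zeros of $u\mapsto P_\infty(e^{i\psi_j})+e^uN_j$, $1\le j\le m$ (the identically zero function is assigned the zero measure). Almost surely, for every $j$, the zeros of the limit function $P_\infty(e^{i\psi_j})+e^uN_j$ are simple and form the lattice $\log(-P_\infty(e^{i\psi_j})/N_j)+2\pi i\mathbb Z$. If $\alpha<-\tfrac12$, both convergences remain true when $a_n$ in the definition of $z_n$ is replaced by $$-2\log b(n)-\log n+\log\log n+\log(-2\alpha-1).$$ -/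

import Mathlib

open MeasureTheory ProbabilityTheory Filter Topology
open scoped ENNReal CompactlySupported

noncomputable section

/-- `ℓ` is slowly varying at `+∞`: measurable on `(0, ∞)`, eventually positive, and
`ℓ (c x) / ℓ x → 1` as `x → +∞` for every `c > 0`. Values off `(0, ∞)` play no role. -/
structure IsSlowlyVarying (ℓ : ℝ → ℝ) : Prop where
  measurable : Measurable ((Set.Ioi (0 : ℝ)).domRestrict ℓ)
  eventually_pos : ∀ᶠ x in atTop, 0 < ℓ x
  tendsto_ratio : ∀ c : ℝ, 0 < c → Tendsto (fun x => ℓ (c * x) / ℓ x) atTop (𝓝 1)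

/-- `b` varies regularly at `+∞` with index `α`: `b x = x ^ α * ℓ x` for `x > 0`, with `ℓ` slowly
varying. The value `b 0` is arbitrary. -/
def IsRegularlyVarying (b : ℝ → ℝ) (α : ℝ) : Prop :=
  ∃ ℓ : ℝ → ℝ, IsSlowlyVarying ℓ ∧ ∀ x : ℝ, 0 < x → b x = x ^ α * ℓ x

/-- The secondary real branch `W₋₁` of the Lambert function: for `x ∈ [-1/e, 0)` the number
`lambertWm1 x` is the unique `w ≤ -1` with `w * exp w = x` (other `x` carry no meaning). -/
def lambertWm1 (x : ℝ) : ℝ :=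
  Function.invFunOn (fun w : ℝ => w * Real.exp w) (Set.Iic (-1)) x

/-- The polynomial `P_n(z) = ∑_{k = 0}^n b(k) x_k z^k`. -/
def weightedPoly (b : ℝ → ℝ) (x : ℕ → ℂ) (n : ℕ) (z : ℂ) : ℂ :=
  ∑ k ∈ Finset.range (n + 1), (b k : ℂ) * x k * z ^ k

/-- `P_∞(z) = ∑_{k ≥ 0} b(k) x_k z^k`, the limit of the partial sums. (On the unit circle the series
need not converge absolutely, so the unconditional sum is not used.) -/
def weightedSeries (b : ℝ → ℝ) (x : ℕ → ℂ) (z : ℂ) : ℂ :=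
  limUnder atTop (fun n : ℕ => weightedPoly b x n z)

/-- The point `exp (a / (2 n) + u / n + i ψ)`. -/
def windowPoint (a : ℝ) (n : ℕ) (ψ : ℝ) (u : ℂ) : ℂ :=
  Complex.exp ((a : ℂ) / (2 * (n : ℂ)) + u / (n : ℂ) + (ψ : ℂ) * Complex.I)

/-- The space of entire functions. -/
def EntireFun : Type := {f : C(ℂ, ℂ) // Differentiable ℂ (f : ℂ → ℂ)}

namespace EntireFun

/-- The topology of locally uniform convergence (the compact-open topology). -/
instance : TopologicalSpace EntireFun :=
  inferInstanceAs (TopologicalSpace {f : C(ℂ, ℂ) // Differentiable ℂ (f : ℂ → ℂ)})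

theorem isInducing_val : Topology.IsInducing (fun f : EntireFun => (f.1 : C(ℂ, ℂ))) := ⟨rfl⟩

instance : SecondCountableTopology EntireFun := isInducing_val.secondCountableTopology

instance : MeasurableSpace EntireFun := borel EntireFun

instance : BorelSpace EntireFun := ⟨rfl⟩

/-- The underlying function. -/
def toFun (f : EntireFun) : ℂ → ℂ := f.1

/-- Bundle a differentiable function. -/
def ofDifferentiable (f : ℂ → ℂ) (hf : Differentiable ℂ f) : EntireFun :=
  ⟨⟨f, hf.continuous⟩, hf⟩

theorem differentiable (f : EntireFun) : Differentiable ℂ f.toFun := f.2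

end EntireFun

theorem differentiable_weightedPoly_windowPoint (b : ℝ → ℝ) (x : ℕ → ℂ) (a : ℝ) (n : ℕ) (ψ : ℝ) :
    Differentiable ℂ (fun u : ℂ => weightedPoly b x n (windowPoint a n ψ u)) := by
  unfold weightedPoly windowPoint
  fun_prop

/-- The entire function `u ↦ P_n(exp (a / (2 n) + u / n + i ψ))`. -/
def windowPoly (b : ℝ → ℝ) (x : ℕ → ℂ) (a : ℝ) (n : ℕ) (ψ : ℝ) : EntireFun :=
  EntireFun.ofDifferentiable (fun u => weightedPoly b x n (windowPoint a n ψ u))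
    (differentiable_weightedPoly_windowPoint b x a n ψ)

/-- The entire function `u ↦ p + e^u N`. -/
def affineExp (p N : ℂ) : EntireFun :=
  EntireFun.ofDifferentiable (fun u => p + Complex.exp u * N) (by fun_prop)

/-- Locally finite integer-valued Borel measures on `ℂ`. -/
def PointMeasure : Type :=
  {ν : Measure ℂ // ∀ B : Set ℂ, Bornology.IsBounded B → MeasurableSet B → ∃ k : ℕ, ν B = k}

namespace PointMeasure

/-- The vague topology: the coarsest one that makes `ν ↦ ∫ φ dν` continuous for every continuous
compactly supported `φ`. -/
instance : TopologicalSpace PointMeasure :=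
  TopologicalSpace.induced (fun (ν : PointMeasure) (φ : C_c(ℂ, ℝ)) => ∫ z, φ z ∂ν.1) inferInstance

end PointMeasure

/-- `m`-tuples of point measures, with the product topology and its Borel sigma-algebra. -/
def PointMeasureTuple (m : ℕ) : Type := Fin m → PointMeasure

namespace PointMeasureTuple

instance (m : ℕ) : TopologicalSpace (PointMeasureTuple m) :=
  inferInstanceAs (TopologicalSpace (Fin m → PointMeasure))

instance (m : ℕ) : MeasurableSpace (PointMeasureTuple m) := borel _

instance (m : ℕ) : BorelSpace (PointMeasureTuple m) := ⟨rfl⟩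

end PointMeasureTuple

/-- The zero counting measure `∑_z ord_z(f) δ_z`, with multiplicities. For `f ≡ 0` it is the zero
measure, by convention. -/
def zeroMeasure (f : EntireFun) : Measure ℂ :=
  Measure.sum fun z : ℂ => (analyticOrderNatAt f.toFun z : ℝ≥0∞) • Measure.dirac z

theorem finite_zeros_of_isBounded (f : EntireFun) {B : Set ℂ} (hB : Bornology.IsBounded B) :
    {z ∈ B | analyticOrderNatAt f.toFun z ≠ 0}.Finite := by
  have hf : AnalyticOnNhd ℂ f.toFun Set.univ := fun z _ => f.differentiable.analyticAt z
  by_cases h0 : ∀ z, f.toFun z = 0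
  · convert! Set.finite_empty
    ext z
    have : f.toFun = fun _ => 0 := funext h0
    have h : analyticOrderAt f.toFun z = ⊤ := by
      rw [analyticOrderAt_eq_top, this]; simp
    simp [analyticOrderNatAt, h]
  · push Not at h0
    obtain ⟨w, hw⟩ := h0
    by_contra hinf
    obtain ⟨z, -, hz⟩ := (Set.Infinite.exists_accPt_of_subset_isCompact hinf
      hB.isCompact_closure (fun y hy => subset_closure hy.1))
    have hfreq : ∃ᶠ y in 𝓝[≠] z, f.toFun y = 0 := by
      rw [accPt_iff_frequently_nhdsNE] at hz
      refine hz.mono fun y hy => apply_eq_zero_of_analyticOrderNatAt_ne_zero hy.2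
    exact hw (hf.eqOn_zero_of_preconnected_of_frequently_eq_zero isPreconnected_univ
      (Set.mem_univ z) hfreq (Set.mem_univ w))

theorem zeroMeasure_isBounded (f : EntireFun) (B : Set ℂ) (hB : Bornology.IsBounded B)
    (hm : MeasurableSet B) : ∃ k : ℕ, zeroMeasure f B = k := by
  have hfin := finite_zeros_of_isBounded f hB
  refine ⟨∑ z ∈ hfin.toFinset, analyticOrderNatAt f.toFun z, ?_⟩
  rw [zeroMeasure, Measure.sum_apply _ hm, tsum_eq_sum (s := hfin.toFinset)]
  · push_cast
    refine Finset.sum_congr rfl fun z hz => ?_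
    rw [Set.Finite.mem_toFinset] at hz
    simp [Measure.dirac_apply' _ hm, hz.1]
  · intro z hz
    rw [Set.Finite.mem_toFinset] at hz
    by_cases hzB : z ∈ B
    · have : analyticOrderNatAt f.toFun z = 0 := by
        by_contra h
        exact hz ⟨hzB, h⟩
      simp [this]
    · simp [Measure.dirac_apply' _ hm, hzB]

/-- The zeros of an entire function as a point measure. -/
def zeros (f : EntireFun) : PointMeasure := ⟨zeroMeasure f, zeroMeasure_isBounded f⟩

/-- The counting measure of the lattice `c + 2 π i ℤ`. -/
def latticeMeasure (c : ℂ) : Measure ℂ :=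
  Measure.sum fun k : ℤ => Measure.dirac (c + 2 * (Real.pi : ℂ) * Complex.I * (k : ℂ))

end

/-!
Write `E = exp (i ψ)` for one of the angles. The polynomial `P_n (z_n (ψ, u))` has the terms
`b k * ξ k * E ^ k * exp (a n * k / (2 n)) * exp (u * k / n)`, and they are split at `k = n / 2`.

For fixed `k` both exponential factors tend to `1`, so that the lower half approximates
`P_{n/2} (E)`, a martingale bounded in `L²` that converges almost surely to `P_∞ (E)`
(`ae_tendsto_weightedPoly`). In the upper half the weight `exp (a n * k / n)` concentrates the
variance on the indices at distance `O(n / a n)` from `n`, where `exp (u * k / n)` is close to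
`exp u`. What remains is `exp u` times `highPart`, a sum of independent variables. Its covariances
are sums of `b k ^ 2 * exp (a n * k / n) * ω ^ k`, where `ω` is a product of two of the numbers `E` or
of one with the conjugate of another. By Potter's bounds `b k` may be replaced by `b n`, the sum
becomes geometric, and it converges to `1` if `ω = 1` and to `0` otherwise
(`IsCentering.tendsto_sum_high_mul_pow`). The only input on `a n` is that it tends to infinity, that
it is `o(n)`, and that `n * b n ^ 2 * exp (a n) / a n` tends to `1` (`IsCentering`); both centring
sequences have these properties. Lindeberg's theorem then makes `highPart` asymptotically Gaussian
(`tendstoInDistribution_highPart`), and it is independent of `P_{n/2} (E)`, which gives the joint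
limit with `N` independent of the series.

Tightness in the space of entire functions is avoided by working in a Hilbert space: the
functions `u ↦ exp (t u)`, `0 ≤ t ≤ 1`, lie in the image of `ℓ²` under a continuous linear map into
the entire functions (`CoeffSpace.toEntire`), so the error of the approximation is a random vector
with orthogonal terms, its second moment is computed termwise and tends to `0`
(`tendsto_sum_norm_remainderVec_sq`), and Slutsky's lemma and the continuous mapping theorem yield
`tendstoInDistribution_windowPoly`.

For the zeros, the argument principle shows that the zero measure is continuous in the vague
topology at every function that is not identically zero (`continuousAt_zeros`). As `N_j ≠ 0` almost
surely, the mapping theorem applies (`tendstoInDistribution_tupleZeros`). The limit function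
`P_∞ (E) + exp u * N_j` has a lattice of simple zeros as soon as also `P_∞ (E) ≠ 0`, which holds
almost surely because a convergent random series with infinitely many non-degenerate independent
terms has no atoms (`ae_weightedSeries_ne_zero`).
-/

noncomputable section

/-! ### Slow and regular variation -/

/-- The uniform convergence theorem for slowly varying functions, in additive form. For large `t` the
set of bad increments is small, by dominated convergence, so that two translates of such sets do not
cover an interval of length `1`; a point `t + r` outside both is close in value to `t` and `t + s`. -/
theorem exists_forall_abs_sub_le_of_tendsto_sub {h : ℝ → ℝ} (hm : Measurable h)
    (hlim : ∀ s : ℝ, Tendsto (fun t => h (t + s) - h t) atTop (𝓝 0)) {ε : ℝ} (hε : 0 < ε) :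
    ∃ T : ℝ, ∀ t ≥ T, ∀ s ∈ Set.Icc (0 : ℝ) 1, |h (t + s) - h t| ≤ ε := by
  -- the set of increments in `[0, 2]` that are bad at `t`
  set bad : ℝ → Set ℝ := fun t => {r | r ∈ Set.Icc (0 : ℝ) 2 ∧ ε / 2 ≤ |h (t + r) - h t|} with hbad
  have hbm : ∀ t, MeasurableSet (bad t) := fun t =>
    measurableSet_Icc.inter (measurableSet_le measurable_const
      ((((hm.comp (measurable_const.add measurable_id))).sub measurable_const).abs))
  have hD : Tendsto (fun t => volume (bad t)) atTop (𝓝 0) := by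
    have h1 : ∀ t, volume (bad t)
        = ∫⁻ r in Set.Icc (0 : ℝ) 2, (bad t).indicator (fun _ => (1 : ℝ≥0∞)) r := by
      intro t
      rw [lintegral_indicator_const (hbm t), one_mul, Measure.restrict_apply (hbm t),
        Set.inter_eq_left.2 (fun r hr => hr.1)]
    simp_rw [h1]
    have : (0 : ℝ≥0∞) = ∫⁻ r in Set.Icc (0 : ℝ) 2, 0 := by simp
    rw [this]
    refine tendsto_lintegral_filter_of_dominated_convergence (fun _ => 1) ?_ ?_ ?_ ?_
    · exact Eventually.of_forall fun t => measurable_const.indicator (hbm t)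
    · refine Eventually.of_forall fun t => ae_of_all _ fun r => ?_
      exact Set.indicator_le_self' (fun _ _ => zero_le) r
    · simp
    · refine ae_of_all _ fun r => ?_
      refine tendsto_const_nhds.congr' ?_
      have := (hlim r).abs
      rw [abs_zero] at this
      filter_upwards [this.eventually_lt_const (half_pos hε)] with t ht
      rw [Set.indicator_of_notMem]
      exact fun hr => absurd hr.2 (not_le.2 ht)
  obtain ⟨T, hT⟩ := eventually_atTop.1
    (hD.eventually_lt_const (show (0 : ℝ≥0∞) < 1 / 2 by simp))
  refine ⟨T, fun t ht s hs => ?_⟩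
  obtain ⟨r, hr, hrb⟩ : ∃ r ∈ Set.Icc s (s + 1), r ∉ bad t ∪ (fun x => x - s) ⁻¹' (bad (t + s)) := by
    by_contra! hcon
    have h2 : volume (Set.Icc s (s + 1)) < 1 := by
      calc volume (Set.Icc s (s + 1)) ≤ volume (bad t ∪ (fun x => x - s) ⁻¹' (bad (t + s))) :=
            measure_mono hcon
        _ ≤ volume (bad t) + volume ((fun x => x - s) ⁻¹' (bad (t + s))) := measure_union_le _ _
        _ = volume (bad t) + volume (bad (t + s)) := by
            rw [(measurePreserving_sub_right volume s).measure_preimage (hbm _).nullMeasurableSet]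
        _ < 1 / 2 + 1 / 2 := ENNReal.add_lt_add (hT t ht) (hT (t + s) (by linarith [hs.1]))
        _ = 1 := ENNReal.add_halves 1
    rw [Real.volume_Icc] at h2
    simp at h2
  simp only [Set.mem_union, Set.mem_preimage, not_or] at hrb
  obtain ⟨h3, h4⟩ := hrb
  have h5 : |h (t + r) - h t| < ε / 2 := by
    by_contra hc
    exact h3 ⟨⟨hs.1.trans hr.1, by linarith [hr.2, hs.2]⟩, not_lt.1 hc⟩
  have h6 : |h (t + r) - h (t + s)| < ε / 2 := by
    by_contra hc
    refine h4 ⟨⟨by linarith [hr.1], by linarith [hr.2]⟩, ?_⟩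
    rw [show t + s + (r - s) = t + r by ring]
    exact not_lt.1 hc
  rw [abs_lt] at h5 h6
  rw [abs_le]
  constructor <;> linarith

/-- Iteration of the uniform bound over unit steps gives a bound of linear growth. -/
theorem exists_forall_abs_sub_le_mul {h : ℝ → ℝ} (hm : Measurable h)
    (hlim : ∀ s : ℝ, Tendsto (fun t => h (t + s) - h t) atTop (𝓝 0)) {ε : ℝ} (hε : 0 < ε) :
    ∃ T : ℝ, ∀ t ≥ T, ∀ s ≥ (0 : ℝ), |h (t + s) - h t| ≤ ε * (1 + s) := by
  obtain ⟨T, hT⟩ := exists_forall_abs_sub_le_of_tendsto_sub hm hlim hε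
  refine ⟨T, fun t ht s hs => ?_⟩
  have key : ∀ n : ℕ, ∀ t ≥ T, ∀ s ∈ Set.Icc (0 : ℝ) n, |h (t + s) - h t| ≤ n * ε := by
    intro n
    induction n with
    | zero =>
      intro t ht s hs
      have : s = 0 := le_antisymm (by simpa using hs.2) hs.1
      simp [this]
    | succ n ih =>
      intro t ht s hs
      have hs2 := hs.2
      push_cast at hs2 ⊢
      by_cases h1 : s ≤ 1
      · refine (hT t ht s ⟨hs.1, h1⟩).trans ?_
        have : (0 : ℝ) ≤ n := n.cast_nonneg
        nlinarith
      · push Not at h1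
        have h2 := hT t ht 1 ⟨zero_le_one, le_rfl⟩
        have h3 := ih (t + 1) (by linarith) (s - 1) ⟨by linarith, by linarith⟩
        rw [show t + 1 + (s - 1) = t + s by ring] at h3
        have := abs_add_le (h (t + s) - h (t + 1)) (h (t + 1) - h t)
        rw [sub_add_sub_cancel] at this
        linarith
  refine (key ⌈s⌉₊ t ht s ⟨hs, Nat.le_ceil s⟩).trans ?_
  have := Nat.ceil_lt_add_one hs
  nlinarith

/-- Potter's bound. -/
theorem IsSlowlyVarying.exists_abs_log_sub_le {ℓ : ℝ → ℝ} (hℓ : IsSlowlyVarying ℓ) {ε : ℝ}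
    (hε : 0 < ε) : ∃ X : ℝ, 1 ≤ X ∧ ∀ x ≥ X, 0 < ℓ x ∧
      ∀ y ≥ x, |Real.log (ℓ y) - Real.log (ℓ x)| ≤ ε * (1 + Real.log (y / x)) := by
  have hm : Measurable fun t => Real.log (ℓ (Real.exp t)) := by
    have : Measurable fun t : ℝ => (⟨Real.exp t, Real.exp_pos t⟩ : Set.Ioi (0 : ℝ)) :=
      Real.measurable_exp.subtype_mk
    exact Real.measurable_log.comp (hℓ.measurable.comp this)
  have hlim : ∀ s : ℝ, Tendsto (fun t => Real.log (ℓ (Real.exp (t + s)))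
      - Real.log (ℓ (Real.exp t))) atTop (𝓝 0) := by
    intro s
    have h1 := ((hℓ.tendsto_ratio (Real.exp s) (Real.exp_pos s)).comp
      Real.tendsto_exp_atTop).log one_ne_zero
    rw [Real.log_one] at h1
    refine h1.congr' ?_
    have h2 : ∀ᶠ t in atTop, 0 < ℓ (Real.exp t) :=
      Real.tendsto_exp_atTop.eventually hℓ.eventually_pos
    have h3 : ∀ᶠ t in atTop, 0 < ℓ (Real.exp (t + s)) :=
      (tendsto_atTop_add_const_right _ s tendsto_id).eventually h2
    filter_upwards [h2, h3] with t ht ht'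
    rw [Real.exp_add, mul_comm] at ht'
    simp only [Function.comp_apply]
    rw [Real.log_div ht'.ne' ht.ne', Real.exp_add, mul_comm]
  obtain ⟨T, hT⟩ := exists_forall_abs_sub_le_mul hm hlim hε
  obtain ⟨X, hX⟩ := eventually_atTop.1 hℓ.eventually_pos
  refine ⟨max 1 (max X (Real.exp T)), le_max_left _ _, fun x hx => ⟨hX x ?_, fun y hy => ?_⟩⟩
  · exact ((le_max_left _ _).trans (le_max_right _ _)).trans hx
  · have hx0 : 0 < x := zero_lt_one.trans_le ((le_max_left _ _).trans hx)
    have hy0 : 0 < y := hx0.trans_le hy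
    have h1 : T ≤ Real.log x := by
      rw [Real.le_log_iff_exp_le hx0]
      exact ((le_max_right _ _).trans (le_max_right _ _)).trans hx
    have h2 := hT (Real.log x) h1 (Real.log (y / x))
      (Real.log_nonneg (by rwa [le_div_iff₀ hx0, one_mul]))
    rwa [Real.log_div hy0.ne' hx0.ne', add_sub_cancel, Real.exp_log hy0, Real.exp_log hx0,
      ← Real.log_div hy0.ne' hx0.ne'] at h2

/-- Potter's bound for regularly varying functions. -/
theorem IsRegularlyVarying.exists_abs_log_sub_le {b : ℝ → ℝ} {α : ℝ} (hb : IsRegularlyVarying b α)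
    {ε : ℝ} (hε : 0 < ε) : ∃ X : ℝ, 1 ≤ X ∧ ∀ x ≥ X, 0 < b x ∧ ∀ y ≥ x,
      |Real.log (b y) - Real.log (b x) - α * Real.log (y / x)| ≤ ε * (1 + Real.log (y / x)) := by
  obtain ⟨ℓ, hℓ, hbl⟩ := hb
  obtain ⟨X, hX1, hX⟩ := hℓ.exists_abs_log_sub_le hε
  have hlog : ∀ x ≥ X, Real.log (b x) = α * Real.log x + Real.log (ℓ x) := fun x hx => by
    have hx0 : 0 < x := by linarith
    rw [hbl x hx0, Real.log_mul (Real.rpow_pos_of_pos hx0 _).ne' (hX x hx).1.ne',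
      Real.log_rpow hx0]
  refine ⟨X, hX1, fun x hx => ⟨?_, fun y hy => ?_⟩⟩
  · have hx0 : 0 < x := by linarith
    rw [hbl x hx0]
    exact mul_pos (Real.rpow_pos_of_pos hx0 _) (hX x hx).1
  · have hx0 : 0 < x := by linarith
    have hy0 : 0 < y := by linarith
    have := (hX x hx).2 y hy
    rw [hlog x hx, hlog y (by linarith)]
    rw [Real.log_div hy0.ne' hx0.ne'] at this ⊢
    convert this using 2
    ring

theorem IsRegularlyVarying.eventually_pos {b : ℝ → ℝ} {α : ℝ} (hb : IsRegularlyVarying b α) :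
    ∀ᶠ n : ℕ in atTop, 0 < b n := by
  obtain ⟨X, -, hX⟩ := hb.exists_abs_log_sub_le one_pos
  filter_upwards [tendsto_natCast_atTop_atTop.eventually_ge_atTop X] with n hn using (hX n hn).1

theorem IsRegularlyVarying.tendsto_log_div_log {b : ℝ → ℝ} {α : ℝ} (hb : IsRegularlyVarying b α) :
    Tendsto (fun n : ℕ => Real.log (b n) / Real.log n) atTop (𝓝 α) := by
  have hlog : Tendsto (fun n : ℕ => Real.log n) atTop atTop :=
    Real.tendsto_log_atTop.comp tendsto_natCast_atTop_atTop
  rw [Metric.tendsto_nhds]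
  intro ε hε
  obtain ⟨X, hX1, hX⟩ := hb.exists_abs_log_sub_le (half_pos hε)
  have hX0 : 0 < X := by linarith
  set K := |Real.log (b X)| + |α * Real.log X| + ε with hK
  have hK : Tendsto (fun n : ℕ => K / Real.log n) atTop (𝓝 0) := tendsto_const_nhds.div_atTop hlog
  filter_upwards [tendsto_natCast_atTop_atTop.eventually_ge_atTop X,
    hK.eventually_lt_const (half_pos hε), hlog.eventually_gt_atTop 0] with n hn hKn hln
  have hn0 : (0 : ℝ) < n := by linarith
  have h := (hX X le_rfl).2 n hn
  have hlX : 0 ≤ Real.log X := Real.log_nonneg hX1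
  rw [Real.log_div hn0.ne' hX0.ne'] at h
  rw [div_lt_iff₀ hln] at hKn
  rw [Real.dist_eq, div_sub' hln.ne', abs_div, abs_of_pos hln, div_lt_iff₀ hln]
  have e1 := abs_le.1 h
  have e2 := neg_abs_le (Real.log (b X))
  have e3 := le_abs_self (Real.log (b X))
  have e4 := neg_abs_le (α * Real.log X)
  have e5 := le_abs_self (α * Real.log X)
  have e6 : 0 ≤ ε * Real.log X := by positivity
  rw [abs_lt]
  constructor <;> nlinarith [e1.1, e1.2]

/-- Potter's bound for the squares, in multiplicative form. -/
theorem IsRegularlyVarying.exists_sq_le_sq_mul_exp {b : ℝ → ℝ} {α : ℝ}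
    (hb : IsRegularlyVarying b α) {ε : ℝ} (hε : 0 < ε) :
    ∃ X : ℝ, 1 ≤ X ∧ ∀ x ≥ X, 0 < b x ∧ ∀ y ≥ x,
      b x ^ 2 ≤ b y ^ 2 * Real.exp (2 * ε * (1 + Real.log (y / x)) - 2 * α * Real.log (y / x)) ∧
      b y ^ 2 ≤ b x ^ 2 * Real.exp (2 * ε * (1 + Real.log (y / x)) + 2 * α * Real.log (y / x)) := by
  obtain ⟨X, hX1, hX⟩ := hb.exists_abs_log_sub_le hε
  refine ⟨X, hX1, fun x hx => ⟨(hX x hx).1, fun y hy => ?_⟩⟩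
  have hbx := (hX x hx).1
  have hby := (hX y (by linarith)).1
  have h := abs_le.1 ((hX x hx).2 y hy)
  have hsq : ∀ z : ℝ, 0 < z → z ^ 2 = Real.exp (2 * Real.log z) := fun z hz => by
    rw [mul_comm, Real.exp_mul, Real.exp_log hz, Real.rpow_two]
  rw [hsq _ hbx, hsq _ hby, ← Real.exp_add, ← Real.exp_add, Real.exp_le_exp, Real.exp_le_exp]
  constructor <;> linarith [h.1, h.2]

/-- The coefficients with index in `(n / 2, n]` are comparable to `b n`. -/
theorem IsRegularlyVarying.exists_sq_le_mul_sq {b : ℝ → ℝ} {α : ℝ}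
    (hb : IsRegularlyVarying b α) : ∃ C : ℝ, 0 < C ∧ ∀ᶠ n : ℕ in atTop,
      ∀ k ∈ Finset.Ioc (n / 2) n, b k ^ 2 ≤ C * b n ^ 2 ∧ b n ^ 2 ≤ C * b k ^ 2 := by
  obtain ⟨X, hX1, hX⟩ := hb.exists_sq_le_sq_mul_exp one_pos
  refine ⟨Real.exp (4 + 2 * |α|), Real.exp_pos _, ?_⟩
  filter_upwards [tendsto_natCast_atTop_atTop.eventually_ge_atTop (2 * X)] with n hn k hk
  rw [Finset.mem_Ioc] at hk
  have hk1 : (n : ℝ) ≤ 2 * k := by exact_mod_cast (by omega : n ≤ 2 * k)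
  have hkn : (k : ℝ) ≤ n := by exact_mod_cast hk.2
  have hk0 : (0 : ℝ) < k := by linarith
  obtain ⟨h1, h2⟩ := (hX k (by linarith)).2 n hkn
  have hl0 : 0 ≤ Real.log ((n : ℝ) / k) := Real.log_nonneg (by rwa [le_div_iff₀ hk0, one_mul])
  have hl1 : Real.log ((n : ℝ) / k) ≤ 1 := by
    have : Real.log ((n : ℝ) / k) ≤ n / k - 1 := Real.log_le_sub_one_of_pos (div_pos (by linarith) hk0)
    have h3 : (n : ℝ) / k ≤ 2 := by rwa [div_le_iff₀ hk0]
    linarith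
  have e1 := neg_abs_le α
  have e2 := le_abs_self α
  have hα0 := abs_nonneg α
  constructor
  · refine h1.trans ?_
    rw [mul_comm]
    refine mul_le_mul_of_nonneg_right (Real.exp_le_exp.2 ?_) (sq_nonneg _)
    nlinarith
  · refine h2.trans ?_
    rw [mul_comm]
    refine mul_le_mul_of_nonneg_right (Real.exp_le_exp.2 ?_) (sq_nonneg _)
    nlinarith

theorem IsRegularlyVarying.summable_sq {b : ℝ → ℝ} {α : ℝ} (hb : IsRegularlyVarying b α)
    (hα : α ≤ -1 / 2) (hb_sq : α = -1 / 2 → Summable fun k : ℕ => b k ^ 2) :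
    Summable fun k : ℕ => b k ^ 2 := by
  rcases hα.eq_or_lt with h | h
  · exact hb_sq h
  set ε : ℝ := (-1 / 2 - α) / 2 with hε
  have hε0 : 0 < ε := by rw [hε]; linarith
  obtain ⟨X, hX1, hX⟩ := hb.exists_sq_le_sq_mul_exp hε0
  have hX0 : 0 < X := by linarith
  refine summable_of_isBigO_nat (g := fun k : ℕ => (k : ℝ) ^ (2 * ε + 2 * α))
    (Real.summable_nat_rpow.2 (by rw [hε]; linarith)) ?_
  refine Asymptotics.IsBigO.of_bound
    (b X ^ 2 * Real.exp (2 * ε) * Real.exp (-(2 * ε + 2 * α) * Real.log X)) ?_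
  filter_upwards [tendsto_natCast_atTop_atTop.eventually_ge_atTop X] with n hn
  have hn0 : (0 : ℝ) < n := by linarith
  have h1 := ((hX X le_rfl).2 n hn).2
  rw [Real.norm_of_nonneg (sq_nonneg _), Real.norm_of_nonneg (by positivity)]
  refine h1.trans (le_of_eq ?_)
  rw [Real.rpow_def_of_pos hn0, mul_assoc (b X ^ 2), mul_assoc (b X ^ 2), ← Real.exp_add, ← Real.exp_add,
    Real.log_div hn0.ne' hX0.ne']
  ring_nf

/-- `n * b n ^ 2` is at most a multiple of the block `∑ b k ^ 2` over `n / 2 < k ≤ n`, which tends to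
`0` as a difference of partial sums. -/
theorem IsRegularlyVarying.tendsto_nat_mul_sq {b : ℝ → ℝ} {α : ℝ} (hb : IsRegularlyVarying b α)
    (hs : Summable fun k : ℕ => b k ^ 2) :
    Tendsto (fun n : ℕ => (n : ℝ) * b n ^ 2) atTop (𝓝 0) := by
  obtain ⟨C, hC, h⟩ := hb.exists_sq_le_mul_sq
  have h1 := hs.hasSum.tendsto_sum_nat
  have hhalf : Tendsto (fun n : ℕ => n / 2 + 1) atTop atTop :=
    tendsto_atTop_atTop.2 fun m => ⟨2 * m, fun n hn => by omega⟩
  have h2 := ((h1.comp (tendsto_add_atTop_nat 1)).sub (h1.comp hhalf)).const_mul (2 * C)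
  rw [sub_self, mul_zero] at h2
  refine squeeze_zero' (Eventually.of_forall fun n => by positivity) ?_ h2
  filter_upwards [h] with n hn
  simp only [Function.comp_apply]
  rw [← Finset.sum_Ico_eq_sub _ (by omega : n / 2 + 1 ≤ n + 1), Finset.mul_sum]
  calc (n : ℝ) * b n ^ 2 ≤ 2 * ((n - n / 2 : ℕ) : ℝ) * b n ^ 2 := by
        gcongr
        exact_mod_cast (by omega : n ≤ 2 * (n - n / 2))
    _ = ∑ k ∈ Finset.Ico (n / 2 + 1) (n + 1), 2 * b n ^ 2 := by
        rw [Finset.sum_const, Nat.card_Ico, nsmul_eq_mul, Nat.add_sub_add_right]; ring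
    _ ≤ _ := by
        refine Finset.sum_le_sum fun k hk => ?_
        rw [Finset.mem_Ico] at hk
        have := (hn k (Finset.mem_Ioc.2 ⟨by omega, by omega⟩)).2
        nlinarith

/-! ### Centring sequences -/

/-- The three properties of the centring sequence that the limit theorem uses. The last one fixes
`a n` up to `o(1)`; it makes the variance of the terms with index near `n` converge. -/
structure IsCentering (b : ℝ → ℝ) (a : ℕ → ℝ) : Prop where
  tendsto_atTop : Tendsto a atTop atTop
  tendsto_div : Tendsto (fun n => a n / n) atTop (𝓝 0)
  tendsto_ratio : Tendsto (fun n : ℕ => n * b n ^ 2 * Real.exp (a n) / a n) atTop (𝓝 1)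

theorem tendsto_log_nat_div_nat : Tendsto (fun n : ℕ => Real.log n / n) atTop (𝓝 0) :=
  (Real.isLittleO_log_id_atTop.tendsto_div_nhds_zero).comp tendsto_natCast_atTop_atTop

theorem lambertWm1_spec {x : ℝ} (hx : x ∈ Set.Ico (-Real.exp (-1)) 0) :
    lambertWm1 x ≤ -1 ∧ lambertWm1 x * Real.exp (lambertWm1 x) = x := by
  have hlim : Tendsto (fun w : ℝ => w * Real.exp w) atBot (𝓝 0) := by
    have := ((Real.tendsto_pow_mul_exp_neg_atTop_nhds_zero 1).comp tendsto_neg_atBot_atTop).neg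
    rw [neg_zero] at this
    refine this.congr fun w => ?_
    simp
  obtain ⟨w₀, hw₀⟩ := eventually_atBot.1 (hlim.eventually_const_lt hx.2)
  set w₁ := min w₀ (-1)
  have hw1 := hw₀ w₁ (min_le_left _ _)
  have hcont : ContinuousOn (fun w : ℝ => w * Real.exp w) (Set.Icc w₁ (-1)) := by fun_prop
  -- `lambertWm1` is a generic inverse on `(-∞, -1]`, so that only the existence of `w` is at stake
  obtain ⟨w, hw, hwx⟩ := intermediate_value_Icc' (min_le_right w₀ (-1)) hcont
    (show x ∈ Set.Icc _ _ from ⟨by simpa using hx.1, hw1.le⟩)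
  have hmem : ∃ w ∈ Set.Iic (-1 : ℝ), w * Real.exp w = x := ⟨w, hw.2, hwx⟩
  exact ⟨Function.invFunOn_mem hmem, Function.invFunOn_eq hmem⟩

theorem eventually_neg_mem_Ico {b : ℝ → ℝ} {α : ℝ} (hb : IsRegularlyVarying b α)
    (hs : Summable fun k : ℕ => b k ^ 2) :
    ∀ᶠ n : ℕ in atTop, -(n * b n ^ 2) ∈ Set.Ico (-Real.exp (-1)) 0 := by
  filter_upwards [(hb.tendsto_nat_mul_sq hs).eventually_le_const (Real.exp_pos (-1)),
    hb.eventually_pos, eventually_gt_atTop 0] with n h1 h2 h3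
  have : (0 : ℝ) < n := by exact_mod_cast h3
  refine ⟨neg_le_neg h1, neg_neg_of_pos (by positivity)⟩

/-- The defining equation of `W₋₁` says that `n * b n ^ 2 * exp (a n) = a n`. -/
theorem isCentering_lambert {b : ℝ → ℝ} {α : ℝ} (hb : IsRegularlyVarying b α)
    (hs : Summable fun k : ℕ => b k ^ 2) {a : ℕ → ℝ}
    (ha : ∀ n : ℕ, a n = -lambertWm1 (-(n * b n ^ 2))) : IsCentering b a := by
  have hev : ∀ᶠ n : ℕ in atTop, 1 ≤ a n ∧ n * b n ^ 2 * Real.exp (a n) = a n := by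
    filter_upwards [eventually_neg_mem_Ico hb hs] with n hn
    obtain ⟨h1, h2⟩ := lambertWm1_spec hn
    rw [show lambertWm1 (-(n * b n ^ 2)) = -a n by rw [ha, neg_neg]] at h1 h2
    refine ⟨by linarith, ?_⟩
    have : (n : ℝ) * b n ^ 2 = a n * Real.exp (-a n) := by linarith
    rw [this, mul_assoc, ← Real.exp_add, neg_add_cancel, Real.exp_zero, mul_one]
  have hlim := hb.tendsto_nat_mul_sq hs
  refine ⟨?_, ?_, ?_⟩
  · refine tendsto_atTop.2 fun K => ?_
    filter_upwards [hev, hlim.eventually_lt_const (Real.exp_pos (-K))] with n ⟨h1, h2⟩ h3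
    -- if `a n < K` then `a n = n b(n)² exp (a n) < exp (-K) exp (a n) < 1`
    by_contra! hlt
    have h4 : n * b n ^ 2 * Real.exp (a n) < Real.exp (-K) * Real.exp (a n) := by gcongr
    rw [← Real.exp_add] at h4
    have h5 : Real.exp (-K + a n) ≤ 1 := Real.exp_le_one_iff.2 (by linarith)
    linarith
  -- `a n = log (a n) - log n - 2 log (b n)` and `log (a n) ≤ a n / 2`, so that `a n = O(log n)`
  · have hlog := hb.tendsto_log_div_log
    have hup : Tendsto (fun n : ℕ => 2 * (-(Real.log n / n)
        - 2 * (Real.log (b n) / Real.log n * (Real.log n / n)))) atTop (𝓝 0) := by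
      have := ((tendsto_log_nat_div_nat.neg).sub
        ((hlog.mul tendsto_log_nat_div_nat).const_mul 2)).const_mul 2
      simpa using this
    refine squeeze_zero' ?_ ?_ hup
    · filter_upwards [hev] with n hn
      exact div_nonneg (by linarith [hn.1]) n.cast_nonneg
    · filter_upwards [hev, hb.eventually_pos, eventually_gt_atTop 1] with n ⟨h1, h2⟩ hbn hn
      have hn1 : (1 : ℝ) < n := by exact_mod_cast hn
      have hn0 : (0 : ℝ) < n := by linarith
      have hln : 0 < Real.log n := Real.log_pos hn1
      have h3 : Real.log (a n) = Real.log n + 2 * Real.log (b n) + a n := by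
        conv_lhs => rw [← h2]
        rw [Real.log_mul (by positivity) (Real.exp_pos _).ne', Real.log_exp,
          Real.log_mul hn0.ne' (by positivity), Real.log_pow]
        push_cast
        ring
      have h4 : Real.log (a n) ≤ a n / 2 := by
        have e1 := Real.log_le_sub_one_of_pos (show 0 < a n / 2 by linarith)
        rw [Real.log_div (by linarith) two_ne_zero] at e1
        have e2 := Real.log_two_lt_d9
        linarith
      have h5 : a n ≤ 2 * (-Real.log n - 2 * Real.log (b n)) := by linarith
      calc a n / n ≤ 2 * (-Real.log n - 2 * Real.log (b n)) / n := by gcongr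
        _ = _ := by field_simp
  · refine tendsto_const_nhds.congr' ?_
    filter_upwards [hev] with n ⟨h1, h2⟩
    rw [h2, div_self (by linarith)]

/-- Here `n * b n ^ 2 * exp (a n) = (-2 α - 1) log n` exactly, and `a n` is asymptotic to
`(-2 α - 1) log n` because `log (b n)` is asymptotic to `α log n`. -/
theorem isCentering_log {b : ℝ → ℝ} {α : ℝ} (hb : IsRegularlyVarying b α) (hα : α < -1 / 2)
    {a : ℕ → ℝ} (ha : ∀ n : ℕ, a n = -2 * Real.log (b n) - Real.log n + Real.log (Real.log n)
      + Real.log (-2 * α - 1)) : IsCentering b a := by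
  have hκ : 0 < -2 * α - 1 := by linarith
  have hlog := hb.tendsto_log_div_log
  have hlogn : Tendsto (fun n : ℕ => Real.log n) atTop atTop :=
    Real.tendsto_log_atTop.comp tendsto_natCast_atTop_atTop
  have hratio : Tendsto (fun n : ℕ => a n / Real.log n) atTop (𝓝 (-2 * α - 1)) := by
    have h1 : Tendsto (fun n : ℕ => Real.log (Real.log n) / Real.log n) atTop (𝓝 0) :=
      (Real.isLittleO_log_id_atTop.tendsto_div_nhds_zero).comp hlogn
    have h2 : Tendsto (fun n : ℕ => Real.log (-2 * α - 1) / Real.log n) atTop (𝓝 0) :=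
      tendsto_const_nhds.div_atTop hlogn
    have h3 := (((hlog.const_mul (-2)).sub_const 1).add h1).add h2
    rw [add_zero, add_zero] at h3
    refine h3.congr' ?_
    filter_upwards [hlogn.eventually_gt_atTop 0] with n hn
    rw [ha]
    field_simp
  have htop : Tendsto a atTop atTop := by
    refine (hratio.pos_mul_atTop hκ hlogn).congr' ?_
    filter_upwards [hlogn.eventually_gt_atTop 0] with n hn
    field_simp
  refine ⟨htop, ?_, ?_⟩
  · have := hratio.mul tendsto_log_nat_div_nat
    rw [mul_zero] at this
    refine this.congr' ?_
    filter_upwards [hlogn.eventually_gt_atTop 0] with n hn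
    field_simp
  · have := (hratio.inv₀ hκ.ne').const_mul (-2 * α - 1)
    rw [mul_inv_cancel₀ hκ.ne'] at this
    refine this.congr' ?_
    filter_upwards [hlogn.eventually_gt_atTop 0, hb.eventually_pos, eventually_gt_atTop 0,
      htop.eventually_gt_atTop 0] with n hn hbn hn0 han
    have hn0' : (0 : ℝ) < n := by exact_mod_cast hn0
    have hexp : Real.exp (a n) = (b n ^ 2)⁻¹ * (n : ℝ)⁻¹ * Real.log n * (-2 * α - 1) := by
      rw [ha, Real.exp_add, Real.exp_add, Real.exp_log hκ, Real.exp_log hn, sub_eq_add_neg,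
        Real.exp_add, Real.exp_neg, Real.exp_log hn0', neg_mul, Real.exp_neg, mul_comm 2,
        Real.exp_mul, Real.exp_log hbn, Real.rpow_two]
    rw [hexp]
    field_simp

/-! ### Weighted sums of the squared coefficients -/

/-- Terms with index at most `n / 2` are negligible, for weights that are dominated by
`exp (a n * k / n)` and vanish termwise: up to `n / a n` the weights are bounded, so that the sum is
dominated by `∑ b k ^ 2`; beyond, Potter's bound compares `b k` with `b n`, and the factor
`exp (a n / 2)` is negligible against `exp (a n)`. -/
theorem IsCentering.tendsto_sum_low {b : ℝ → ℝ} {α : ℝ} (hb : IsRegularlyVarying b α)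
    (hs : Summable fun k : ℕ => b k ^ 2) {a : ℕ → ℝ} (ha : IsCentering b a) {θ : ℕ → ℕ → ℝ}
    (h0 : ∀ n k, 0 ≤ θ n k)
    (hle : ∀ᶠ n in atTop, ∀ k ≤ n / 2, θ n k ≤ Real.exp (a n * k / n))
    (hlim : ∀ k, Tendsto (fun n => θ n k) atTop (𝓝 0)) :
    Tendsto (fun n : ℕ => ∑ k ∈ Finset.range (n / 2 + 1), b k ^ 2 * θ n k) atTop (𝓝 0) := by
  classical
  -- `F` collects the terms with `k ≤ n / a n`, and `δ n` bounds each of the others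
  set F : ℕ → ℕ → ℝ := fun n k => if k ≤ n / 2 ∧ a n * k ≤ n then b k ^ 2 * θ n k else 0 with hF
  have hF0 : ∀ n k, 0 ≤ F n k := fun n k => by
    simp only [hF]
    split_ifs
    · exact mul_nonneg (sq_nonneg _) (h0 n k)
    · exact le_rfl
  have hFlim : Tendsto (fun n => ∑' k, F n k) atTop (𝓝 0) := by
    have : (0 : ℝ) = ∑' _ : ℕ, (0 : ℝ) := by simp
    rw [this]
    refine tendsto_tsum_of_dominated_convergence (bound := fun k : ℕ => b k ^ 2 * Real.exp 1)
      (hs.mul_right _) (fun k => ?_) ?_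
    · have h1 := (hlim k).const_mul (b k ^ 2)
      rw [mul_zero] at h1
      refine squeeze_zero (fun n => hF0 n k) (fun n => ?_) h1
      simp only [hF]
      split_ifs
      · exact le_rfl
      · exact mul_nonneg (sq_nonneg _) (h0 n k)
    · filter_upwards [hle, eventually_gt_atTop 0] with n hn hn0 k
      have hn0' : (0 : ℝ) < n := by exact_mod_cast hn0
      rw [Real.norm_of_nonneg (hF0 n k)]
      simp only [hF]
      split_ifs with hk
      · refine mul_le_mul_of_nonneg_left ((hn k hk.1).trans (Real.exp_le_exp.2 ?_)) (sq_nonneg _)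
        rw [div_le_one hn0']
        exact hk.2
      · positivity
  obtain ⟨X, hX1, hX⟩ := hb.exists_sq_le_sq_mul_exp one_pos
  set δ : ℕ → ℝ := fun n => b n ^ 2 * (Real.exp 2 * a n ^ (2 + 2 * |α|) * Real.exp (a n / 2))
  -- `n δ n` is the bounded ratio `n b(n)² exp (a n) / a n` times a power of `a n` times `exp (-a n / 2)`
  have hδ : Tendsto (fun n => n * δ n) atTop (𝓝 0) := by
    have h1 : Tendsto (fun n => a n ^ (3 + 2 * |α|) * Real.exp (-(1 / 2) * a n)) atTop (𝓝 0) :=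
      (tendsto_rpow_mul_exp_neg_mul_atTop_nhds_zero _ _ (by norm_num)).comp ha.tendsto_atTop
    have h2 := (ha.tendsto_ratio.mul h1).const_mul (Real.exp 2)
    rw [mul_zero, mul_zero] at h2
    refine h2.congr' ?_
    filter_upwards [ha.tendsto_atTop.eventually_gt_atTop 0] with n hn
    have e1 : a n ^ (3 + 2 * |α|) = a n * a n ^ (2 + 2 * |α|) := by
      rw [show 3 + 2 * |α| = 1 + (2 + 2 * |α|) by ring, Real.rpow_add hn, Real.rpow_one]
    have e2 : Real.exp (a n) * Real.exp (-(1 / 2) * a n) = Real.exp (a n / 2) := by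
      rw [← Real.exp_add]; ring_nf
    simp only [δ]
    rw [e1, ← e2]
    field_simp
  have hupper := hFlim.add hδ
  rw [add_zero] at hupper
  refine squeeze_zero' (Eventually.of_forall fun n => Finset.sum_nonneg fun k _ =>
    mul_nonneg (sq_nonneg _) (h0 n k)) ?_ hupper
  filter_upwards [hle, eventually_ge_atTop 2, ha.tendsto_atTop.eventually_ge_atTop 1,
    ha.tendsto_div.eventually_lt_const (show (0 : ℝ) < 1 / X by positivity)] with n hn hn2 han hanX
  have hn0 : (0 : ℝ) < n := by exact_mod_cast (by omega : 0 < n)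
  have han0 : 0 < a n := by linarith
  have hδ0 : 0 ≤ δ n := by positivity
  have hterm : ∀ k ∈ Finset.range (n / 2 + 1), b k ^ 2 * θ n k ≤ F n k + δ n := by
    intro k hk
    have hk2 : k ≤ n / 2 := by simpa [Nat.lt_succ_iff] using hk
    by_cases hc : a n * k ≤ n
    · simp only [hF]
      rw [if_pos ⟨hk2, hc⟩]
      linarith
    · have : F n k = 0 := by simp only [hF]; rw [if_neg (fun h => hc h.2)]
      rw [this, zero_add]
      push Not at hc
      have hk0 : (0 : ℝ) < k := by
        by_contra! hneg
        nlinarith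
      have hkn : (2 * k : ℝ) ≤ n := by exact_mod_cast (by omega : 2 * k ≤ n)
      have hkX : X ≤ k := by
        have h1 : a n / n < 1 / X := hanX
        have hX0 : 0 < X := by linarith
        rw [div_lt_div_iff₀ hn0 hX0] at h1
        by_contra! hlt
        nlinarith
      have h1 := ((hX k hkX).2 n (by linarith)).1
      have hrat : (n : ℝ) / k ≤ a n := by
        rw [div_le_iff₀ hk0]
        exact hc.le
      have hl0 : 0 ≤ Real.log ((n : ℝ) / k) :=
        Real.log_nonneg (by rw [le_div_iff₀ hk0]; linarith)
      have hl1 : Real.log ((n : ℝ) / k) ≤ Real.log (a n) := Real.log_le_log (by positivity) hrat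
      have e1 := neg_abs_le α
      have hα0 := abs_nonneg α
      have h2 : Real.exp (2 * 1 * (1 + Real.log ((n : ℝ) / k)) - 2 * α * Real.log ((n : ℝ) / k))
          ≤ Real.exp 2 * a n ^ (2 + 2 * |α|) := by
        rw [Real.rpow_def_of_pos han0, ← Real.exp_add]
        refine Real.exp_le_exp.2 ?_
        nlinarith
      have h3 : θ n k ≤ Real.exp (a n / 2) := by
        refine (hn k hk2).trans (Real.exp_le_exp.2 ?_)
        rw [div_le_div_iff₀ hn0 two_pos]
        nlinarith
      calc b k ^ 2 * θ n k ≤ (b n ^ 2 * (Real.exp 2 * a n ^ (2 + 2 * |α|))) * Real.exp (a n / 2) := by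
            refine mul_le_mul (h1.trans ?_) h3 (h0 n k) (by positivity)
            exact mul_le_mul_of_nonneg_left h2 (sq_nonneg _)
        _ = δ n := by simp only [δ]; ring
  calc ∑ k ∈ Finset.range (n / 2 + 1), b k ^ 2 * θ n k
      ≤ ∑ k ∈ Finset.range (n / 2 + 1), (F n k + δ n) := Finset.sum_le_sum hterm
    _ = ∑' k, F n k + ((n / 2 + 1 : ℕ) : ℝ) * δ n := by
        rw [Finset.sum_add_distrib, Finset.sum_const, Finset.card_range, nsmul_eq_mul,
          tsum_eq_sum (s := Finset.range (n / 2 + 1))]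
        intro k hk
        simp only [hF]
        rw [if_neg]
        simp only [Finset.mem_range] at hk
        omega
    _ ≤ ∑' k, F n k + n * δ n := by
        gcongr
        omega

theorem sum_Ioc_half_eq {M : Type*} [AddCommMonoid M] (n : ℕ) (f : ℕ → M) :
    ∑ k ∈ Finset.Ioc (n / 2) n, f k = ∑ j ∈ Finset.range (n - n / 2), f (n - j) := by
  refine Finset.sum_nbij' (fun k => n - k) (fun j => n - j) ?_ ?_ ?_ ?_ ?_
  · intro k hk; simp only [Finset.mem_Ioc, Finset.mem_range] at *; omega
  · intro k hk; simp only [Finset.mem_Ioc, Finset.mem_range] at *; omega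
  · intro k hk; simp only [Finset.mem_Ioc] at *; omega
  · intro k hk; simp only [Finset.mem_range] at *; omega
  · intro k hk
    simp only [Finset.mem_Ioc] at hk
    rw [Nat.sub_sub_self hk.2]

theorem sum_exp_neg_mul_le {x : ℝ} (hx : 0 < x) (hx1 : x ≤ 1) (J : ℕ) :
    ∑ j ∈ Finset.range J, Real.exp (-(x * j)) ≤ 2 / x := by
  have hr1 : Real.exp (-x) < 1 := Real.exp_lt_one_iff.mpr (by linarith)
  have h1 : ∑ j ∈ Finset.range J, Real.exp (-(x * j)) = ∑ j ∈ Finset.range J, Real.exp (-x) ^ j := by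
    refine Finset.sum_congr rfl fun j _ => ?_
    rw [← Real.exp_nat_mul]
    ring_nf
  have h2 : ∑ j ∈ Finset.range J, Real.exp (-x) ^ j ≤ (1 - Real.exp (-x))⁻¹ := by
    rw [← tsum_geometric_of_lt_one (Real.exp_pos _).le hr1]
    exact (summable_geometric_of_lt_one (Real.exp_pos _).le hr1).sum_le_tsum _
      (fun _ _ => by positivity)
  have h3 : Real.exp (-x) ≤ 1 / (1 + x) := by
    rw [Real.exp_neg, ← one_div]
    exact one_div_le_one_div_of_le (by linarith) (by linarith [Real.add_one_le_exp x])
  have h4 : x / 2 ≤ 1 - Real.exp (-x) := by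
    have : x / 2 ≤ 1 - 1 / (1 + x) := by
      rw [le_sub_iff_add_le, div_add_div _ _ two_ne_zero (by linarith), div_le_one (by linarith)]
      nlinarith
    linarith
  rw [h1]
  refine h2.trans ?_
  rw [inv_le_comm₀ (by linarith) (by positivity), inv_div]
  exact h4

theorem IsCentering.tendsto_sq_mul_exp {b : ℝ → ℝ} {a : ℕ → ℝ} (ha : IsCentering b a) :
    Tendsto (fun n : ℕ => b n ^ 2 * Real.exp (a n)) atTop (𝓝 0) := by
  have := ha.tendsto_ratio.mul ha.tendsto_div
  rw [mul_zero] at this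
  refine this.congr' ?_
  filter_upwards [ha.tendsto_atTop.eventually_gt_atTop 0, eventually_gt_atTop 0] with n h1 h2
  have : (0 : ℝ) < n := by exact_mod_cast h2
  field_simp

theorem exp_mul_sub_div {a : ℝ} {n j : ℕ} (hj : j ≤ n) (hn : 0 < n) :
    Real.exp (a * ((n - j : ℕ) : ℝ) / n) = Real.exp a * Real.exp (-(a / n * j)) := by
  have : (0 : ℝ) < n := by exact_mod_cast hn
  rw [← Real.exp_add, Nat.cast_sub hj]
  congr 1
  field_simp
  ring

/-- The substitution `k = n - j` turns the weight into `exp (a n) * exp (-x)`, `x = a n / n * j`, and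
`1 - k / n` into `x / a n`, so that the sum is of the order of `(a n)⁻¹ ^ 2`. -/
theorem IsCentering.tendsto_sum_high_aux {b : ℝ → ℝ} {a : ℕ → ℝ} (ha : IsCentering b a) :
    Tendsto (fun n : ℕ => ∑ k ∈ Finset.Ioc (n / 2) n,
      b n ^ 2 * Real.exp (a n * k / n) * (1 - k / n : ℝ) ^ 2) atTop (𝓝 0) := by
  have hup : Tendsto (fun n : ℕ => 32 * (n * b n ^ 2 * Real.exp (a n) / a n) * (a n)⁻¹ ^ 2)
      atTop (𝓝 0) := by
    have := (ha.tendsto_ratio.const_mul 32).mul ((tendsto_inv_atTop_zero.comp ha.tendsto_atTop).pow 2)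
    simpa using this
  refine squeeze_zero' (Eventually.of_forall fun n => Finset.sum_nonneg fun k _ =>
    mul_nonneg (mul_nonneg (sq_nonneg _) (Real.exp_pos _).le) (sq_nonneg _)) ?_ hup
  filter_upwards [ha.tendsto_atTop.eventually_gt_atTop 0, eventually_gt_atTop 0,
    ha.tendsto_div.eventually_le_const one_pos] with n han hn hle
  have hn0 : (0 : ℝ) < n := by exact_mod_cast hn
  have hx : 0 < a n / n / 2 := by positivity
  rw [sum_Ioc_half_eq n (fun k => b n ^ 2 * Real.exp (a n * k / n) * (1 - k / n : ℝ) ^ 2)]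
  calc ∑ j ∈ Finset.range (n - n / 2), b n ^ 2 * Real.exp (a n * ((n - j : ℕ) : ℝ) / n)
        * (1 - ((n - j : ℕ) : ℝ) / n) ^ 2
      ≤ ∑ j ∈ Finset.range (n - n / 2), b n ^ 2 * Real.exp (a n) * (8 * (a n)⁻¹ ^ 2)
          * Real.exp (-(a n / n / 2 * j)) := by
        refine Finset.sum_le_sum fun j hj => ?_
        have hjn : j ≤ n := by simp only [Finset.mem_range] at hj; omega
        rw [exp_mul_sub_div hjn hn, Nat.cast_sub hjn]
        have h1 : (1 - ((n : ℝ) - j) / n) = (a n)⁻¹ * (a n / n * j) := by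
          field_simp
          ring
        set x := a n / n * j
        have hx0 : 0 ≤ x := by positivity
        -- by `x ^ 2 ≤ 8 * exp (x / 2)`; the remaining factor sums to at most a multiple of `n / a n`
        have h2 : x ^ 2 * Real.exp (-x) ≤ 8 * Real.exp (-(x / 2)) := by
          have e1 := Real.quadratic_le_exp_of_nonneg (show 0 ≤ x / 2 by positivity)
          have e2 : Real.exp (-(x / 2)) = Real.exp (x / 2) * Real.exp (-x) := by
            rw [← Real.exp_add]; ring_nf
          rw [e2, ← mul_assoc]
          exact mul_le_mul_of_nonneg_right (by nlinarith) (Real.exp_pos _).le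
        have h3 : a n / n / 2 * j = x / 2 := by simp only [x]; ring
        rw [h1, h3]
        have h4 : 0 ≤ b n ^ 2 * Real.exp (a n) * (a n)⁻¹ ^ 2 := by positivity
        nlinarith [mul_le_mul_of_nonneg_left h2 h4]
    _ ≤ b n ^ 2 * Real.exp (a n) * (8 * (a n)⁻¹ ^ 2) * (2 / (a n / n / 2)) := by
        rw [← Finset.mul_sum]
        exact mul_le_mul_of_nonneg_left (sum_exp_neg_mul_le hx (by linarith) _) (by positivity)
    _ = 32 * (n * b n ^ 2 * Real.exp (a n) / a n) * (a n)⁻¹ ^ 2 := by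
        field_simp
        ring

/-- Only the terms with index `n - O(n / a n)` contribute, so that `k / n` may be replaced by `1`. -/
theorem IsCentering.tendsto_sum_high_sq {b : ℝ → ℝ} {α : ℝ} (hb : IsRegularlyVarying b α)
    {a : ℕ → ℝ} (ha : IsCentering b a) :
    Tendsto (fun n : ℕ => ∑ k ∈ Finset.Ioc (n / 2) n,
      b k ^ 2 * Real.exp (a n * k / n) * (1 - k / n : ℝ) ^ 2) atTop (𝓝 0) := by
  obtain ⟨C, hC, h⟩ := hb.exists_sq_le_mul_sq
  have hup := ha.tendsto_sum_high_aux.const_mul C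
  rw [mul_zero] at hup
  refine squeeze_zero' (Eventually.of_forall fun n => Finset.sum_nonneg fun k _ =>
    mul_nonneg (mul_nonneg (sq_nonneg _) (Real.exp_pos _).le) (sq_nonneg _)) ?_ hup
  filter_upwards [h] with n hn
  rw [Finset.mul_sum]
  refine Finset.sum_le_sum fun k hk => ?_
  rw [← mul_assoc, ← mul_assoc]
  gcongr
  exact (hn k hk).1

theorem IsCentering.exists_sq_mul_exp_le {b : ℝ → ℝ} {α : ℝ} (hb : IsRegularlyVarying b α)
    {a : ℕ → ℝ} (ha : IsCentering b a) : ∃ δ : ℕ → ℝ, Tendsto δ atTop (𝓝 0) ∧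
      ∀ᶠ n : ℕ in atTop, ∀ k ∈ Finset.Ioc (n / 2) n, b k ^ 2 * Real.exp (a n * k / n) ≤ δ n := by
  obtain ⟨C, hC, h⟩ := hb.exists_sq_le_mul_sq
  have hup := ha.tendsto_sq_mul_exp.const_mul C
  rw [mul_zero] at hup
  refine ⟨_, hup, ?_⟩
  filter_upwards [h, ha.tendsto_atTop.eventually_gt_atTop 0, eventually_gt_atTop 0]
    with n hn han hn0 k hk
  have hn0 : (0 : ℝ) < n := by exact_mod_cast hn0
  rw [← mul_assoc]
  refine mul_le_mul (hn k hk).1 (Real.exp_le_exp.2 ?_) (Real.exp_pos _).le (by positivity)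
  rw [div_le_iff₀ hn0]
  have : (k : ℝ) ≤ n := by exact_mod_cast (Finset.mem_Ioc.1 hk).2
  gcongr

theorem tendsto_div_one_sub_exp_neg :
    Tendsto (fun x : ℝ => x / (1 - Real.exp (-x))) (𝓝[>] 0) (𝓝 1) := by
  have h1 : HasDerivAt (fun x : ℝ => 1 - Real.exp (-x)) 1 0 := by
    have := ((hasDerivAt_neg (0 : ℝ)).exp).const_sub 1
    simpa using this
  have h2 := (h1.tendsto_slope).mono_left (nhdsWithin_mono 0 (s := Set.Ioi 0)
    fun x hx => (Set.mem_Ioi.1 hx).ne')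
  have h3 := h2.inv₀ one_ne_zero
  rw [inv_one] at h3
  refine h3.congr fun x => ?_
  simp [slope_def_field]

/-- After `k = n - j` the sum is geometric with ratio `r n = exp (-(a n / n)) * ω⁻¹`. If `ω = 1` then
`1 - r n` is asymptotic to `a n / n`, otherwise it stays away from `0`; in both cases the definition
of a centring sequence gives the limit. -/
theorem IsCentering.tendsto_sum_high_geom {b : ℝ → ℝ} {a : ℕ → ℝ} (ha : IsCentering b a) {ω : ℂ}
    (hω : ‖ω‖ = 1) :
    Tendsto (fun n : ℕ => ∑ k ∈ Finset.Ioc (n / 2) n,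
      ((b n ^ 2 * Real.exp (a n * k / n) : ℝ) : ℂ) * ω ^ k) atTop (𝓝 (if ω = 1 then 1 else 0)) := by
  have hω0 : ω ≠ 0 := by rintro rfl; simp at hω
  set r : ℕ → ℂ := fun n => (Real.exp (-(a n / n)) : ℝ) * ω⁻¹ with hr
  have hexp : Tendsto (fun n : ℕ => Real.exp (-(a n / n))) atTop (𝓝 1) := by
    have h0 : Tendsto (fun n : ℕ => -(a n / n)) atTop (𝓝 0) := by simpa using ha.tendsto_div.neg
    have := (Real.continuous_exp.tendsto 0).comp h0
    rwa [Real.exp_zero] at this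
  have hpow : Tendsto (fun n => 1 - r n ^ (n - n / 2)) atTop (𝓝 1) := by
    have h1 : Tendsto (fun n => r n ^ (n - n / 2)) atTop (𝓝 0) := by
      rw [tendsto_zero_iff_norm_tendsto_zero]
      have h2 : Tendsto (fun n => Real.exp (-(a n / 2))) atTop (𝓝 0) :=
        Real.tendsto_exp_neg_atTop_nhds_zero.comp (ha.tendsto_atTop.atTop_div_const two_pos)
      refine squeeze_zero' (Eventually.of_forall fun n => norm_nonneg _) ?_ h2
      filter_upwards [ha.tendsto_atTop.eventually_gt_atTop 0, eventually_gt_atTop 0] with n han hn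
      have hn0 : (0 : ℝ) < n := by exact_mod_cast hn
      simp only [hr]
      rw [norm_pow, norm_mul, norm_inv, hω, inv_one, mul_one, Complex.norm_real,
        Real.norm_of_nonneg (Real.exp_pos _).le, ← Real.exp_nat_mul, Real.exp_le_exp]
      have h3 : (n : ℝ) ≤ 2 * ((n - n / 2 : ℕ) : ℝ) := by
        exact_mod_cast (by omega : n ≤ 2 * (n - n / 2))
      have h4 : a n / 2 = n * (a n / n / 2) := by field_simp
      have h5 : 0 < a n / n := by positivity
      nlinarith
    simpa using h1.const_sub 1
  have hmain : Tendsto (fun n : ℕ => ((b n ^ 2 * Real.exp (a n) : ℝ) : ℂ) * ω ^ n / (1 - r n)) atTop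
      (𝓝 (if ω = 1 then 1 else 0)) := by
    split_ifs with h1
    · subst h1
      have h2 : Tendsto (fun n : ℕ => a n / n) atTop (𝓝[>] 0) := by
        refine tendsto_nhdsWithin_iff.2 ⟨ha.tendsto_div, ?_⟩
        filter_upwards [ha.tendsto_atTop.eventually_gt_atTop 0, eventually_gt_atTop 0] with n han hn
        have hn0 : (0 : ℝ) < n := by exact_mod_cast hn
        exact div_pos han hn0
      have h3 := ha.tendsto_ratio.mul (tendsto_div_one_sub_exp_neg.comp h2)
      rw [mul_one] at h3
      have h4 := (Complex.continuous_ofReal.tendsto 1).comp h3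
      rw [Complex.ofReal_one] at h4
      refine h4.congr' ?_
      filter_upwards [ha.tendsto_atTop.eventually_gt_atTop 0, eventually_gt_atTop 0] with n han hn
      have hn0 : (0 : ℝ) < n := by exact_mod_cast hn
      have h5 : (n : ℝ) * b n ^ 2 * Real.exp (a n) / a n * (a n / n / (1 - Real.exp (-(a n / n))))
          = b n ^ 2 * Real.exp (a n) / (1 - Real.exp (-(a n / n))) := by
        field_simp
      simp only [Function.comp_apply, hr]
      rw [h5]
      push_cast
      simp
    · have h2 : Tendsto (fun n => 1 - r n) atTop (𝓝 (1 - ω⁻¹)) := by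
        have := ((Complex.continuous_ofReal.tendsto 1).comp hexp).mul_const ω⁻¹
        rw [Complex.ofReal_one, one_mul] at this
        exact this.const_sub 1
      have h3 : Tendsto (fun n : ℕ => ((b n ^ 2 * Real.exp (a n) : ℝ) : ℂ) * ω ^ n) atTop (𝓝 0) := by
        rw [tendsto_zero_iff_norm_tendsto_zero]
        refine ha.tendsto_sq_mul_exp.congr fun n => ?_
        rw [norm_mul, norm_pow, hω, one_pow, mul_one, Complex.norm_real,
          Real.norm_of_nonneg (by positivity)]
      have h4 : 1 - ω⁻¹ ≠ 0 := by
        rw [sub_ne_zero]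
        exact fun h => h1 (inv_eq_one.1 h.symm)
      have h5 := h3.div h2 h4
      rwa [zero_div] at h5
  have hprod := hmain.mul hpow
  rw [mul_one] at hprod
  refine hprod.congr' ?_
  filter_upwards [ha.tendsto_atTop.eventually_gt_atTop 0, eventually_gt_atTop 0] with n han hn
  have hn0 : (0 : ℝ) < n := by exact_mod_cast hn
  have hr1 : r n ≠ 1 := by
    intro h
    have h1 := congrArg norm h
    simp only [hr] at h1
    rw [norm_mul, norm_inv, hω, inv_one, mul_one, Complex.norm_real, norm_one,
      Real.norm_of_nonneg (Real.exp_pos _).le, Real.exp_eq_one_iff] at h1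
    have : 0 < a n / n := by positivity
    linarith
  rw [sum_Ioc_half_eq n (fun k => ((b n ^ 2 * Real.exp (a n * k / n) : ℝ) : ℂ) * ω ^ k)]
  have hterm : ∀ j ∈ Finset.range (n - n / 2),
      ((b n ^ 2 * Real.exp (a n * ((n - j : ℕ) : ℝ) / n) : ℝ) : ℂ) * ω ^ (n - j)
        = ((b n ^ 2 * Real.exp (a n) : ℝ) : ℂ) * ω ^ n * r n ^ j := by
    intro j hj
    have hjn : j ≤ n := by simp only [Finset.mem_range] at hj; omega
    rw [exp_mul_sub_div hjn hn, pow_sub₀ _ hω0 hjn]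
    simp only [hr]
    rw [mul_pow, ← Complex.ofReal_pow, ← Real.exp_nat_mul, inv_pow,
      show (j : ℝ) * -(a n / n) = -(a n / n * j) by ring]
    push_cast
    ring
  rw [Finset.sum_congr rfl hterm, ← Finset.mul_sum, geom_sum_eq hr1]
  rw [← neg_sub 1 (r n), ← neg_sub 1 (r n ^ (n - n / 2)), neg_div_neg_eq]
  ring

/-- `b k` is close to `b n` when `k / n` is close to `1`, by Potter's bound. -/
theorem IsRegularlyVarying.exists_abs_sq_sub_le {b : ℝ → ℝ} {α : ℝ} (hb : IsRegularlyVarying b α)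
    {η : ℝ} (hη : 0 < η) : ∃ δ > 0, ∀ᶠ n : ℕ in atTop, ∀ k ≤ n, 1 - (k : ℝ) / n ≤ δ →
      |b k ^ 2 - b n ^ 2| ≤ η * b n ^ 2 := by
  obtain ⟨ε, hε0, hε⟩ : ∃ ε > 0, Real.exp (8 * ε) - 1 < η := by
    have : Tendsto (fun ε : ℝ => Real.exp (8 * ε) - 1) (𝓝[>] 0) (𝓝 0) := by
      have h : Continuous fun ε : ℝ => Real.exp (8 * ε) - 1 := by fun_prop
      have := (h.tendsto 0).mono_left (nhdsWithin_le_nhds (s := Set.Ioi 0))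
      simpa using this
    obtain ⟨ε, h1, h2⟩ := ((this.eventually_lt_const hη).and self_mem_nhdsWithin).exists
    exact ⟨ε, h2, h1⟩
  obtain ⟨X, hX1, hX⟩ := hb.exists_sq_le_sq_mul_exp hε0
  have hα0 := abs_nonneg α
  refine ⟨min (1 / 2) (ε / (1 + |α|)), lt_min (by norm_num) (by positivity), ?_⟩
  filter_upwards [tendsto_natCast_atTop_atTop.eventually_ge_atTop (2 * X)] with n hn k hkn hk
  have hn0 : (0 : ℝ) < n := by linarith
  have hk1 := hk.trans (min_le_left _ _)
  have hk2 := hk.trans (min_le_right _ _)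
  replace hkn : (k : ℝ) ≤ n := by exact_mod_cast hkn
  have hk3 : (n : ℝ) ≤ 2 * k := by
    rw [sub_le_iff_le_add, ← sub_le_iff_le_add', le_div_iff₀ hn0] at hk1
    linarith
  have hk0 : (0 : ℝ) < k := by linarith
  have hL0 : 0 ≤ Real.log ((n : ℝ) / k) := Real.log_nonneg (by rwa [le_div_iff₀ hk0, one_mul])
  have hL : Real.log ((n : ℝ) / k) ≤ (1 - k / n) * 2 := by
    have e1 : Real.log ((n : ℝ) / k) ≤ n / k - 1 := Real.log_le_sub_one_of_pos (div_pos hn0 hk0)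
    have e2 : (n : ℝ) / k - 1 = (1 - k / n) * (n / k) := by field_simp
    have e3 : (n : ℝ) / k ≤ 2 := by rwa [div_le_iff₀ hk0]
    have e4 : 0 ≤ 1 - (k : ℝ) / n := by rw [sub_nonneg, div_le_one hn0]; exact hkn
    rw [e2] at e1
    exact e1.trans (mul_le_mul_of_nonneg_left e3 e4)
  obtain ⟨g1, g2⟩ := (hX k (by linarith)).2 n hkn
  set L := Real.log ((n : ℝ) / k)
  have hL1 : L ≤ 1 := by linarith
  have hL2 : |α| * L ≤ 2 * ε := by
    have e1 : (1 + |α|) * (ε / (1 + |α|)) = ε := by field_simp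
    nlinarith
  have e1 : -|α| * L ≤ α * L := mul_le_mul_of_nonneg_right (neg_abs_le α) hL0
  have e2 : α * L ≤ |α| * L := mul_le_mul_of_nonneg_right (le_abs_self α) hL0
  have b1 : Real.exp (2 * ε * (1 + L) - 2 * α * L) ≤ Real.exp (8 * ε) :=
    Real.exp_le_exp.2 (by nlinarith)
  have b2 : Real.exp (2 * ε * (1 + L) + 2 * α * L) ≤ Real.exp (8 * ε) :=
    Real.exp_le_exp.2 (by nlinarith)
  have h1 := g1.trans (mul_le_mul_of_nonneg_left b1 (sq_nonneg _))
  have h2 := g2.trans (mul_le_mul_of_nonneg_left b2 (sq_nonneg _))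
  have hE : 1 ≤ Real.exp (8 * ε) := Real.one_le_exp (by positivity)
  have hbn := sq_nonneg (b n)
  have h3 : (Real.exp (8 * ε) - 1) * b n ^ 2 ≤ η * b n ^ 2 :=
    mul_le_mul_of_nonneg_right hε.le hbn
  refine le_trans (abs_le.2 ⟨?_, ?_⟩) h3
  · rcases le_total (b n ^ 2) (b k ^ 2) with h | h
    · nlinarith
    · nlinarith
  · linarith

/-- The covariances of the terms with index above `n / 2`. The sum localises at `k / n → 1`, where
`b k / b n → 1`, so that it becomes geometric; its length `n / a n` tends to infinity, and the
oscillation of `ω ^ k` kills it unless `ω = 1`. -/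
theorem IsCentering.tendsto_sum_high_mul_pow {b : ℝ → ℝ} {α : ℝ} (hb : IsRegularlyVarying b α)
    {a : ℕ → ℝ} (ha : IsCentering b a) {ω : ℂ} (hω : ‖ω‖ = 1) :
    Tendsto (fun n : ℕ => ∑ k ∈ Finset.Ioc (n / 2) n,
      ((b k ^ 2 * Real.exp (a n * k / n) : ℝ) : ℂ) * ω ^ k) atTop (𝓝 (if ω = 1 then 1 else 0)) := by
  have hone : Tendsto (fun n : ℕ => ∑ k ∈ Finset.Ioc (n / 2) n,
      b n ^ 2 * Real.exp (a n * k / n)) atTop (𝓝 1) := by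
    have := (Complex.continuous_re.tendsto _).comp (ha.tendsto_sum_high_geom (ω := 1) (by simp))
    simp only [if_true, Complex.one_re] at this
    refine this.congr fun n => ?_
    simp only [Function.comp_apply, one_pow, mul_one]
    rw [← Complex.ofReal_sum, Complex.ofReal_re]
  have hdiff : Tendsto (fun n : ℕ => ∑ k ∈ Finset.Ioc (n / 2) n,
      |b k ^ 2 - b n ^ 2| * Real.exp (a n * k / n)) atTop (𝓝 0) := by
    obtain ⟨C, hC, hCb⟩ := hb.exists_sq_le_mul_sq
    rw [Metric.tendsto_nhds]
    intro η hη
    obtain ⟨δ, hδ0, hδ⟩ := hb.exists_abs_sq_sub_le (show 0 < η / 4 by positivity)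
    have hlim1 := (ha.tendsto_sum_high_aux.const_mul ((C + 1) / δ ^ 2))
    rw [mul_zero] at hlim1
    filter_upwards [hCb, hone.eventually_lt_const (show (1 : ℝ) < 2 by norm_num),
      hlim1.eventually_lt_const (show (0 : ℝ) < η / 4 by positivity),
      hδ] with n h1 h2 h3 h4
    rw [Real.dist_eq, sub_zero, abs_of_nonneg (Finset.sum_nonneg fun k _ => by positivity)]
    have hterm : ∀ k ∈ Finset.Ioc (n / 2) n, |b k ^ 2 - b n ^ 2| * Real.exp (a n * k / n)
        ≤ η / 4 * (b n ^ 2 * Real.exp (a n * k / n))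
          + (C + 1) / δ ^ 2 * (b n ^ 2 * Real.exp (a n * k / n) * (1 - k / n : ℝ) ^ 2) := by
      intro k hk
      have hbn := sq_nonneg (b n)
      have hbk := sq_nonneg (b k)
      have hE := Real.exp_pos (a n * k / n)
      suffices |b k ^ 2 - b n ^ 2| ≤ η / 4 * b n ^ 2
          + (C + 1) / δ ^ 2 * (b n ^ 2 * (1 - k / n : ℝ) ^ 2) by
        nlinarith [mul_le_mul_of_nonneg_right this hE.le]
      -- away from `k / n = 1` the factor `(1 - k / n)² / δ²` is at least `1`
      by_cases hc : 1 - (k : ℝ) / n ≤ δ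
      · exact (h4 k (Finset.mem_Ioc.1 hk).2 hc).trans (le_add_of_nonneg_right (by positivity))
      · push Not at hc
        have e1 : 1 ≤ (1 - (k : ℝ) / n) ^ 2 / δ ^ 2 := by
          rw [one_le_div (by positivity)]
          gcongr
        have e2 : |b k ^ 2 - b n ^ 2| ≤ (C + 1) * b n ^ 2 := by
          have := (h1 k hk).1
          rw [abs_le]
          constructor <;> nlinarith
        have e3 : 0 ≤ (C + 1) * b n ^ 2 := by positivity
        calc |b k ^ 2 - b n ^ 2| ≤ (C + 1) * b n ^ 2 * 1 := by linarith
          _ ≤ (C + 1) * b n ^ 2 * ((1 - (k : ℝ) / n) ^ 2 / δ ^ 2) := by gcongr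
          _ = (C + 1) / δ ^ 2 * (b n ^ 2 * (1 - k / n : ℝ) ^ 2) := by ring
          _ ≤ _ := le_add_of_nonneg_left (by positivity)
    refine (Finset.sum_le_sum hterm).trans_lt ?_
    have h5 := add_lt_add (mul_lt_mul_of_pos_left h2 (show 0 < η / 4 by positivity)) h3
    rw [Finset.mul_sum, Finset.mul_sum, ← Finset.sum_add_distrib] at h5
    linarith
  rw [← add_zero (if ω = 1 then (1 : ℂ) else 0)]
  have h0 : Tendsto (fun n : ℕ => ∑ k ∈ Finset.Ioc (n / 2) n,
      (((b k ^ 2 - b n ^ 2) * Real.exp (a n * k / n) : ℝ) : ℂ) * ω ^ k) atTop (𝓝 0) := by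
    rw [tendsto_zero_iff_norm_tendsto_zero]
    refine squeeze_zero (fun n => norm_nonneg _) (fun n => ?_) hdiff
    refine (norm_sum_le _ _).trans (Finset.sum_le_sum fun k _ => ?_)
    rw [norm_mul, norm_pow, hω, one_pow, mul_one, Complex.norm_real, Real.norm_eq_abs, abs_mul,
      abs_of_pos (Real.exp_pos _)]
  refine ((ha.tendsto_sum_high_geom hω).add h0).congr fun n => ?_
  rw [← Finset.sum_add_distrib]
  refine Finset.sum_congr rfl fun k _ => ?_
  push_cast
  ring

/-! ### A central limit theorem for weighted sums -/

/-- Second-order Taylor bound; the minimum lets dominated convergence apply to variables with just two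
moments. -/
theorem norm_exp_mul_I_sub_le (x : ℝ) :
    ‖Complex.exp (x * Complex.I) - (1 + x * Complex.I - (x ^ 2 / 2 : ℝ))‖ ≤ 4 * x ^ 2 * min 1 |x| := by
  have hnx : ‖(x : ℂ) * Complex.I‖ = |x| := by simp
  rcases le_total |x| 1 with h | h
  · have h1 := Complex.exp_bound (x := x * Complex.I) (by rwa [hnx]) (n := 3) (by norm_num)
    rw [hnx] at h1
    simp only [Finset.sum_range_succ, Finset.sum_range_zero, pow_zero, Nat.factorial] at h1
    have h2 : (x * Complex.I) ^ 2 = -((x ^ 2 : ℝ) : ℂ) := by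
      rw [mul_pow, Complex.I_sq]; push_cast; ring
    rw [h2] at h1
    rw [min_eq_right h]
    refine le_trans (le_of_eq ?_) (h1.trans ?_)
    · congr 1
      push_cast
      ring
    · have : |x| ^ 3 = x ^ 2 * |x| := by rw [pow_succ, sq_abs]
      rw [this]
      have h3 : 0 ≤ x ^ 2 * |x| := by positivity
      norm_num
      nlinarith
  · rw [min_eq_left h, mul_one]
    have h1 : ‖Complex.exp (x * Complex.I)‖ = 1 := Complex.norm_exp_ofReal_mul_I x
    have h2 : ‖(1 : ℂ) + x * Complex.I - (x ^ 2 / 2 : ℝ)‖ ≤ 1 + |x| + x ^ 2 / 2 := by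
      refine (norm_sub_le _ _).trans (add_le_add ((norm_add_le _ _).trans ?_) ?_)
      · rw [norm_one, hnx]
      · rw [Complex.norm_real, Real.norm_of_nonneg (by positivity)]
    have h3 : |x| ≤ x ^ 2 := by rw [← sq_abs]; nlinarith
    have h4 := norm_sub_le (Complex.exp (x * Complex.I)) ((1 : ℂ) + x * Complex.I - (x ^ 2 / 2 : ℝ))
    nlinarith

theorem norm_prod_sub_prod_le {ι : Type*} (s : Finset ι) (f g : ι → ℂ)
    (hf : ∀ i ∈ s, ‖f i‖ ≤ 1) (hg : ∀ i ∈ s, ‖g i‖ ≤ 1) :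
    ‖∏ i ∈ s, f i - ∏ i ∈ s, g i‖ ≤ ∑ i ∈ s, ‖f i - g i‖ := by
  classical
  induction s using Finset.induction_on with
  | empty => simp
  | insert i s hi ih =>
    rw [Finset.prod_insert hi, Finset.prod_insert hi, Finset.sum_insert hi]
    have h1 : f i * ∏ i ∈ s, f i - g i * ∏ i ∈ s, g i
        = (f i - g i) * ∏ i ∈ s, f i + g i * (∏ i ∈ s, f i - ∏ i ∈ s, g i) := by ring
    rw [h1]
    refine (norm_add_le _ _).trans (add_le_add ?_ ?_)
    · rw [norm_mul]
      refine mul_le_of_le_one_right (norm_nonneg _) ?_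
      rw [norm_prod]
      exact Finset.prod_le_one (fun _ _ => norm_nonneg _)
        fun j hj => hf j (Finset.mem_insert_of_mem hj)
    · rw [norm_mul]
      refine (mul_le_of_le_one_left (norm_nonneg _) (hg i (Finset.mem_insert_self i s))).trans ?_
      exact ih (fun j hj => hf j (Finset.mem_insert_of_mem hj))
        (fun j hj => hg j (Finset.mem_insert_of_mem hj))

section Lindeberg

variable {Ω : Type*} [MeasurableSpace Ω] {μ : Measure Ω} [IsProbabilityMeasure μ]

/-- The second-order error of the characteristic function of `X` is `o(‖w‖ ^ 2)`, uniformly in the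
direction of `w`. -/
theorem exists_norm_integral_exp_sub_le {X : Ω → ℂ} (hX : Measurable X) (hX2 : MemLp X 2 μ)
    (h0 : ∫ ω, X ω ∂μ = 0) {δ : ℕ → ℝ} (hδ : Tendsto δ atTop (𝓝 0)) :
    ∃ η : ℕ → ℝ, Tendsto η atTop (𝓝 0) ∧ ∀ n, ∀ w : ℂ, ‖w‖ ≤ δ n →
      ‖∫ ω, Complex.exp ((X ω * w).re * Complex.I) ∂μ
        - (1 - ((∫ ω, (X ω * w).re ^ 2 ∂μ) / 2 : ℝ))‖ ≤ ‖w‖ ^ 2 * η n := by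
  have hsq : Integrable (fun ω => ‖X ω‖ ^ 2) μ := hX2.integrable_norm_pow two_ne_zero
  have hXi : Integrable X μ := hX2.integrable one_le_two
  have hint : ∀ n, Integrable (fun ω => 4 * ‖X ω‖ ^ 2 * min 1 (|δ n| * ‖X ω‖)) μ := by
    intro n
    refine (hsq.const_mul 4).mono (by fun_prop) (ae_of_all _ fun ω => ?_)
    rw [norm_mul, Real.norm_of_nonneg (show 0 ≤ min 1 (|δ n| * ‖X ω‖) by positivity)]
    exact mul_le_of_le_one_right (norm_nonneg _) (min_le_left _ _)
  refine ⟨fun n => ∫ ω, 4 * ‖X ω‖ ^ 2 * min 1 (|δ n| * ‖X ω‖) ∂μ, ?_, fun n w hw => ?_⟩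
  · have : (0 : ℝ) = ∫ ω, (0 : ℝ) ∂μ := by simp
    rw [this]
    refine tendsto_integral_of_dominated_convergence (fun ω => 4 * ‖X ω‖ ^ 2)
      (fun n => (hint n).aestronglyMeasurable) (hsq.const_mul 4) (fun n => ae_of_all _ fun ω => ?_)
      (ae_of_all _ fun ω => ?_)
    · rw [norm_mul, Real.norm_of_nonneg (show 0 ≤ min 1 (|δ n| * ‖X ω‖) by positivity),
        Real.norm_of_nonneg (by positivity)]
      exact mul_le_of_le_one_right (by positivity) (min_le_left _ _)
    · have h1 : Tendsto (fun n => |δ n| * ‖X ω‖) atTop (𝓝 0) := by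
        simpa using hδ.abs.mul_const ‖X ω‖
      have h2 := ((tendsto_const_nhds (x := (1 : ℝ))).min h1).const_mul (4 * ‖X ω‖ ^ 2)
      simpa using h2
  · have hre : Integrable (fun ω => (X ω * w).re) μ := (hXi.mul_const w).re
    have hre0 : ∫ ω, (X ω * w).re ∂μ = 0 := by
      have := integral_re (hXi.mul_const w)
      simp only [RCLike.re_to_complex] at this
      rw [this, integral_mul_const, h0, zero_mul, Complex.zero_re]
    have habs : ∀ ω, |(X ω * w).re| ≤ ‖X ω‖ * ‖w‖ := fun ω =>
      (Complex.abs_re_le_norm _).trans (norm_mul _ _).le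
    have hre2 : Integrable (fun ω => (X ω * w).re ^ 2) μ := by
      refine (hsq.mul_const (‖w‖ ^ 2)).mono (by fun_prop) (ae_of_all _ fun ω => ?_)
      rw [Real.norm_of_nonneg (sq_nonneg _), Real.norm_of_nonneg (by positivity), ← mul_pow,
        ← sq_abs]
      exact pow_le_pow_left₀ (abs_nonneg _) (habs ω) 2
    have hexp : Integrable (fun ω => Complex.exp ((X ω * w).re * Complex.I)) μ := by
      refine Integrable.of_bound (by fun_prop) 1 (ae_of_all _ fun ω => ?_)
      rw [Complex.norm_exp_ofReal_mul_I]
    have hrec : Integrable (fun ω => ((X ω * w).re : ℂ) * Complex.I) μ := hre.ofReal.mul_const _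
    have hre2c : Integrable (fun ω => (((X ω * w).re ^ 2 / 2 : ℝ) : ℂ)) μ :=
      (hre2.div_const 2).ofReal
    have h1 : ∫ ω, Complex.exp ((X ω * w).re * Complex.I) ∂μ
        - (1 - ((∫ ω, (X ω * w).re ^ 2 ∂μ) / 2 : ℝ))
        = ∫ ω, (Complex.exp ((X ω * w).re * Complex.I)
          - (1 + (X ω * w).re * Complex.I - ((X ω * w).re ^ 2 / 2 : ℝ))) ∂μ := by
      have e1 : Integrable (fun ω => (1 : ℂ) + (X ω * w).re * Complex.I) μ :=
        (integrable_const _).add hrec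
      have e2 : Integrable (fun ω => (1 : ℂ) + (X ω * w).re * Complex.I
          - (((X ω * w).re ^ 2 / 2 : ℝ) : ℂ)) μ := e1.sub hre2c
      rw [integral_sub hexp e2, integral_sub e1 hre2c,
        integral_add (integrable_const _) hrec, integral_mul_const,
        integral_complex_ofReal, integral_complex_ofReal, hre0, integral_div]
      simp
    rw [h1, ← integral_const_mul]
    refine (norm_integral_le_integral_norm _).trans (integral_mono_of_nonneg
      (ae_of_all _ fun _ => norm_nonneg _) ((hint n).const_mul _) (ae_of_all _ fun ω => ?_))
    refine (norm_exp_mul_I_sub_le _).trans ?_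
    have h2 : (X ω * w).re ^ 2 ≤ (‖X ω‖ * ‖w‖) ^ 2 := by
      rw [← sq_abs]
      exact pow_le_pow_left₀ (abs_nonneg _) (habs ω) 2
    have h3 : |(X ω * w).re| ≤ |δ n| * ‖X ω‖ := by
      refine (habs ω).trans ?_
      rw [mul_comm]
      exact mul_le_mul_of_nonneg_right (hw.trans (le_abs_self _)) (norm_nonneg _)
    calc 4 * (X ω * w).re ^ 2 * min 1 |(X ω * w).re|
        ≤ 4 * (‖X ω‖ * ‖w‖) ^ 2 * min 1 (|δ n| * ‖X ω‖) := by gcongr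
      _ = ‖w‖ ^ 2 * (4 * ‖X ω‖ ^ 2 * min 1 (|δ n| * ‖X ω‖)) := by ring

theorem abs_exp_neg_sub_le {y : ℝ} (hy : 0 ≤ y) (hy1 : y ≤ 1) :
    |Real.exp (-y) - (1 - y)| ≤ y ^ 2 := by
  have := Real.abs_exp_sub_one_sub_id_le (x := -y) (by rwa [abs_neg, abs_of_nonneg hy])
  rw [neg_sq] at this
  convert this using 2
  ring

/-- The Lindeberg central limit theorem for sums of copies of a centred complex random variable,
with complex weights that tend to zero uniformly. -/
theorem tendsto_integral_exp_sum {ξ : ℕ → Ω → ℂ} (hm : ∀ k, Measurable (ξ k))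
    (hind : iIndepFun ξ μ) (hid : ∀ k, IdentDistrib (ξ k) (ξ 0) μ μ)
    (h0 : ∫ ω, ξ 0 ω ∂μ = 0) (h2 : MemLp (ξ 0) 2 μ) {s : ℕ → Finset ℕ} {w : ℕ → ℕ → ℂ}
    {δ : ℕ → ℝ} (hδ : Tendsto δ atTop (𝓝 0)) (hw : ∀ᶠ n in atTop, ∀ k ∈ s n, ‖w n k‖ ≤ δ n)
    {M : ℝ} (hM : ∀ᶠ n in atTop, ∑ k ∈ s n, ‖w n k‖ ^ 2 ≤ M) {V : ℝ}
    (hV : Tendsto (fun n => ∑ k ∈ s n, ∫ ω, (ξ 0 ω * w n k).re ^ 2 ∂μ) atTop (𝓝 V)) :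
    Tendsto (fun n => ∫ ω, Complex.exp (((∑ k ∈ s n, (ξ k ω * w n k).re : ℝ) : ℂ) * Complex.I) ∂μ)
      atTop (𝓝 (Complex.exp (-(V / 2 : ℝ)))) := by
  obtain ⟨η, hη, hηw⟩ := exists_norm_integral_exp_sub_le (hm 0) h2 h0 hδ
  set φ : ℂ → ℂ := fun w => ∫ ω, Complex.exp ((ξ 0 ω * w).re * Complex.I) ∂μ with hφ
  set v : ℂ → ℝ := fun w => ∫ ω, (ξ 0 ω * w).re ^ 2 ∂μ with hv
  have hsq : Integrable (fun ω => ‖ξ 0 ω‖ ^ 2) μ := h2.integrable_norm_pow two_ne_zero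
  set K : ℝ := ∫ ω, ‖ξ 0 ω‖ ^ 2 ∂μ with hK
  have hK0 : 0 ≤ K := integral_nonneg fun _ => by positivity
  have hv0 : ∀ w, 0 ≤ v w := fun w => integral_nonneg fun _ => sq_nonneg _
  have hvK : ∀ w, v w ≤ K * ‖w‖ ^ 2 := by
    intro w
    rw [hK, ← integral_mul_const]
    refine integral_mono_of_nonneg (ae_of_all _ fun _ => sq_nonneg _) (hsq.mul_const _)
      (ae_of_all _ fun ω => ?_)
    simp only
    rw [← mul_pow, ← norm_mul, ← sq_abs]
    exact pow_le_pow_left₀ (abs_nonneg _) (Complex.abs_re_le_norm _) 2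
  have hprod : ∀ n, ∫ ω, Complex.exp (((∑ k ∈ s n, (ξ k ω * w n k).re : ℝ) : ℂ) * Complex.I) ∂μ
      = ∏ k ∈ s n, φ (w n k) := by
    intro n
    have hXm : ∀ k, Measurable fun ω => (ξ k ω * w n k).re := fun k =>
      Complex.measurable_re.comp ((hm k).mul_const _)
    have hXind : iIndepFun (fun k ω => (ξ k ω * w n k).re) μ :=
      hind.comp (fun k z => (z * w n k).re) fun k =>
        Complex.measurable_re.comp (measurable_id.mul_const _)
    have h := iIndepFun.charFun_map_fun_finsetSum_eq_prod (s := s n)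
      (fun k _ => (hXm k).aemeasurable) (hXind.restrict _)
    have h1 := congrFun h 1
    rw [Finset.prod_apply, charFun_apply_real, integral_map (by fun_prop) (by fun_prop)] at h1
    simp only [Complex.ofReal_one, one_mul] at h1
    rw [h1]
    refine Finset.prod_congr rfl fun k _ => ?_
    rw [charFun_apply_real, integral_map (hXm k).aemeasurable (by fun_prop)]
    simp only [Complex.ofReal_one, one_mul, hφ]
    exact ((hid k).comp (u := fun z : ℂ => Complex.exp ((z * w n k).re * Complex.I))
      (by fun_prop)).integral_eq
  simp_rw [hprod]
  have hlim : Tendsto (fun n => ∏ k ∈ s n, ((Real.exp (-(v (w n k) / 2)) : ℝ) : ℂ)) atTop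
      (𝓝 (Complex.exp (-(V / 2 : ℝ)))) := by
    have h3 : ∀ n, ∏ k ∈ s n, ((Real.exp (-(v (w n k) / 2)) : ℝ) : ℂ)
        = ((Real.exp (-((∑ k ∈ s n, v (w n k)) / 2)) : ℝ) : ℂ) := by
      intro n
      rw [← Complex.ofReal_prod, ← Real.exp_sum, Finset.sum_neg_distrib, Finset.sum_div]
    simp_rw [h3]
    have h4 : Complex.exp (-(V / 2 : ℝ)) = ((Real.exp (-(V / 2)) : ℝ) : ℂ) := by push_cast; rfl
    rw [h4]
    exact (Complex.continuous_ofReal.tendsto _).comp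
      ((Real.continuous_exp.tendsto _).comp (hV.div_const 2).neg)
  have hdiff : Tendsto (fun n => ∏ k ∈ s n, φ (w n k)
      - ∏ k ∈ s n, ((Real.exp (-(v (w n k) / 2)) : ℝ) : ℂ)) atTop (𝓝 0) := by
    have hup : Tendsto (fun n => |M| * (|η n| + K ^ 2 * δ n ^ 2)) atTop (𝓝 0) := by
      have := (hη.abs.add ((hδ.pow 2).const_mul (K ^ 2))).const_mul |M|
      simpa using this
    rw [tendsto_zero_iff_norm_tendsto_zero]
    refine squeeze_zero' (Eventually.of_forall fun _ => norm_nonneg _) ?_ hup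
    have hsmall : ∀ᶠ n in atTop, K * δ n ^ 2 < 1 := by
      have := (hδ.pow 2).const_mul K
      simp only [ne_eq, OfNat.ofNat_ne_zero, not_false_eq_true, zero_pow, mul_zero] at this
      exact this.eventually_lt_const one_pos
    filter_upwards [hw, hM, hsmall] with n hwn hMn hsn
    refine (norm_prod_sub_prod_le _ _ _ ?_ ?_).trans ?_
    · intro k _
      refine (norm_integral_le_integral_norm _).trans (le_of_eq ?_)
      simp_rw [Complex.norm_exp_ofReal_mul_I]
      simp
    · intro k _
      rw [Complex.norm_real, Real.norm_of_nonneg (Real.exp_pos _).le, Real.exp_le_one_iff]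
      linarith [hv0 (w n k)]
    · have hterm : ∀ k ∈ s n, ‖φ (w n k) - ((Real.exp (-(v (w n k) / 2)) : ℝ) : ℂ)‖
          ≤ ‖w n k‖ ^ 2 * (|η n| + K ^ 2 * δ n ^ 2) := by
        intro k hk
        have hwk := hwn k hk
        have hwsq : ‖w n k‖ ^ 2 ≤ δ n ^ 2 := pow_le_pow_left₀ (norm_nonneg _) hwk 2
        have e1 := hηw n (w n k) hwk
        have e2 : v (w n k) ≤ K * ‖w n k‖ ^ 2 := hvK _
        have e3 : v (w n k) ≤ 1 := by nlinarith
        have e4 := abs_exp_neg_sub_le (y := v (w n k) / 2) (by linarith [hv0 (w n k)]) (by linarith)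
        have e5 : φ (w n k) - ((Real.exp (-(v (w n k) / 2)) : ℝ) : ℂ)
            = (φ (w n k) - (1 - (v (w n k) / 2 : ℝ)))
              - ((Real.exp (-(v (w n k) / 2)) - (1 - v (w n k) / 2) : ℝ) : ℂ) := by
          push_cast; ring
        rw [e5]
        refine (norm_sub_le _ _).trans ?_
        rw [Complex.norm_real, Real.norm_eq_abs, mul_add]
        refine add_le_add (e1.trans ?_) (e4.trans ?_)
        · exact mul_le_mul_of_nonneg_left (le_abs_self _) (sq_nonneg _)
        · calc (v (w n k) / 2) ^ 2 ≤ v (w n k) ^ 2 := by nlinarith [sq_nonneg (v (w n k))]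
            _ ≤ (K * ‖w n k‖ ^ 2) ^ 2 := pow_le_pow_left₀ (hv0 _) e2 2
            _ = ‖w n k‖ ^ 2 * (K ^ 2 * ‖w n k‖ ^ 2) := by ring
            _ ≤ ‖w n k‖ ^ 2 * (K ^ 2 * δ n ^ 2) := by gcongr
      refine (Finset.sum_le_sum hterm).trans ?_
      rw [← Finset.sum_mul]
      exact mul_le_mul_of_nonneg_right (hMn.trans (le_abs_self _)) (by positivity)
  have := hdiff.add hlim
  simpa using this

end Lindeberg

/-! ### The Gaussian limit vector -/

section Gaussian

variable {m : ℕ}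

/-- The indicator that `ψ i` and `ψ j`, taken in `[0, 2 π)`, are opposite angles modulo `2 π`. -/
def oppositeInd (ψ : Fin m → ℝ) (i j : Fin m) : ℝ :=
  if ψ i + ψ j = 0 ∨ ψ i + ψ j = 2 * Real.pi then 1 else 0

/-- The covariance matrix of the real parts (left summand) and the imaginary parts (right summand)
of the limit vector. -/
def limitCov (ψ : Fin m → ℝ) (σ₁ σ₂ : ℝ) : Matrix (Fin m ⊕ Fin m) (Fin m ⊕ Fin m) ℝ :=
  Matrix.fromBlocks
    (Matrix.of fun i j => 1 / 2 * ((σ₁ ^ 2 + σ₂ ^ 2) * (if i = j then 1 else 0)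
      + (σ₁ ^ 2 - σ₂ ^ 2) * oppositeInd ψ i j)) 0 0
    (Matrix.of fun i j => 1 / 2 * ((σ₁ ^ 2 + σ₂ ^ 2) * (if i = j then 1 else 0)
      - (σ₁ ^ 2 - σ₂ ^ 2) * oppositeInd ψ i j))

theorem oppositeInd_comm (ψ : Fin m → ℝ) (i j : Fin m) :
    oppositeInd ψ i j = oppositeInd ψ j i := by
  simp only [oppositeInd, add_comm (ψ i)]

theorem oppositeInd_nonneg (ψ : Fin m → ℝ) (i j : Fin m) : 0 ≤ oppositeInd ψ i j := by
  simp only [oppositeInd]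
  split_ifs <;> norm_num

/-- Each angle has at most one opposite among the `ψ j`, as these are distinct. -/
theorem sum_oppositeInd_le {ψ : Fin m → ℝ} (hψ_mono : StrictMono ψ)
    (hψ : ∀ j, ψ j ∈ Set.Ico 0 (2 * Real.pi)) (i : Fin m) : ∑ j, oppositeInd ψ i j ≤ 1 := by
  have hpi := Real.pi_pos
  by_cases h : ∃ j, ψ i + ψ j = 0 ∨ ψ i + ψ j = 2 * Real.pi
  · obtain ⟨j, hj⟩ := h
    rw [Finset.sum_eq_single j]
    · simp only [oppositeInd]
      split_ifs <;> norm_num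
    · intro k _ hkj
      simp only [oppositeInd]
      rw [if_neg]
      intro hk
      refine hkj (hψ_mono.injective ?_)
      have h1 := (hψ i).1
      have h2 := hψ j
      have h3 := hψ k
      have h4 := (hψ i).2
      rcases hj with hj | hj <;> rcases hk with hk | hk <;> linarith [h2.1, h2.2, h3.1, h3.2]
    · simp
  · push Not at h
    rw [Finset.sum_eq_zero]
    · exact zero_le_one
    · intro j _
      simp only [oppositeInd]
      rw [if_neg]
      push Not
      exact h j

theorem abs_sum_oppositeInd_le {ψ : Fin m → ℝ} (hψ_mono : StrictMono ψ)
    (hψ : ∀ j, ψ j ∈ Set.Ico 0 (2 * Real.pi)) (y : Fin m → ℝ) :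
    |∑ i, ∑ j, oppositeInd ψ i j * (y i * y j)| ≤ ∑ i, y i ^ 2 := by
  have h1 : ∑ i, ∑ j, oppositeInd ψ i j * (y i ^ 2 / 2) ≤ ∑ i, y i ^ 2 / 2 := by
    refine Finset.sum_le_sum fun i _ => ?_
    rw [← Finset.sum_mul]
    exact mul_le_of_le_one_left (by positivity) (sum_oppositeInd_le hψ_mono hψ i)
  have h2 : ∑ i, ∑ j, oppositeInd ψ i j * (y j ^ 2 / 2) ≤ ∑ i, y i ^ 2 / 2 := by
    rw [Finset.sum_comm]
    refine le_trans (le_of_eq ?_) h1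
    refine Finset.sum_congr rfl fun i _ => Finset.sum_congr rfl fun j _ => ?_
    rw [oppositeInd_comm]
  calc |∑ i, ∑ j, oppositeInd ψ i j * (y i * y j)|
      ≤ ∑ i, ∑ j, |oppositeInd ψ i j * (y i * y j)| :=
        (Finset.abs_sum_le_sum_abs _ _).trans
          (Finset.sum_le_sum fun i _ => Finset.abs_sum_le_sum_abs _ _)
    _ ≤ ∑ i, ∑ j, (oppositeInd ψ i j * (y i ^ 2 / 2) + oppositeInd ψ i j * (y j ^ 2 / 2)) := by
        refine Finset.sum_le_sum fun i _ => Finset.sum_le_sum fun j _ => ?_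
        rw [abs_mul, abs_of_nonneg (oppositeInd_nonneg ψ i j), ← mul_add]
        refine mul_le_mul_of_nonneg_left ?_ (oppositeInd_nonneg ψ i j)
        rw [abs_le]
        constructor <;> nlinarith [sq_nonneg (y i - y j), sq_nonneg (y i + y j)]
    _ ≤ ∑ i, y i ^ 2 / 2 + ∑ i, y i ^ 2 / 2 := by
        simp_rw [Finset.sum_add_distrib]
        exact add_le_add h1 h2
    _ = ∑ i, y i ^ 2 := by
        rw [← Finset.sum_add_distrib]
        exact Finset.sum_congr rfl fun i _ => by ring

theorem dotProduct_limitCov_mulVec (ψ : Fin m → ℝ) (σ₁ σ₂ : ℝ) (x : Fin m ⊕ Fin m → ℝ) :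
    x ⬝ᵥ (limitCov ψ σ₁ σ₂).mulVec x
      = 1 / 2 * ((σ₁ ^ 2 + σ₂ ^ 2) * ∑ i, (x (.inl i) ^ 2 + x (.inr i) ^ 2)
        + (σ₁ ^ 2 - σ₂ ^ 2) * ∑ i, ∑ j, oppositeInd ψ i j
          * (x (.inl i) * x (.inl j) - x (.inr i) * x (.inr j))) := by
  simp only [dotProduct, Matrix.mulVec, limitCov, Fintype.sum_sum_type, Matrix.fromBlocks_apply₁₁,
    Matrix.fromBlocks_apply₁₂, Matrix.fromBlocks_apply₂₁, Matrix.fromBlocks_apply₂₂,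
    Matrix.zero_apply, zero_mul, Finset.sum_const_zero, add_zero, zero_add, Matrix.of_apply]
  have key : ∀ (y : Fin m → ℝ) (i : Fin m) (c : ℝ),
      ∑ j, 1 / 2 * ((σ₁ ^ 2 + σ₂ ^ 2) * (if i = j then 1 else 0) + c * oppositeInd ψ i j) * y j
        = 1 / 2 * ((σ₁ ^ 2 + σ₂ ^ 2) * y i + c * ∑ j, oppositeInd ψ i j * y j) := by
    intro y i c
    rw [Finset.mul_sum, show (σ₁ ^ 2 + σ₂ ^ 2) * y i
      = ∑ j, (σ₁ ^ 2 + σ₂ ^ 2) * (if i = j then 1 else 0) * y j by simp, ← Finset.sum_add_distrib,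
      Finset.mul_sum]
    exact Finset.sum_congr rfl fun j _ => by ring
  have key' : ∀ (y : Fin m → ℝ) (i : Fin m) (c : ℝ),
      ∑ j, 1 / 2 * ((σ₁ ^ 2 + σ₂ ^ 2) * (if i = j then 1 else 0) - c * oppositeInd ψ i j) * y j
        = 1 / 2 * ((σ₁ ^ 2 + σ₂ ^ 2) * y i - c * ∑ j, oppositeInd ψ i j * y j) := by
    intro y i c
    have := key y i (-c)
    simpa only [neg_mul, ← sub_eq_add_neg] using this
  simp_rw [key (fun j => x (.inl j)), key' (fun j => x (.inr j)), mul_sub, Finset.sum_sub_distrib]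
  rw [Finset.sum_add_distrib]
  simp only [mul_add, mul_sub, Finset.sum_add_distrib, Finset.mul_sum]
  have e1 : ∀ i, x i * (1 / 2 * ((σ₁ ^ 2 + σ₂ ^ 2) * x i)) = 1 / 2 * ((σ₁ ^ 2 + σ₂ ^ 2) * x i ^ 2) :=
    fun i => by ring
  have e2 : ∀ i j : Fin m ⊕ Fin m, ∀ p : ℝ, x i * (1 / 2 * ((σ₁ ^ 2 - σ₂ ^ 2) * (p * x j)))
      = 1 / 2 * ((σ₁ ^ 2 - σ₂ ^ 2) * (p * (x i * x j))) := fun i j p => by ring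
  simp only [e1, e2]
  ring

theorem posSemidef_limitCov {ψ : Fin m → ℝ} (hψ_mono : StrictMono ψ)
    (hψ : ∀ j, ψ j ∈ Set.Ico 0 (2 * Real.pi)) (σ₁ σ₂ : ℝ) : (limitCov ψ σ₁ σ₂).PosSemidef := by
  refine Matrix.PosSemidef.of_dotProduct_mulVec_nonneg ?_ fun x => ?_
  · refine Matrix.IsHermitian.fromBlocks ?_ (by simp) ?_
    · ext i j
      simp [oppositeInd_comm ψ i j, eq_comm]
    · ext i j
      simp [oppositeInd_comm ψ i j, eq_comm]
  · rw [star_trivial, dotProduct_limitCov_mulVec]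
    have h1 := abs_le.1 (abs_sum_oppositeInd_le hψ_mono hψ fun i => x (.inl i))
    have h2 := abs_le.1 (abs_sum_oppositeInd_le hψ_mono hψ fun i => x (.inr i))
    simp_rw [mul_sub, Finset.sum_sub_distrib, Finset.sum_add_distrib]
    set A := ∑ i, x (.inl i) ^ 2
    set B := ∑ i, x (.inr i) ^ 2
    set C := ∑ i, ∑ j, oppositeInd ψ i j * (x (.inl i) * x (.inl j))
    set D := ∑ i, ∑ j, oppositeInd ψ i j * (x (.inr i) * x (.inr j))
    have e1 : 0 ≤ σ₁ ^ 2 * ((A + C) + (B - D)) :=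
      mul_nonneg (sq_nonneg _) (by linarith [h1.1, h2.2])
    have e2 : 0 ≤ σ₂ ^ 2 * ((A - C) + (B + D)) :=
      mul_nonneg (sq_nonneg _) (by linarith [h1.2, h2.1])
    linarith

/-- The complex vector with given real and imaginary parts. -/
def toComplexVec (m : ℕ) : EuclideanSpace ℝ (Fin m ⊕ Fin m) →L[ℝ] (Fin m → ℂ) :=
  ContinuousLinearMap.pi fun j =>
    (EuclideanSpace.proj (𝕜 := ℝ) (Sum.inl j : Fin m ⊕ Fin m)).smulRight (1 : ℂ)
      + (EuclideanSpace.proj (𝕜 := ℝ) (Sum.inr j : Fin m ⊕ Fin m)).smulRight Complex.I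

theorem toComplexVec_apply (x : EuclideanSpace ℝ (Fin m ⊕ Fin m)) (j : Fin m) :
    toComplexVec m x j = x (.inl j) + x (.inr j) * Complex.I := by
  simp [toComplexVec]

/-- The law of the limit vector `(N_1, …, N_m)`. -/
def limitGaussian (ψ : Fin m → ℝ) (σ₁ σ₂ : ℝ) : Measure (Fin m → ℂ) :=
  (multivariateGaussian 0 (limitCov ψ σ₁ σ₂)).map (toComplexVec m)

instance (ψ : Fin m → ℝ) (σ₁ σ₂ : ℝ) : IsGaussian (limitGaussian ψ σ₁ σ₂) := by
  unfold limitGaussian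
  infer_instance

theorem memLp_eval_multivariateGaussian {ι : Type*} [Fintype ι] [DecidableEq ι]
    (S : Matrix ι ι ℝ) (i : ι) : MemLp (fun x => x i) 2 (multivariateGaussian 0 S) :=
  IsGaussian.memLp_dual (multivariateGaussian 0 S)
    (EuclideanSpace.proj (𝕜 := ℝ) i) 2 (by simp)

theorem integral_eval_multivariateGaussian {ι : Type*} [Fintype ι] [DecidableEq ι]
    (S : Matrix ι ι ℝ) (i : ι) : ∫ x, x i ∂(multivariateGaussian 0 S) = 0 := by
  have := (EuclideanSpace.proj (𝕜 := ℝ) i).integral_comp_id_comm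
    (μ := multivariateGaussian 0 S) IsGaussian.integrable_id
  simpa using this

theorem integral_mul_multivariateGaussian {ι : Type*} [Fintype ι] [DecidableEq ι]
    {S : Matrix ι ι ℝ} (hS : S.PosSemidef) (i j : ι) :
    ∫ x, x i * x j ∂(multivariateGaussian 0 S) = S i j := by
  have h := covariance_eval_multivariateGaussian (μ := 0) hS i j
  rw [covariance_eq_sub (memLp_eval_multivariateGaussian S i) (memLp_eval_multivariateGaussian S j),
    integral_eval_multivariateGaussian, zero_mul, sub_zero] at h
  exact h

theorem integral_limitGaussian (ψ : Fin m → ℝ) (σ₁ σ₂ : ℝ) (j : Fin m) :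
    ∫ N, N j ∂(limitGaussian ψ σ₁ σ₂) = 0 := by
  rw [limitGaussian, integral_map (by fun_prop)
    (measurable_pi_apply (X := fun _ : Fin m => ℂ) j).aestronglyMeasurable]
  simp_rw [toComplexVec_apply]
  have hi := fun i => (memLp_eval_multivariateGaussian (limitCov ψ σ₁ σ₂) i).integrable one_le_two
  rw [integral_add (hi _).ofReal ((hi _).ofReal.mul_const _), integral_mul_const,
    integral_complex_ofReal, integral_complex_ofReal, integral_eval_multivariateGaussian,
    integral_eval_multivariateGaussian]
  simp

theorem integral_mul_limitGaussian {ψ : Fin m → ℝ} (hψ_mono : StrictMono ψ)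
    (hψ : ∀ j, ψ j ∈ Set.Ico 0 (2 * Real.pi)) (σ₁ σ₂ : ℝ) (i j : Fin m) {c : ℂ} :
    ∫ N, N i * ((N j).re + c * (N j).im) ∂(limitGaussian ψ σ₁ σ₂)
      = 1 / 2 * ((σ₁ ^ 2 + σ₂ ^ 2) * (if i = j then 1 else 0) * (1 + c * Complex.I)
        + (σ₁ ^ 2 - σ₂ ^ 2) * oppositeInd ψ i j * (1 - c * Complex.I)) := by
  have hmeas : ∀ k : Fin m, Measurable fun N : Fin m → ℂ => N k := measurable_pi_apply
  rw [limitGaussian, integral_map (by fun_prop) (Measurable.aestronglyMeasurable (by fun_prop))]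
  have hre : ∀ x : EuclideanSpace ℝ (Fin m ⊕ Fin m), (toComplexVec m x j).re = x (.inl j) := by
    intro x; rw [toComplexVec_apply]; simp
  have him : ∀ x : EuclideanSpace ℝ (Fin m ⊕ Fin m), (toComplexVec m x j).im = x (.inr j) := by
    intro x; rw [toComplexVec_apply]; simp
  simp_rw [hre, him, toComplexVec_apply]
  have hS := posSemidef_limitCov hψ_mono hψ σ₁ σ₂
  have hi : ∀ k l, Integrable (fun x => ((x k * x l : ℝ) : ℂ))
      (multivariateGaussian 0 (limitCov ψ σ₁ σ₂)) := fun k l =>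
    ((memLp_eval_multivariateGaussian _ k).integrable_mul (memLp_eval_multivariateGaussian _ l)).ofReal
  have h1 : ∀ x : EuclideanSpace ℝ (Fin m ⊕ Fin m),
      ((x (.inl i) : ℂ) + x (.inr i) * Complex.I) * (x (.inl j) + c * x (.inr j))
        = ((x (.inl i) * x (.inl j) : ℝ) + (x (.inl i) * x (.inr j) : ℝ) * c)
          + ((x (.inr i) * x (.inl j) : ℝ) * Complex.I + (x (.inr i) * x (.inr j) : ℝ) * (c * Complex.I)) := by
    intro x; push_cast; ring
  simp_rw [h1]
  have hA : Integrable (fun x => ((x (.inl i) * x (.inl j) : ℝ) : ℂ)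
      + (x (.inl i) * x (.inr j) : ℝ) * c) (multivariateGaussian 0 (limitCov ψ σ₁ σ₂)) :=
    (hi _ _).add ((hi _ _).mul_const _)
  have hB : Integrable (fun x => ((x (.inr i) * x (.inl j) : ℝ) : ℂ) * Complex.I
      + (x (.inr i) * x (.inr j) : ℝ) * (c * Complex.I))
      (multivariateGaussian 0 (limitCov ψ σ₁ σ₂)) :=
    ((hi _ _).mul_const _).add ((hi _ _).mul_const _)
  rw [integral_add hA hB, integral_add (hi _ _) ((hi _ _).mul_const _),
    integral_add ((hi _ _).mul_const _) ((hi _ _).mul_const _)]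
  simp_rw [integral_mul_const, integral_complex_ofReal, integral_mul_multivariateGaussian hS]
  simp only [limitCov, Matrix.fromBlocks_apply₁₁, Matrix.fromBlocks_apply₁₂,
    Matrix.fromBlocks_apply₂₁, Matrix.fromBlocks_apply₂₂, Matrix.zero_apply, Matrix.of_apply]
  split_ifs <;> push_cast <;> ring

theorem integral_mul_conj_limitGaussian {ψ : Fin m → ℝ} (hψ_mono : StrictMono ψ)
    (hψ : ∀ j, ψ j ∈ Set.Ico 0 (2 * Real.pi)) (σ₁ σ₂ : ℝ) (i j : Fin m) :
    ∫ N, N i * (starRingEnd ℂ) (N j) ∂(limitGaussian ψ σ₁ σ₂)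
      = if i = j then ((σ₁ ^ 2 + σ₂ ^ 2 : ℝ) : ℂ) else 0 := by
  have h1 : ∀ z : ℂ, (starRingEnd ℂ) z = z.re + -Complex.I * z.im := fun z => by
    apply Complex.ext <;> simp
  simp_rw [h1]
  rw [integral_mul_limitGaussian hψ_mono hψ]
  simp only [neg_mul, Complex.I_mul_I]
  split_ifs <;> push_cast <;> ring

theorem integral_mul_self_limitGaussian {ψ : Fin m → ℝ} (hψ_mono : StrictMono ψ)
    (hψ : ∀ j, ψ j ∈ Set.Ico 0 (2 * Real.pi)) (σ₁ σ₂ : ℝ) (i j : Fin m) :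
    ∫ N, N i * N j ∂(limitGaussian ψ σ₁ σ₂)
      = if ψ i + ψ j = 0 ∨ ψ i + ψ j = 2 * Real.pi then ((σ₁ ^ 2 - σ₂ ^ 2 : ℝ) : ℂ) else 0 := by
  have h1 : ∀ z w : ℂ, w * z = w * (z.re + Complex.I * z.im) := fun z w => by
    rw [mul_comm Complex.I, Complex.re_add_im]
  simp_rw [fun N : Fin m → ℂ => h1 (N j) (N i)]
  rw [integral_mul_limitGaussian hψ_mono hψ]
  simp only [Complex.I_mul_I, oppositeInd]
  split_ifs <;> push_cast <;> ring

/-- A centred real Gaussian variable of positive variance has no atoms; one of the real and the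
imaginary part of `N j` is such a variable. -/
theorem ae_ne_zero_limitGaussian {ψ : Fin m → ℝ} (hψ_mono : StrictMono ψ)
    (hψ : ∀ j, ψ j ∈ Set.Ico 0 (2 * Real.pi)) {σ₁ σ₂ : ℝ} (hσ : 0 < σ₁ ^ 2 + σ₂ ^ 2) (j : Fin m) :
    ∀ᵐ N ∂(limitGaussian ψ σ₁ σ₂), N j ≠ 0 := by
  have hS := posSemidef_limitCov hψ_mono hψ σ₁ σ₂
  have key : ∀ i, 0 < limitCov ψ σ₁ σ₂ i i →
      ∀ᵐ x ∂(multivariateGaussian 0 (limitCov ψ σ₁ σ₂)), x i ≠ 0 := by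
    intro i hi
    have h := measurePreserving_eval_multivariateGaussian (μ := 0) hS (i := i)
    have hna : NullSingletonClass (gaussianReal ((0 : EuclideanSpace ℝ (Fin m ⊕ Fin m)) i)
        (limitCov ψ σ₁ σ₂ i i).toNNReal) :=
      nullSingletonClass_gaussianReal (Real.toNNReal_pos.2 hi).ne'
    exact h.quasiMeasurePreserving.ae (p := fun y => y ≠ 0) (by
      rw [ae_iff]
      simpa using hna.measure_singleton 0)
  have hsum : 0 < limitCov ψ σ₁ σ₂ (.inl j) (.inl j) ∨ 0 < limitCov ψ σ₁ σ₂ (.inr j) (.inr j) := by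
    have : limitCov ψ σ₁ σ₂ (.inl j) (.inl j) + limitCov ψ σ₁ σ₂ (.inr j) (.inr j)
        = σ₁ ^ 2 + σ₂ ^ 2 := by
      simp [limitCov]; ring
    by_contra! hcon
    linarith [hcon.1, hcon.2]
  have hmeas : MeasurableSet {N : Fin m → ℂ | N j ≠ 0} :=
    (measurableSet_eq_fun (measurable_pi_apply (X := fun _ : Fin m => ℂ) j) measurable_const).compl
  rw [limitGaussian, ae_map_iff (by fun_prop) hmeas]
  rcases hsum with h | h
  · filter_upwards [key _ h] with x hx h0
    have := congrArg Complex.re h0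
    rw [toComplexVec_apply] at this
    exact hx (by simpa using this)
  · filter_upwards [key _ h] with x hx h0
    have := congrArg Complex.im h0
    rw [toComplexVec_apply] at this
    exact hx (by simpa using this)

end Gaussian

/-! ### The terms of high index -/

/-- The sum of the terms with index in `(n / 2, n]` of `P_n (exp (a / (2 n) + i ψ))`. -/
def highPart (b : ℝ → ℝ) (x : ℕ → ℂ) (a : ℝ) (n : ℕ) (ψ : ℝ) : ℂ :=
  ∑ k ∈ Finset.Ioc (n / 2) n,
    ((b k * Real.exp (a * k / (2 * n)) : ℝ) : ℂ) * x k * Complex.exp (ψ * Complex.I) ^ k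

theorem exp_mul_I_mul_exp_eq_one_iff {m : ℕ} {ψ : Fin m → ℝ}
    (hψ : ∀ j, ψ j ∈ Set.Ico 0 (2 * Real.pi)) (i j : Fin m) :
    Complex.exp (ψ i * Complex.I) * Complex.exp (ψ j * Complex.I) = 1
      ↔ ψ i + ψ j = 0 ∨ ψ i + ψ j = 2 * Real.pi := by
  have hpi := Real.pi_pos
  rw [← Complex.exp_add, ← add_mul, Complex.exp_eq_one_iff]
  constructor
  · rintro ⟨k, hk⟩
    rw [← mul_assoc] at hk
    have h1 := mul_right_cancel₀ Complex.I_ne_zero hk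
    have h2 : ψ i + ψ j = k * (2 * Real.pi) := by exact_mod_cast h1
    have h3 := hψ i
    have h4 := hψ j
    have hk0 : (-1 : ℝ) < k := by
      by_contra! hcon
      nlinarith [h3.1, h4.1]
    have hk2 : (k : ℝ) < 2 := by
      by_contra! hcon
      nlinarith [h3.2, h4.2]
    have hk0' : -1 < k := by exact_mod_cast hk0
    have hk2' : k < 2 := by exact_mod_cast hk2
    obtain rfl | rfl : k = 0 ∨ k = 1 := by omega
    · left; simpa using h2
    · right; simpa using h2
  · rintro (h | h)
    · refine ⟨0, ?_⟩
      rw [← Complex.ofReal_add, h]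
      simp
    · refine ⟨1, ?_⟩
      rw [← Complex.ofReal_add, h]
      push_cast
      ring

theorem exp_mul_I_mul_conj_eq_one_iff {m : ℕ} {ψ : Fin m → ℝ} (hψ_mono : StrictMono ψ)
    (hψ : ∀ j, ψ j ∈ Set.Ico 0 (2 * Real.pi)) (i j : Fin m) :
    Complex.exp (ψ i * Complex.I) * (starRingEnd ℂ) (Complex.exp (ψ j * Complex.I)) = 1
      ↔ i = j := by
  have hpi := Real.pi_pos
  have hconj : (starRingEnd ℂ) (Complex.exp (ψ j * Complex.I)) = Complex.exp (-(ψ j * Complex.I)) := by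
    rw [← Complex.exp_conj]
    simp
  rw [hconj, ← Complex.exp_add, ← sub_eq_add_neg, ← sub_mul, Complex.exp_eq_one_iff]
  constructor
  · rintro ⟨k, hk⟩
    rw [← mul_assoc] at hk
    have h1 := mul_right_cancel₀ Complex.I_ne_zero hk
    have h2 : ψ i - ψ j = k * (2 * Real.pi) := by exact_mod_cast h1
    have h3 := hψ i
    have h4 := hψ j
    have hk0 : (-1 : ℝ) < k := by
      by_contra! hcon
      nlinarith [h3.1, h4.2]
    have hk2 : (k : ℝ) < 1 := by
      by_contra! hcon
      nlinarith [h3.2, h4.1]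
    have hk0' : -1 < k := by exact_mod_cast hk0
    have hk2' : k < 1 := by exact_mod_cast hk2
    obtain rfl : k = 0 := by omega
    refine hψ_mono.injective ?_
    simp only [Int.cast_zero, zero_mul] at h2
    linarith
  · rintro rfl
    exact ⟨0, by simp⟩

theorem norm_exp_mul_I (x : ℝ) : ‖Complex.exp (x * Complex.I)‖ = 1 :=
  Complex.norm_exp_ofReal_mul_I x

section

variable {Ω : Type*} [MeasurableSpace Ω] {μ : Measure Ω} [IsProbabilityMeasure μ]

theorem integral_re_mul_sq {X : Ω → ℂ} (h0 : ∫ ω, X ω ∂μ = 0) (h2 : MemLp X 2 μ) {σ₁ σ₂ : ℝ}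
    (hσ₁ : σ₁ ^ 2 = ∫ ω, (X ω).re ^ 2 ∂μ) (hσ₂ : σ₂ ^ 2 = ∫ ω, (X ω).im ^ 2 ∂μ)
    (hcov : cov[fun ω => (X ω).re, fun ω => (X ω).im; μ] = 0) (w : ℂ) :
    ∫ ω, (X ω * w).re ^ 2 ∂μ
      = 1 / 2 * ((σ₁ ^ 2 + σ₂ ^ 2) * ‖w‖ ^ 2 + (σ₁ ^ 2 - σ₂ ^ 2) * (w ^ 2).re) := by
  have hX : Integrable X μ := h2.integrable one_le_two
  have hre2 : MemLp (fun ω => (X ω).re) 2 μ := h2.re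
  have him2 : MemLp (fun ω => (X ω).im) 2 μ := h2.im
  have hre0 : ∫ ω, (X ω).re ∂μ = 0 := by
    have := integral_re hX
    simp only [RCLike.re_to_complex] at this
    rw [this, h0, Complex.zero_re]
  have hxy : ∫ ω, (X ω).re * (X ω).im ∂μ = 0 := by
    rw [covariance_eq_sub hre2 him2, hre0, zero_mul, sub_zero] at hcov
    exact hcov
  have i1 : Integrable (fun ω => (X ω).re ^ 2) μ := hre2.integrable_sq
  have i2 : Integrable (fun ω => (X ω).im ^ 2) μ := him2.integrable_sq
  have i3 : Integrable (fun ω => (X ω).re * (X ω).im) μ := hre2.integrable_mul him2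
  have h : ∀ ω, (X ω * w).re ^ 2 = (X ω).re ^ 2 * w.re ^ 2 + (X ω).im ^ 2 * w.im ^ 2
      - (X ω).re * (X ω).im * (2 * w.re * w.im) := fun ω => by
    rw [Complex.mul_re]; ring
  have i4 : Integrable (fun ω => (X ω).re ^ 2 * w.re ^ 2 + (X ω).im ^ 2 * w.im ^ 2) μ :=
    (i1.mul_const _).add (i2.mul_const _)
  simp_rw [h]
  rw [integral_sub i4 (i3.mul_const _), integral_add (i1.mul_const _) (i2.mul_const _),
    integral_mul_const, integral_mul_const, integral_mul_const, hxy, ← hσ₁, ← hσ₂,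
    ← Complex.normSq_eq_norm_sq, Complex.normSq_apply, sq w, Complex.mul_re]
  ring

theorem measurable_highPart {ξ : ℕ → Ω → ℂ} (hm : ∀ k, Measurable (ξ k)) (b : ℝ → ℝ) (a : ℝ) (n : ℕ)
    (ψ : ℝ) : Measurable fun ω => highPart b (fun k => ξ k ω) a n ψ := by
  unfold highPart
  fun_prop

end

/-- Convergence in distribution depends on the limit through its law only. -/
theorem tendstoInDistribution_of_map_eq {ι E Ω₁ Ω₂ : Type*} {Ω : ι → Type*}
    {mΩ : ∀ i, MeasurableSpace (Ω i)} {μ : ∀ i, Measure (Ω i)} [∀ i, IsProbabilityMeasure (μ i)]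
    [MeasurableSpace Ω₁] [MeasurableSpace Ω₂] {μ₁ : Measure Ω₁} [IsProbabilityMeasure μ₁]
    {μ₂ : Measure Ω₂} [IsProbabilityMeasure μ₂] [MeasurableSpace E] [TopologicalSpace E]
    [OpensMeasurableSpace E] {X : ∀ i, Ω i → E} {l : Filter ι} {Z₁ : Ω₁ → E} {Z₂ : Ω₂ → E}
    (h : TendstoInDistribution X l Z₁ μ μ₁) (hZ₂ : AEMeasurable Z₂ μ₂)
    (he : μ₂.map Z₂ = μ₁.map Z₁) : TendstoInDistribution X l Z₂ μ μ₂ := by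
  refine ⟨h.forall_aemeasurable, hZ₂, ?_⟩
  have hlim : (⟨μ₂.map Z₂, Measure.isProbabilityMeasure_map hZ₂⟩ : ProbabilityMeasure E)
      = ⟨μ₁.map Z₁, Measure.isProbabilityMeasure_map h.aemeasurable_limit⟩ := Subtype.ext he
  rw [hlim]
  exact h.tendsto

section Weights

variable {m : ℕ}

/-- The coefficient of `ξ k` in the linear functional `∑ j, conj (τ j) * highPart _ _ a n (ψ j)`. -/
def highWeight (b : ℝ → ℝ) (a : ℝ) (n : ℕ) (ψ : Fin m → ℝ) (τ : Fin m → ℂ) (k : ℕ) : ℂ :=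
  ((b k * Real.exp (a * k / (2 * n)) : ℝ) : ℂ)
    * ∑ j, (starRingEnd ℂ) (τ j) * Complex.exp (ψ j * Complex.I) ^ k

theorem sum_mul_highPart (b : ℝ → ℝ) (x : ℕ → ℂ) (a : ℝ) (n : ℕ) (ψ : Fin m → ℝ) (τ : Fin m → ℂ) :
    ∑ j, (starRingEnd ℂ) (τ j) * highPart b x a n (ψ j)
      = ∑ k ∈ Finset.Ioc (n / 2) n, x k * highWeight b a n ψ τ k := by
  simp only [highPart, highWeight, Finset.mul_sum]
  rw [Finset.sum_comm]
  exact Finset.sum_congr rfl fun k _ => Finset.sum_congr rfl fun j _ => by ring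

theorem sq_exp_half (a : ℝ) (n k : ℕ) :
    Real.exp (a * k / (2 * n)) ^ 2 = Real.exp (a * k / n) := by
  rw [← Real.exp_nat_mul]
  congr 1
  push_cast
  rw [mul_div_assoc', mul_div_mul_left _ _ two_ne_zero]

theorem tendsto_sum_highWeight_sq {b : ℝ → ℝ} {α : ℝ} (hb : IsRegularlyVarying b α)
    {a : ℕ → ℝ} (ha : IsCentering b a) {ψ : Fin m → ℝ}
    (hψ : ∀ j, ψ j ∈ Set.Ico 0 (2 * Real.pi)) (τ : Fin m → ℂ) :
    Tendsto (fun n => ∑ k ∈ Finset.Ioc (n / 2) n, highWeight b (a n) n ψ τ k ^ 2) atTop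
      (𝓝 (∑ i, ∑ j, oppositeInd ψ i j * ((starRingEnd ℂ) (τ i) * (starRingEnd ℂ) (τ j)))) := by
  have h : ∀ i j : Fin m, Tendsto (fun n : ℕ => (∑ k ∈ Finset.Ioc (n / 2) n,
      ((b k ^ 2 * Real.exp (a n * k / n) : ℝ) : ℂ)
        * (Complex.exp (ψ i * Complex.I) * Complex.exp (ψ j * Complex.I)) ^ k)
        * ((starRingEnd ℂ) (τ i) * (starRingEnd ℂ) (τ j))) atTop
      (𝓝 (oppositeInd ψ i j * ((starRingEnd ℂ) (τ i) * (starRingEnd ℂ) (τ j)))) := by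
    intro i j
    have h1 := ha.tendsto_sum_high_mul_pow hb
      (ω := Complex.exp (ψ i * Complex.I) * Complex.exp (ψ j * Complex.I))
      (by rw [norm_mul, norm_exp_mul_I, norm_exp_mul_I, one_mul])
    have h2 : (if Complex.exp (ψ i * Complex.I) * Complex.exp (ψ j * Complex.I) = 1
        then (1 : ℂ) else 0) = oppositeInd ψ i j := by
      simp only [exp_mul_I_mul_exp_eq_one_iff hψ, oppositeInd]
      split_ifs <;> simp
    rw [h2] at h1
    exact h1.mul_const _
  refine (tendsto_finsetSum _ fun i _ => tendsto_finsetSum _ fun j _ => h i j).congr fun n => ?_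
  simp only [highWeight, mul_pow, ← Complex.ofReal_pow, sq_exp_half]
  simp_rw [sq (∑ j, _), Finset.sum_mul_sum, Finset.sum_mul, Finset.mul_sum]
  rw [Finset.sum_congr rfl fun i _ => Finset.sum_comm, Finset.sum_comm]
  exact Finset.sum_congr rfl fun k _ => Finset.sum_congr rfl fun i _ =>
    Finset.sum_congr rfl fun j _ => by ring

theorem tendsto_sum_norm_highWeight_sq {b : ℝ → ℝ} {α : ℝ} (hb : IsRegularlyVarying b α)
    {a : ℕ → ℝ} (ha : IsCentering b a) {ψ : Fin m → ℝ} (hψ_mono : StrictMono ψ)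
    (hψ : ∀ j, ψ j ∈ Set.Ico 0 (2 * Real.pi)) (τ : Fin m → ℂ) :
    Tendsto (fun n => ∑ k ∈ Finset.Ioc (n / 2) n, ‖highWeight b (a n) n ψ τ k‖ ^ 2) atTop
      (𝓝 (∑ i, ‖τ i‖ ^ 2)) := by
  have h : ∀ i j : Fin m, Tendsto (fun n : ℕ => (∑ k ∈ Finset.Ioc (n / 2) n,
      ((b k ^ 2 * Real.exp (a n * k / n) : ℝ) : ℂ)
        * (Complex.exp (ψ i * Complex.I) * (starRingEnd ℂ) (Complex.exp (ψ j * Complex.I))) ^ k)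
        * ((starRingEnd ℂ) (τ i) * τ j)) atTop
      (𝓝 ((if i = j then 1 else 0) * ((starRingEnd ℂ) (τ i) * τ j))) := by
    intro i j
    have h1 := ha.tendsto_sum_high_mul_pow hb
      (ω := Complex.exp (ψ i * Complex.I) * (starRingEnd ℂ) (Complex.exp (ψ j * Complex.I)))
      (by rw [norm_mul, RCLike.norm_conj, norm_exp_mul_I, norm_exp_mul_I, one_mul])
    simp only [exp_mul_I_mul_conj_eq_one_iff hψ_mono hψ] at h1
    exact h1.mul_const _
  have h2 := tendsto_finsetSum Finset.univ fun i _ =>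
    tendsto_finsetSum Finset.univ fun j _ => h i j
  have h3 := (Complex.continuous_re.tendsto _).comp h2
  have h4 : (∑ i, ∑ j, (if i = j then 1 else 0) * ((starRingEnd ℂ) (τ i) * τ j)).re
      = ∑ i, ‖τ i‖ ^ 2 := by
    rw [Complex.re_sum]
    refine Finset.sum_congr rfl fun i _ => ?_
    simp only [ite_mul, one_mul, zero_mul, Finset.sum_ite_eq, Finset.mem_univ, if_true]
    rw [mul_comm, Complex.mul_conj, Complex.ofReal_re, Complex.normSq_eq_norm_sq]
  rw [h4] at h3
  refine h3.congr fun n => ?_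
  simp only [Function.comp_apply]
  have h5 : ∀ k, ((‖highWeight b (a n) n ψ τ k‖ ^ 2 : ℝ) : ℂ)
      = ∑ i, ∑ j, ((b k ^ 2 * Real.exp (a n * k / n) : ℝ) : ℂ)
        * (Complex.exp (ψ i * Complex.I) * (starRingEnd ℂ) (Complex.exp (ψ j * Complex.I))) ^ k
        * ((starRingEnd ℂ) (τ i) * τ j) := by
    intro k
    rw [← Complex.normSq_eq_norm_sq, ← Complex.mul_conj]
    simp only [highWeight, map_mul, map_sum, map_pow, Complex.conj_conj, Complex.conj_ofReal]
    rw [mul_mul_mul_comm, ← Complex.ofReal_mul, ← sq, mul_pow (b k), sq_exp_half,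
      Finset.sum_mul_sum, Finset.mul_sum]
    refine Finset.sum_congr rfl fun i _ => ?_
    rw [Finset.mul_sum]
    exact Finset.sum_congr rfl fun j _ => by ring
  have h6 : ((∑ k ∈ Finset.Ioc (n / 2) n, ‖highWeight b (a n) n ψ τ k‖ ^ 2 : ℝ) : ℂ)
      = ∑ i, ∑ j, (∑ k ∈ Finset.Ioc (n / 2) n,
      ((b k ^ 2 * Real.exp (a n * k / n) : ℝ) : ℂ)
        * (Complex.exp (ψ i * Complex.I) * (starRingEnd ℂ) (Complex.exp (ψ j * Complex.I))) ^ k)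
        * ((starRingEnd ℂ) (τ i) * τ j) := by
    rw [Complex.ofReal_sum, Finset.sum_congr rfl fun k _ => h5 k]
    simp_rw [Finset.sum_mul]
    rw [Finset.sum_comm]
    exact Finset.sum_congr rfl fun i _ => Finset.sum_comm
  rw [← h6, Complex.ofReal_re]

theorem exists_norm_highWeight_le {b : ℝ → ℝ} {α : ℝ} (hb : IsRegularlyVarying b α)
    {a : ℕ → ℝ} (ha : IsCentering b a) (ψ : Fin m → ℝ) (τ : Fin m → ℂ) :
    ∃ δ : ℕ → ℝ, Tendsto δ atTop (𝓝 0) ∧ ∀ᶠ n : ℕ in atTop, ∀ k ∈ Finset.Ioc (n / 2) n,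
      ‖highWeight b (a n) n ψ τ k‖ ≤ δ n := by
  obtain ⟨δ, hδ, h⟩ := ha.exists_sq_mul_exp_le hb
  refine ⟨fun n => Real.sqrt (δ n) * ∑ j, ‖τ j‖, ?_, ?_⟩
  · have := ((Real.continuous_sqrt.tendsto 0).comp hδ).mul_const (∑ j, ‖τ j‖)
    simpa using this
  · filter_upwards [h] with n hn k hk
    rw [highWeight, norm_mul]
    refine mul_le_mul ?_ ?_ (norm_nonneg _) (Real.sqrt_nonneg _)
    · rw [Complex.norm_real, Real.norm_eq_abs, ← Real.sqrt_sq_eq_abs, mul_pow, sq_exp_half]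
      exact Real.sqrt_le_sqrt (hn k hk)
    · refine (norm_sum_le _ _).trans (Finset.sum_le_sum fun j _ => ?_)
      rw [norm_mul, norm_pow, norm_exp_mul_I, one_pow, mul_one, RCLike.norm_conj]

end Weights

section

variable {Ω : Type*} [MeasurableSpace Ω] {μ : Measure Ω} [IsProbabilityMeasure μ] {m : ℕ}

/-- By Lévy's continuity theorem it suffices to treat the real linear functionals of the vector; these
are weighted sums of the `ξ k`, to which the Lindeberg theorem applies. -/
theorem tendstoInDistribution_highPart {ξ : ℕ → Ω → ℂ} (hm : ∀ k, Measurable (ξ k)) (hind : iIndepFun ξ μ)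
    (hid : ∀ k, IdentDistrib (ξ k) (ξ 0) μ μ) (h0 : ∫ ω, ξ 0 ω ∂μ = 0) (h2 : MemLp (ξ 0) 2 μ)
    {σ₁ σ₂ : ℝ} (hσ₁ : σ₁ ^ 2 = ∫ ω, (ξ 0 ω).re ^ 2 ∂μ) (hσ₂ : σ₂ ^ 2 = ∫ ω, (ξ 0 ω).im ^ 2 ∂μ)
    (hcov : cov[fun ω => (ξ 0 ω).re, fun ω => (ξ 0 ω).im; μ] = 0)
    {b : ℝ → ℝ} {α : ℝ} (hb : IsRegularlyVarying b α) {a : ℕ → ℝ} (ha : IsCentering b a)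
    {ψ : Fin m → ℝ} (hψ_mono : StrictMono ψ) (hψ : ∀ j, ψ j ∈ Set.Ico 0 (2 * Real.pi)) :
    TendstoInDistribution (fun n ω j => highPart b (fun k => ξ k ω) (a n) n (ψ j)) atTop
      (fun N : Fin m → ℂ => N) (fun _ => μ) (limitGaussian ψ σ₁ σ₂) := by
  -- the real and imaginary parts as a Euclidean vector
  set W : ℕ → Ω → EuclideanSpace ℝ (Fin m ⊕ Fin m) := fun n ω => WithLp.toLp 2
    (Sum.elim (fun j => (highPart b (fun k => ξ k ω) (a n) n (ψ j)).re)
      (fun j => (highPart b (fun k => ξ k ω) (a n) n (ψ j)).im)) with hW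
  have hWm : ∀ n, Measurable (W n) := by
    intro n
    refine (WithLp.measurable_toLp 2 _).comp (measurable_pi_lambda _ ?_)
    rintro (j | j)
    · exact Complex.measurable_re.comp (measurable_highPart hm b (a n) n (ψ j))
    · exact Complex.measurable_im.comp (measurable_highPart hm b (a n) n (ψ j))
  have hWT : ∀ n ω, toComplexVec m (W n ω) = fun j => highPart b (fun k => ξ k ω) (a n) n (ψ j) := by
    intro n ω
    ext j
    rw [toComplexVec_apply]
    simp [hW, Complex.re_add_im]
  have hS := posSemidef_limitCov hψ_mono hψ σ₁ σ₂
  have hlaw : TendstoInDistribution W atTop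
      (fun x : EuclideanSpace ℝ (Fin m ⊕ Fin m) => x) (fun _ => μ)
      (multivariateGaussian 0 (limitCov ψ σ₁ σ₂)) := by
    refine ⟨fun n => (hWm n).aemeasurable, aemeasurable_id',
      ProbabilityMeasure.tendsto_of_tendsto_charFun fun t => ?_⟩
    simp only [ProbabilityMeasure.coe_mk, Measure.map_id']
    rw [charFun_multivariateGaussian hS]
    set τ : Fin m → ℂ := fun j => t (.inl j) + t (.inr j) * Complex.I with hτ
    have hinner : ∀ n ω, inner ℝ (W n ω) t
        = ∑ k ∈ Finset.Ioc (n / 2) n, (ξ k ω * highWeight b (a n) n ψ τ k).re := by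
      intro n ω
      rw [← Complex.re_sum, ← sum_mul_highPart, Complex.re_sum, PiLp.inner_apply,
        Fintype.sum_sum_type, ← Finset.sum_add_distrib]
      refine Finset.sum_congr rfl fun j _ => ?_
      simp [hW, hτ, Complex.mul_re]
    have hchar : ∀ n, charFun (μ.map (W n)) t
        = ∫ ω, Complex.exp (((∑ k ∈ Finset.Ioc (n / 2) n,
          (ξ k ω * highWeight b (a n) n ψ τ k).re : ℝ) : ℂ) * Complex.I) ∂μ := by
      intro n
      rw [charFun_apply, integral_map (hWm n).aemeasurable (by fun_prop)]
      simp_rw [hinner]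
    simp_rw [hchar]
    obtain ⟨δ, hδ, hw⟩ := exists_norm_highWeight_le hb ha ψ τ
    have hnorm := tendsto_sum_norm_highWeight_sq hb ha hψ_mono hψ τ
    have hM := hnorm.eventually_le_const (lt_add_one (∑ i, ‖τ i‖ ^ 2))
    have hV : Tendsto (fun n => ∑ k ∈ Finset.Ioc (n / 2) n,
        ∫ ω, (ξ 0 ω * highWeight b (a n) n ψ τ k).re ^ 2 ∂μ) atTop
        (𝓝 (t.ofLp ⬝ᵥ (limitCov ψ σ₁ σ₂).mulVec t.ofLp)) := by
      have h3 := (Complex.continuous_re.tendsto _).comp (tendsto_sum_highWeight_sq hb ha hψ τ)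
      have h4 := ((hnorm.const_mul (σ₁ ^ 2 + σ₂ ^ 2)).add
        (h3.const_mul (σ₁ ^ 2 - σ₂ ^ 2))).const_mul (1 / 2)
      have h5 : t.ofLp ⬝ᵥ (limitCov ψ σ₁ σ₂).mulVec t.ofLp
          = 1 / 2 * ((σ₁ ^ 2 + σ₂ ^ 2) * ∑ i, ‖τ i‖ ^ 2 + (σ₁ ^ 2 - σ₂ ^ 2)
            * (∑ i, ∑ j, oppositeInd ψ i j * ((starRingEnd ℂ) (τ i) * (starRingEnd ℂ) (τ j))).re) := by
        rw [dotProduct_limitCov_mulVec]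
        congr 2
        · refine congrArg _ (Finset.sum_congr rfl fun i _ => ?_)
          rw [← Complex.normSq_eq_norm_sq, Complex.normSq_apply]
          simp [hτ]
          ring
        · simp_rw [Complex.re_sum]
          refine congrArg _ <| Finset.sum_congr rfl fun i _ => Finset.sum_congr rfl fun j _ => ?_
          rw [Complex.re_ofReal_mul, Complex.mul_re]
          simp [hτ]
      rw [h5]
      refine h4.congr fun n => ?_
      simp only [Function.comp_apply]
      simp_rw [integral_re_mul_sq h0 h2 hσ₁ hσ₂ hcov]
      rw [← Finset.mul_sum, Finset.sum_add_distrib, ← Finset.mul_sum, ← Finset.mul_sum,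
        Complex.re_sum]
    have := tendsto_integral_exp_sum hm hind hid h0 h2 hδ hw hM hV
    convert this using 2
    congr 1
    push_cast
    simp
  have hmap := hlaw.continuous_comp (toComplexVec m).continuous
  have hcomp : ∀ n, toComplexVec m ∘ W n = fun ω j => highPart b (fun k => ξ k ω) (a n) n (ψ j) :=
    fun n => funext fun ω => hWT n ω
  simp only [hcomp] at hmap
  refine tendstoInDistribution_of_map_eq hmap aemeasurable_id' ?_
  rw [Measure.map_id', limitGaussian]
  rfl

end

/-! ### Almost sure convergence of the random series -/

section

variable {Ω : Type*} [MeasurableSpace Ω] {μ : Measure Ω} [IsProbabilityMeasure μ]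

theorem integral_sum_sq_of_iIndepFun {ι : Type*} {X : ι → Ω → ℝ} (hind : iIndepFun X μ)
    (h2 : ∀ k, MemLp (X k) 2 μ) (h0 : ∀ k, ∫ ω, X k ω ∂μ = 0) (s : Finset ι) :
    ∫ ω, (∑ k ∈ s, X k ω) ^ 2 ∂μ = ∑ k ∈ s, ∫ ω, X k ω ^ 2 ∂μ := by
  have hsum : MemLp (∑ k ∈ s, X k) 2 μ := memLp_finsetSum' s fun k _ => h2 k
  have hmean : ∫ ω, (∑ k ∈ s, X k) ω ∂μ = 0 := by
    simp only [Finset.sum_apply]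
    rw [integral_finsetSum _ fun k _ => (h2 k).integrable one_le_two]
    exact Finset.sum_eq_zero fun k _ => h0 k
  have h := IndepFun.variance_sum (s := s) (fun k _ => h2 k)
    (fun i _ j _ hij => hind.indepFun hij)
  rw [variance_of_integral_eq_zero hsum.1.aemeasurable hmean] at h
  simp only [Finset.sum_apply] at h
  rw [h]
  exact Finset.sum_congr rfl fun k _ =>
    variance_of_integral_eq_zero (h2 k).1.aemeasurable (h0 k)

/-- A series of independent centred square-integrable variables with summable variances converges
almost surely: its partial sums form a martingale bounded in `L²`. -/
theorem ae_exists_tendsto_sum_of_iIndepFun {X : ℕ → Ω → ℝ} (hm : ∀ k, Measurable (X k))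
    (hind : iIndepFun X μ) (h2 : ∀ k, MemLp (X k) 2 μ) (h0 : ∀ k, ∫ ω, X k ω ∂μ = 0)
    (hs : Summable fun k => ∫ ω, X k ω ^ 2 ∂μ) :
    ∀ᵐ ω ∂μ, ∃ c, Tendsto (fun n : ℕ => ∑ k ∈ Finset.range (n + 1), X k ω) atTop (𝓝 c) := by
  have hsm : ∀ k, StronglyMeasurable (X k) := fun k => (hm k).stronglyMeasurable
  have hint : ∀ k, Integrable (X k) μ := fun k => (h2 k).integrable one_le_two
  have hmart : Martingale (fun (n : ℕ) ω => ∑ k ∈ Finset.range (n + 1), X k ω)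
      (Filtration.natural X hsm) μ := by
    refine martingale_of_condExp_sub_eq_zero_nat ?_ ?_ ?_
    · intro n
      refine Finset.stronglyMeasurable_fun_sum _ fun k hk => ?_
      exact (Filtration.stronglyAdapted_natural hsm k).mono
        ((Filtration.natural X hsm).mono (Nat.lt_succ_iff.mp (Finset.mem_range.mp hk)))
    · exact fun n => integrable_finsetSum _ fun k _ => hint k
    · intro n
      have h1 : ((fun ω => ∑ k ∈ Finset.range (n + 1 + 1), X k ω)
          - fun ω => ∑ k ∈ Finset.range (n + 1), X k ω) = X (n + 1) := by
        ext ω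
        simp [Finset.sum_range_succ]
      rw [h1]
      refine (hind.condExp_natural_ae_eq_of_lt hsm (Nat.lt_succ_self n)).trans ?_
      rw [h0]
      rfl
  refine hmart.submartingale.exists_ae_tendsto_of_bdd
    (R := (1 + ∑' k, ∫ ω, X k ω ^ 2 ∂μ).toNNReal) fun n => ?_
  have hS : MemLp (fun ω => ∑ k ∈ Finset.range (n + 1), X k ω) 2 μ :=
    memLp_finsetSum _ fun k _ => h2 k
  rw [eLpNorm_one_eq_lintegral_enorm, ← ofReal_integral_norm_eq_lintegral_enorm
    (hS.integrable one_le_two)]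
  refine ENNReal.ofReal_le_ofReal ?_
  have h3 : ∫ ω, ‖∑ k ∈ Finset.range (n + 1), X k ω‖ ∂μ
      ≤ ∫ ω, (1 + (∑ k ∈ Finset.range (n + 1), X k ω) ^ 2) ∂μ := by
    refine integral_mono (hS.integrable one_le_two).norm
      ((integrable_const _).add hS.integrable_sq) fun ω => ?_
    simp only [Real.norm_eq_abs]
    rw [← sq_abs]
    nlinarith [sq_nonneg (|∑ k ∈ Finset.range (n + 1), X k ω| - 1),
      abs_nonneg (∑ k ∈ Finset.range (n + 1), X k ω)]
  refine h3.trans ?_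
  rw [integral_add (integrable_const _) hS.integrable_sq, integral_sum_sq_of_iIndepFun hind h2 h0]
  simp only [integral_const, probReal_univ, smul_eq_mul, mul_one]
  gcongr
  exact hs.sum_le_tsum _ fun k _ => integral_nonneg fun ω => sq_nonneg _

end

section

variable {Ω : Type*} [MeasurableSpace Ω] {μ : Measure Ω} {ξ : ℕ → Ω → ℂ}

theorem integral_norm_sq_eq_of_identDistrib (hid : ∀ k, IdentDistrib (ξ k) (ξ 0) μ μ) (k : ℕ) :
    ∫ ω, ‖ξ k ω‖ ^ 2 ∂μ = ∫ ω, ‖ξ 0 ω‖ ^ 2 ∂μ :=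
  ((hid k).comp (u := fun z : ℂ => ‖z‖ ^ 2) (by fun_prop)).integral_eq

theorem integral_const_mul_eq_zero_of_identDistrib (hid : ∀ k, IdentDistrib (ξ k) (ξ 0) μ μ)
    (h0 : ∫ ω, ξ 0 ω ∂μ = 0) (c : ℂ) (k : ℕ) : ∫ ω, c * ξ k ω ∂μ = 0 := by
  rw [integral_const_mul, (hid k).integral_eq, h0, mul_zero]

theorem memLp_const_mul_of_identDistrib (hid : ∀ k, IdentDistrib (ξ k) (ξ 0) μ μ)
    (h2 : MemLp (ξ 0) 2 μ) (c : ℂ) (k : ℕ) : MemLp (fun ω => c * ξ k ω) 2 μ :=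
  ((hid k).memLp_iff.mpr h2).const_mul c

theorem integral_re_sq_add_integral_im_sq {X : Ω → ℂ} (h2 : MemLp X 2 μ) :
    ∫ ω, (X ω).re ^ 2 ∂μ + ∫ ω, (X ω).im ^ 2 ∂μ = ∫ ω, ‖X ω‖ ^ 2 ∂μ := by
  have i1 : Integrable (fun ω => (X ω).re ^ 2) μ := h2.re.integrable_sq
  have i2 : Integrable (fun ω => (X ω).im ^ 2) μ := h2.im.integrable_sq
  rw [← integral_add i1 i2]
  refine integral_congr_ae (ae_of_all _ fun ω => ?_)
  simp only [← Complex.normSq_eq_norm_sq, Complex.normSq_apply]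
  ring

end

section

variable {Ω : Type*} [MeasurableSpace Ω] {μ : Measure Ω} [IsProbabilityMeasure μ] {ξ : ℕ → Ω → ℂ}

theorem integral_re_const_mul_eq_zero (hid : ∀ k, IdentDistrib (ξ k) (ξ 0) μ μ)
    (h0 : ∫ ω, ξ 0 ω ∂μ = 0) (h2 : MemLp (ξ 0) 2 μ) (c : ℂ) (k : ℕ) :
    ∫ ω, (c * ξ k ω).re ∂μ = 0 := by
  have := integral_re ((memLp_const_mul_of_identDistrib hid h2 c k).integrable one_le_two)
  simp only [RCLike.re_to_complex] at this
  rw [this, integral_const_mul_eq_zero_of_identDistrib hid h0, Complex.zero_re]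

theorem integral_im_const_mul_eq_zero (hid : ∀ k, IdentDistrib (ξ k) (ξ 0) μ μ)
    (h0 : ∫ ω, ξ 0 ω ∂μ = 0) (h2 : MemLp (ξ 0) 2 μ) (c : ℂ) (k : ℕ) :
    ∫ ω, (c * ξ k ω).im ∂μ = 0 := by
  have := integral_im ((memLp_const_mul_of_identDistrib hid h2 c k).integrable one_le_two)
  simp only [RCLike.im_to_complex] at this
  rw [this, integral_const_mul_eq_zero_of_identDistrib hid h0, Complex.zero_im]

theorem ae_exists_tendsto_sum_mul (hm : ∀ k, Measurable (ξ k)) (hind : iIndepFun ξ μ)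
    (hid : ∀ k, IdentDistrib (ξ k) (ξ 0) μ μ) (h0 : ∫ ω, ξ 0 ω ∂μ = 0) (h2 : MemLp (ξ 0) 2 μ)
    {c : ℕ → ℂ} (hc : Summable fun k => ‖c k‖ ^ 2) :
    ∀ᵐ ω ∂μ, ∃ s, Tendsto (fun n : ℕ => ∑ k ∈ Finset.range (n + 1), c k * ξ k ω) atTop (𝓝 s) := by
  have hX := fun k => memLp_const_mul_of_identDistrib hid h2 (c k) k
  have hre : iIndepFun (fun k ω => (c k * ξ k ω).re) μ :=
    hind.comp (fun k z => (c k * z).re) fun k => by fun_prop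
  have him : iIndepFun (fun k ω => (c k * ξ k ω).im) μ :=
    hind.comp (fun k z => (c k * z).im) fun k => by fun_prop
  have hsum : Summable fun k => ∫ ω, ‖c k * ξ k ω‖ ^ 2 ∂μ := by
    simp_rw [norm_mul, mul_pow]
    simp_rw [integral_const_mul, integral_norm_sq_eq_of_identDistrib hid]
    exact hc.mul_right _
  have hs1 : Summable fun k => ∫ ω, (c k * ξ k ω).re ^ 2 ∂μ := by
    refine hsum.of_nonneg_of_le (fun k => integral_nonneg fun ω => sq_nonneg _) fun k => ?_
    rw [← integral_re_sq_add_integral_im_sq (hX k)]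
    exact le_add_of_nonneg_right (integral_nonneg fun ω => sq_nonneg _)
  have hs2 : Summable fun k => ∫ ω, (c k * ξ k ω).im ^ 2 ∂μ := by
    refine hsum.of_nonneg_of_le (fun k => integral_nonneg fun ω => sq_nonneg _) fun k => ?_
    rw [← integral_re_sq_add_integral_im_sq (hX k)]
    exact le_add_of_nonneg_left (integral_nonneg fun ω => sq_nonneg _)
  filter_upwards [ae_exists_tendsto_sum_of_iIndepFun (fun k => by fun_prop) hre
      (fun k => (hX k).re) (fun k => integral_re_const_mul_eq_zero hid h0 h2 (c k) k) hs1,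
    ae_exists_tendsto_sum_of_iIndepFun (fun k => by fun_prop) him
      (fun k => (hX k).im) (fun k => integral_im_const_mul_eq_zero hid h0 h2 (c k) k) hs2]
    with ω ⟨x, hx⟩ ⟨y, hy⟩
  refine ⟨x + y * Complex.I, ?_⟩
  refine (((Complex.continuous_ofReal.tendsto x).comp hx).add
    (((Complex.continuous_ofReal.tendsto y).comp hy).mul_const Complex.I)).congr fun n => ?_
  simp only [Function.comp_apply]
  rw [← Complex.re_sum, ← Complex.im_sum, Complex.re_add_im]

end

/-! ### The random series has no atoms -/

theorem indepFun_update_zero {Ω : Type*} [MeasurableSpace Ω] {μ : Measure Ω}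
    {ξ : ℕ → Ω → ℂ} (hm : ∀ k, Measurable (ξ k)) (hind : iIndepFun ξ μ)
    (k : ℕ) : IndepFun (ξ k) (fun ω => Function.update (fun j => ξ j ω) k 0) μ := by
  have h := indep_iSup_of_disjoint (fun j => (hm j).comap_le) hind
    (S := {k}) (T := {k}ᶜ) (by simp)
  rw [iSup_singleton] at h
  rw [IndepFun_iff_Indep]
  refine indep_of_indep_of_le_right h ?_
  rw [← measurable_iff_comap_le]
  refine @measurable_pi_lambda _ _ _ (_) _ _ fun j => ?_
  by_cases hj : j = k
  · subst hj
    simp only [Function.update_self]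
    exact measurable_const
  · simp only [Function.update_of_ne hj]
    rw [measurable_iff_comap_le]
    exact le_iSup₂_of_le j hj le_rfl

section

variable {Ω : Type*} [MeasurableSpace Ω] {μ : Measure Ω} [IsProbabilityMeasure μ]

/-- If no point has full mass, then the masses of points are bounded away from `1`, since at most
one point has mass above `1 / 2`. -/
theorem exists_lt_one_forall_measure_singleton_le {E : Type*} [MeasurableSpace E]
    [MeasurableSingletonClass E] (ν : Measure E) [IsProbabilityMeasure ν] (h : ∀ y, ν {y} ≠ 1) :
    ∃ q < 1, ∀ y, ν {y} ≤ q := by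
  by_cases h1 : ∃ y₀, 1 / 2 < ν {y₀}
  · obtain ⟨y₀, hy₀⟩ := h1
    refine ⟨ν {y₀}, lt_of_le_of_ne prob_le_one (h y₀), fun y => ?_⟩
    by_cases hy : y = y₀
    · rw [hy]
    · by_contra! hlt
      have h3 : ν {y} + ν {y₀} ≤ 1 := by
        rw [← measure_union (by simpa using hy) (measurableSet_singleton _)]
        exact prob_le_one
      have h4 : (1 : ℝ≥0∞) < ν {y} + ν {y₀} := by
        calc (1 : ℝ≥0∞) = 1 / 2 + 1 / 2 := (ENNReal.add_halves 1).symm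
          _ < ν {y} + ν {y₀} := ENNReal.add_lt_add (hy₀.trans hlt) hy₀
      exact absurd h4 (not_lt.mpr h3)
  · push Not at h1
    exact ⟨1 / 2, ENNReal.half_lt_self one_ne_zero ENNReal.one_ne_top, h1⟩

theorem measure_preimage_inter_eq_le_of_indepFun {F : Type*} [MeasurableSpace F] {X : Ω → ℂ} {Y : Ω → F} (hX : Measurable X) (hY : Measurable Y)
    (h : IndepFun X Y μ) {q : ℝ≥0∞} (hq : ∀ y, μ {ω | X ω = y} ≤ q) {B : Set F}
    (hB : MeasurableSet B) {Z : F → ℂ} (hZ : Measurable Z) :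
    μ {ω | Y ω ∈ B ∧ X ω = Z (Y ω)} ≤ q * μ (Y ⁻¹' B) := by
  have hP : MeasurableSet {p : F × ℂ | p.1 ∈ B ∧ p.2 = Z p.1} :=
    (hB.preimage measurable_fst).inter (measurableSet_eq_fun measurable_snd (hZ.comp measurable_fst))
  have hpm : IsProbabilityMeasure (μ.map Y) := Measure.isProbabilityMeasure_map hY.aemeasurable
  have hpm' : IsProbabilityMeasure (μ.map X) := Measure.isProbabilityMeasure_map hX.aemeasurable
  have h1 : μ {ω | Y ω ∈ B ∧ X ω = Z (Y ω)}
      = ((μ.map Y).prod (μ.map X)) {p : F × ℂ | p.1 ∈ B ∧ p.2 = Z p.1} := by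
    rw [← h.symm.map_prod_eq_prod_map_map hY.aemeasurable hX.aemeasurable,
      Measure.map_apply (hY.prodMk hX) hP]
    rfl
  rw [h1, Measure.prod_apply hP, ← Measure.map_apply hY hB, ← lintegral_indicator_one hB,
    ← lintegral_const_mul _ (measurable_one.indicator hB)]
  refine lintegral_mono fun y => ?_
  by_cases hy : y ∈ B
  · simp only [hy, Set.indicator_of_mem, Pi.one_apply, mul_one]
    refine le_trans ?_ (hq (Z y))
    have h2 : Prod.mk y ⁻¹' {p : F × ℂ | p.1 ∈ B ∧ p.2 = Z p.1} = {Z y} := by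
      ext z; simp [hy]
    rw [h2, Measure.map_apply hX (measurableSet_singleton _)]
    rfl
  · simp [hy]

/-- A convergent random series of independent variables, whose laws have point masses bounded away
from `1`, has no atoms. The event `E` that the sum is `y` is nearly an event `A` that involves
finitely many of the variables; given `A` and all variables but one that does not enter `A`, `E`
prescribes the value of the remaining one, so `P (A ∩ E) ≤ q P A`, whence `P E ≤ q P E`. -/
theorem measure_tendsto_sum_mul_eq_zero {ξ : ℕ → Ω → ℂ} (hm : ∀ k, Measurable (ξ k))
    (hind : iIndepFun ξ μ) {q : ℝ≥0∞} (hq1 : q < 1) (hq : ∀ k y, μ {ω | ξ k ω = y} ≤ q)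
    {c : ℕ → ℂ} (hc : ∃ᶠ k in atTop, c k ≠ 0) (y : ℂ) :
    μ {ω | Tendsto (fun n : ℕ => ∑ k ∈ Finset.range (n + 1), c k * ξ k ω) atTop (𝓝 y)} = 0 := by
  set Ξ : Ω → ℕ → ℂ := fun ω k => ξ k ω with hΞ
  have hΞm : Measurable Ξ := measurable_pi_lambda _ hm
  have hpm : IsProbabilityMeasure (μ.map Ξ) := Measure.isProbabilityMeasure_map hΞm.aemeasurable
  set S : ℕ → (ℕ → ℂ) → ℂ := fun n x => ∑ k ∈ Finset.range (n + 1), c k * x k with hS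
  have hSm : ∀ n, Measurable (S n) := fun n => by fun_prop
  set E : Set (ℕ → ℂ) := {x | Tendsto (fun n => S n x) atTop (𝓝 y)} with hE
  have hEm : MeasurableSet E := measurableSet_tendsto (𝓝 y) hSm
  have hEq : μ {ω | Tendsto (fun n : ℕ => ∑ k ∈ Finset.range (n + 1), c k * ξ k ω) atTop (𝓝 y)}
      = (μ.map Ξ) E := by
    rw [Measure.map_apply hΞm hEm]
    rfl
  rw [hEq]
  set T : (ℕ → ℂ) → ℂ := fun x => limUnder atTop fun n => S n x with hT
  have hTm : Measurable T :=
    (StronglyMeasurable.limUnder fun n => (hSm n).stronglyMeasurable).measurable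
  have hcyl : ∀ A ∈ measurableCylinders (fun _ : ℕ => ℂ),
      (μ.map Ξ) (A ∩ E) ≤ q * (μ.map Ξ) A := by
    intro A hA
    obtain ⟨s, S₀, hS₀, rfl⟩ := (mem_measurableCylinders A).mp hA
    obtain ⟨k, hk, hck⟩ : ∃ k, k ∉ s ∧ c k ≠ 0 := by
      obtain ⟨k, hk1, hk2⟩ := (hc.and_eventually (eventually_gt_atTop (s.sup id))).exists
      exact ⟨k, fun hks => absurd (Finset.le_sup (f := id) hks) (not_le.mpr hk2), hk1⟩
    have hcm : MeasurableSet (cylinder (α := fun _ : ℕ => ℂ) s S₀) := MeasurableSet.of_mem_measurableCylinders hA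
    have hupd : ∀ ω, Function.update (Ξ ω) k 0 ∈ cylinder s S₀ ↔ Ξ ω ∈ cylinder s S₀ := by
      intro ω
      rw [mem_cylinder, mem_cylinder]
      have : s.restrict (Function.update (Ξ ω) k 0) = s.restrict (Ξ ω) := by
        ext j
        simp only [Finset.restrict]
        rw [Function.update_of_ne]
        rintro rfl
        exact hk j.2
      rw [this]
    have hYm : Measurable fun ω => Function.update (Ξ ω) k 0 := by
      refine measurable_pi_lambda _ fun j => ?_
      by_cases hj : j = k
      · subst hj; simp
      · simp only [Function.update_of_ne hj]; exact hm j
    have key := measure_preimage_inter_eq_le_of_indepFun (hm k) hYm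
      (indepFun_update_zero hm hind k) (hq k) hcm
      (Z := fun x => (y - T x) / c k) (by fun_prop)
    rw [Measure.map_apply hΞm (hcm.inter hEm), Measure.map_apply hΞm hcm]
    have h1 : (fun ω => Function.update (Ξ ω) k 0) ⁻¹' cylinder s S₀ = Ξ ⁻¹' cylinder s S₀ := by
      ext ω; exact hupd ω
    rw [h1] at key
    refine le_trans (measure_mono ?_) key
    rintro ω ⟨hω1, hω2⟩
    refine ⟨(hupd ω).mpr hω1, ?_⟩
    have h2 : Tendsto (fun n => S n (Function.update (Ξ ω) k 0)) atTop
        (𝓝 (y - c k * ξ k ω)) := by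
      have h3 : Tendsto (fun n => S n (Ξ ω)) atTop (𝓝 y) := hω2
      refine (h3.sub_const (c k * ξ k ω)).congr' ?_
      filter_upwards [eventually_ge_atTop k] with n hn
      have hkn : k ∈ Finset.range (n + 1) := Finset.mem_range.mpr (by omega)
      simp only [hS]
      rw [← Finset.add_sum_erase _ _ hkn, ← Finset.add_sum_erase _ _ hkn, Function.update_self,
        mul_zero, zero_add, add_sub_cancel_left]
      refine Finset.sum_congr rfl fun j hj => ?_
      rw [Function.update_of_ne (Finset.ne_of_mem_erase hj)]
    change ξ k ω = (y - T (Function.update (Ξ ω) k 0)) / c k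
    rw [hT]
    simp only [h2.limUnder_eq]
    field_simp
    ring
  -- approximate `E` by cylinders
  by_contra hne
  have hpos : 0 < (μ.map Ξ).real E := by
    rw [measureReal_def]
    exact ENNReal.toReal_pos hne (measure_ne_top _ _)
  set r := (μ.map Ξ).real E with hr
  have hqr : q.toReal < 1 := by
    rw [← ENNReal.toReal_one]
    exact ENNReal.toReal_strict_mono ENNReal.one_ne_top hq1
  obtain ⟨A, hA, hAE⟩ := exists_measure_symmDiff_lt_of_generateFrom_isSetRing (μ := μ.map Ξ)
    (C := measurableCylinders (fun _ : ℕ => ℂ)) isSetAlgebra_measurableCylinders.isSetRing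
    ⟨{Set.univ}, Set.countable_singleton _,
      by simpa using univ_mem_measurableCylinders (fun _ : ℕ => ℂ), by simp⟩
    generateFrom_measurableCylinders.symm hEm
    (ε := ENNReal.ofReal ((1 - q.toReal) * r / 2))
    (ENNReal.ofReal_pos.mpr (by
      have : 0 < 1 - q.toReal := by linarith
      positivity))
  set δ := (μ.map Ξ).real (symmDiff A E) with hδ
  have hδlt : δ < (1 - q.toReal) * r / 2 := by
    rw [hδ, measureReal_def]
    exact ENNReal.toReal_lt_of_lt_ofReal hAE
  have h1 : r ≤ (μ.map Ξ).real (A ∩ E) + δ := by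
    refine (measureReal_mono ?_ (measure_ne_top _ _)).trans (measureReal_union_le _ _)
    intro x hx
    by_cases hxA : x ∈ A
    · exact Or.inl ⟨hxA, hx⟩
    · exact Or.inr (Or.inr ⟨hx, hxA⟩)
  have h2 : (μ.map Ξ).real A ≤ r + δ := by
    refine (measureReal_mono ?_ (measure_ne_top _ _)).trans (measureReal_union_le _ _)
    intro x hx
    by_cases hxE : x ∈ E
    · exact Or.inl hxE
    · exact Or.inr (Or.inl ⟨hx, hxE⟩)
  have h3 : (μ.map Ξ).real (A ∩ E) ≤ q.toReal * (μ.map Ξ).real A := by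
    simp only [measureReal_def]
    rw [← ENNReal.toReal_mul]
    exact ENNReal.toReal_mono (ENNReal.mul_ne_top hq1.ne_top (measure_ne_top _ _)) (hcyl A hA)
  have h4 : 0 ≤ q.toReal := ENNReal.toReal_nonneg
  have h5 : 0 ≤ δ := measureReal_nonneg
  nlinarith [mul_le_mul_of_nonneg_left h2 h4]

end

section

variable {Ω : Type*} [MeasurableSpace Ω] {μ : Measure Ω} [IsProbabilityMeasure μ] {ξ : ℕ → Ω → ℂ}
  {b : ℝ → ℝ}

theorem weightedPoly_eq_sum_mul (b : ℝ → ℝ) (x : ℕ → ℂ) (n : ℕ) (z : ℂ) :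
    weightedPoly b x n z = ∑ k ∈ Finset.range (n + 1), ((b k : ℂ) * z ^ k) * x k :=
  Finset.sum_congr rfl fun k _ => by ring

theorem norm_mul_exp_mul_I_pow (r ψ : ℝ) (k : ℕ) :
    ‖(r : ℂ) * Complex.exp (ψ * Complex.I) ^ k‖ = |r| := by
  rw [norm_mul, norm_pow, norm_exp_mul_I, one_pow, mul_one, Complex.norm_real, Real.norm_eq_abs]

theorem measurable_weightedPoly (hm : ∀ k, Measurable (ξ k)) (b : ℝ → ℝ) (n : ℕ) (z : ℂ) :
    Measurable fun ω => weightedPoly b (fun k => ξ k ω) n z := by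
  unfold weightedPoly
  fun_prop

theorem measurable_weightedSeries (hm : ∀ k, Measurable (ξ k)) (b : ℝ → ℝ) (z : ℂ) :
    Measurable fun ω => weightedSeries b (fun k => ξ k ω) z :=
  (StronglyMeasurable.limUnder fun n => (measurable_weightedPoly hm b n z).stronglyMeasurable).measurable

theorem ae_tendsto_weightedPoly (hm : ∀ k, Measurable (ξ k)) (hind : iIndepFun ξ μ)
    (hid : ∀ k, IdentDistrib (ξ k) (ξ 0) μ μ) (h0 : ∫ ω, ξ 0 ω ∂μ = 0) (h2 : MemLp (ξ 0) 2 μ)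
    (hs : Summable fun k : ℕ => b k ^ 2) (ψ : ℝ) :
    ∀ᵐ ω ∂μ, Tendsto (fun n : ℕ => weightedPoly b (fun k => ξ k ω) n (Complex.exp (ψ * Complex.I)))
      atTop (𝓝 (weightedSeries b (fun k => ξ k ω) (Complex.exp (ψ * Complex.I)))) := by
  have hc : Summable fun k : ℕ => ‖(b k : ℂ) * Complex.exp (ψ * Complex.I) ^ k‖ ^ 2 := by
    simpa only [norm_mul_exp_mul_I_pow, sq_abs] using hs
  filter_upwards [ae_exists_tendsto_sum_mul hm hind hid h0 h2 hc] with ω hω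
  refine tendsto_nhds_limUnder ?_
  simpa only [weightedPoly_eq_sum_mul] using hω

/-- The sum of the series has no atom at `0`. Positive variance and mean zero keep `ξ 0` from being
almost surely constant, so that its point masses are bounded away from `1`. -/
theorem ae_weightedSeries_ne_zero (hm : ∀ k, Measurable (ξ k)) (hind : iIndepFun ξ μ)
    (hid : ∀ k, IdentDistrib (ξ k) (ξ 0) μ μ) (h0 : ∫ ω, ξ 0 ω ∂μ = 0) (h2 : MemLp (ξ 0) 2 μ)
    (hpos : 0 < ∫ ω, ‖ξ 0 ω‖ ^ 2 ∂μ)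
    (hs : Summable fun k : ℕ => b k ^ 2) (hb : ∀ᶠ n : ℕ in atTop, b n ≠ 0) (ψ : ℝ) :
    ∀ᵐ ω ∂μ, weightedSeries b (fun k => ξ k ω) (Complex.exp (ψ * Complex.I)) ≠ 0 := by
  have hpm : IsProbabilityMeasure (μ.map (ξ 0)) :=
    Measure.isProbabilityMeasure_map (hm 0).aemeasurable
  obtain ⟨q, hq1, hq⟩ := exists_lt_one_forall_measure_singleton_le (μ.map (ξ 0)) fun y hy => by
    rw [Measure.map_apply (hm 0) (measurableSet_singleton y)] at hy
    have hae : ∀ᵐ ω ∂μ, ξ 0 ω = y :=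
      (prob_compl_eq_zero_iff ((hm 0) (measurableSet_singleton y))).mpr hy
    have hy0 : y = 0 := by
      rw [integral_congr_ae hae] at h0
      simpa using h0
    have : ∫ ω, ‖ξ 0 ω‖ ^ 2 ∂μ = 0 := by
      refine integral_eq_zero_of_ae ?_
      filter_upwards [hae] with ω hω
      simp [hω, hy0]
    exact hpos.ne' this
  have hq' : ∀ k y, μ {ω | ξ k ω = y} ≤ q := by
    intro k y
    have := hq y
    rw [← (hid k).map_eq, Measure.map_apply (hm k) (measurableSet_singleton y)] at this
    exact this
  have hc : ∃ᶠ k : ℕ in atTop, (b k : ℂ) * Complex.exp (ψ * Complex.I) ^ k ≠ 0 := by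
    refine (hb.mono fun k hk => ?_).frequently
    exact mul_ne_zero (by exact_mod_cast hk) (pow_ne_zero _ (Complex.exp_ne_zero _))
  have hnull := measure_tendsto_sum_mul_eq_zero hm hind hq1 hq' hc 0
  have hae : ∀ᵐ ω ∂μ, ¬ Tendsto (fun n : ℕ => ∑ k ∈ Finset.range (n + 1),
      ((b k : ℂ) * Complex.exp (ψ * Complex.I) ^ k) * ξ k ω) atTop (𝓝 0) := by
    rw [ae_iff]
    simpa only [not_not] using hnull
  filter_upwards [hae, ae_tendsto_weightedPoly hm hind hid h0 h2 hs ψ] with ω h3 h4 h5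
  rw [h5] at h4
  exact h3 (by simpa only [weightedPoly_eq_sum_mul] using h4)

end

/-! ### A Hilbert space of entire functions of exponential type -/

/-- The space `ℓ²(ℕ)`, a sequence `w` in which stands for the entire function
`u ↦ ∑ p, w p (2 u)^p / p!`. -/
abbrev CoeffSpace : Type := lp (fun _ : ℕ => ℂ) 2

instance : MeasurableSpace CoeffSpace := borel CoeffSpace

instance : BorelSpace CoeffSpace := ⟨rfl⟩

instance : SecondCountableTopology CoeffSpace := by
  have hb : (Submodule.span ℂ (Set.range fun i : ℕ =>
      lp.single (E := fun _ : ℕ => ℂ) 2 i (1 : ℂ))).topologicalClosure = ⊤ := by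
    rw [eq_top_iff]
    intro f _
    have h := lp.hasSum_single (E := fun _ : ℕ => ℂ) (p := 2) ENNReal.ofNat_ne_top f
    refine mem_closure_of_tendsto h (Eventually.of_forall fun s => ?_)
    refine Submodule.sum_mem _ fun i _ => ?_
    have h1 : lp.single (E := fun _ : ℕ => ℂ) 2 i (f i : ℂ)
        = (f i : ℂ) • lp.single (E := fun _ : ℕ => ℂ) 2 i (1 : ℂ) := by
      rw [← lp.single_smul, smul_eq_mul, mul_one]
    rw [h1]
    exact Submodule.smul_mem _ _ (Submodule.subset_span ⟨i, rfl⟩)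
  have hsep : TopologicalSpace.IsSeparable (Set.univ : Set CoeffSpace) := by
    have h := ((Set.countable_range fun i : ℕ =>
      lp.single (E := fun _ : ℕ => ℂ) 2 i (1 : ℂ)).isSeparable.span (R := ℂ)).closure
    rw [← Submodule.topologicalClosure_coe, hb] at h
    exact h
  have : TopologicalSpace.SeparableSpace CoeffSpace :=
    TopologicalSpace.isSeparable_univ_iff.mp hsep
  exact UniformSpace.secondCountable_of_separable _

namespace CoeffSpace

theorem norm_term_le (w : CoeffSpace) (u : ℂ) (p : ℕ) :
    ‖w p * ((2 * u) ^ p / (p.factorial : ℂ))‖ ≤ ‖w‖ * ((2 * ‖u‖) ^ p / p.factorial) := by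
  rw [norm_mul, norm_div, norm_pow, norm_mul, Complex.norm_natCast, Complex.norm_ofNat]
  gcongr
  exact lp.norm_apply_le_norm two_ne_zero w p

theorem summable_norm_bound (C r : ℝ) : Summable fun p : ℕ => C * ((2 * r) ^ p / p.factorial) :=
  (Real.summable_pow_div_factorial (2 * r)).mul_left C

theorem summable_term (w : CoeffSpace) (u : ℂ) :
    Summable fun p : ℕ => w p * ((2 * u) ^ p / (p.factorial : ℂ)) :=
  Summable.of_norm_bounded (summable_norm_bound ‖w‖ ‖u‖) (norm_term_le w u)

/-- The function `u ↦ ∑ p, w p (2 u)^p / p!`. -/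
def eval (w : CoeffSpace) (u : ℂ) : ℂ := ∑' p : ℕ, w p * ((2 * u) ^ p / (p.factorial : ℂ))

theorem differentiable_eval (w : CoeffSpace) : Differentiable ℂ (eval w) := by
  intro u
  have h := Complex.differentiableOn_tsum_of_summable_norm (F := fun (p : ℕ) (u : ℂ) =>
    w p * ((2 * u) ^ p / (p.factorial : ℂ))) (U := Metric.ball 0 (‖u‖ + 1))
    (summable_norm_bound ‖w‖ (‖u‖ + 1)) (fun p => by fun_prop) Metric.isOpen_ball
    (fun p z hz => (norm_term_le w z p).trans (by
      have : ‖z‖ ≤ ‖u‖ + 1 := (mem_ball_zero_iff.mp hz).le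
      gcongr))
  exact h.differentiableAt (Metric.isOpen_ball.mem_nhds (by simp))

theorem eval_add (v w : CoeffSpace) (u : ℂ) : eval (v + w) u = eval v u + eval w u := by
  rw [eval, eval, eval, ← (summable_term v u).tsum_add (summable_term w u)]
  exact tsum_congr fun p => by rw [lp.coeFn_add, Pi.add_apply, add_mul]

theorem eval_smul (c : ℂ) (w : CoeffSpace) (u : ℂ) : eval (c • w) u = c * eval w u := by
  rw [eval, eval, ← tsum_mul_left]
  exact tsum_congr fun p => by rw [lp.coeFn_smul, Pi.smul_apply, smul_eq_mul, mul_assoc]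

/-- Evaluation at a point, as a linear map. -/
def evalLinear (u : ℂ) : CoeffSpace →ₗ[ℂ] ℂ where
  toFun w := eval w u
  map_add' v w := eval_add v w u
  map_smul' c w := eval_smul c w u

theorem norm_eval_le (w : CoeffSpace) (u : ℂ) : ‖eval w u‖ ≤ ‖w‖ * Real.exp (2 * ‖u‖) := by
  rw [Real.exp_eq_exp_ℝ, NormedSpace.exp_eq_tsum_div, ← tsum_mul_left]
  exact tsum_of_norm_bounded (summable_norm_bound ‖w‖ ‖u‖).hasSum (norm_term_le w u)

/-- The entire function represented by a sequence of coefficients. -/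
def toEntire (w : CoeffSpace) : EntireFun := EntireFun.ofDifferentiable (eval w) (differentiable_eval w)

theorem continuous_toEntire : Continuous toEntire := by
  rw [EntireFun.isInducing_val.continuous_iff]
  refine ContinuousMap.continuous_of_continuous_uncurry _ ?_
  change Continuous fun q : CoeffSpace × ℂ => eval q.1 q.2
  rw [continuous_iff_continuousAt]
  rintro ⟨w₀, u₀⟩
  have h1 : Tendsto (fun q : CoeffSpace × ℂ => ‖q.1 - w₀‖ * Real.exp (2 * ‖q.2‖)) (𝓝 (w₀, u₀))
      (𝓝 0) := by
    have : Continuous fun q : CoeffSpace × ℂ => ‖q.1 - w₀‖ * Real.exp (2 * ‖q.2‖) := by fun_prop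
    have h := this.tendsto (w₀, u₀)
    simpa using h
  have h2 : Tendsto (fun q : CoeffSpace × ℂ => eval (q.1 - w₀) q.2) (𝓝 (w₀, u₀)) (𝓝 0) :=
    squeeze_zero_norm (fun q => norm_eval_le _ _) h1
  have h3 : Tendsto (fun q : CoeffSpace × ℂ => eval w₀ q.2) (𝓝 (w₀, u₀)) (𝓝 (eval w₀ u₀)) :=
    ((differentiable_eval w₀).continuous.comp continuous_snd).tendsto (w₀, u₀)
  have h4 := h2.add h3
  rw [zero_add] at h4
  refine h4.congr fun q => ?_
  rw [← eval_add, sub_add_cancel]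

theorem memℓp_pow {t : ℝ} (ht : t ∈ Set.Icc (0 : ℝ) 1) :
    Memℓp (fun p : ℕ => ((t / 2 : ℝ) : ℂ) ^ p) 2 := by
  refine memℓp_gen ?_
  have h : Summable fun p : ℕ => (1 / 4 : ℝ) ^ p := summable_geometric_of_lt_one (by norm_num) (by norm_num)
  refine h.of_nonneg_of_le (fun p => by positivity) fun p => ?_
  rw [ENNReal.toReal_ofNat, Real.rpow_two, norm_pow, Complex.norm_real, Real.norm_eq_abs,
    ← pow_mul, mul_comm p 2, pow_mul]
  refine pow_le_pow_left₀ (by positivity) ?_ p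
  rw [sq_abs]
  nlinarith [ht.1, ht.2]

open Classical in
/-- For `t ∈ [0, 1]`, the element that represents `u ↦ exp (t u)` (and `0` for other `t`). -/
def expVec (t : ℝ) : CoeffSpace :=
  if ht : t ∈ Set.Icc (0 : ℝ) 1 then ⟨fun p : ℕ => ((t / 2 : ℝ) : ℂ) ^ p, memℓp_pow ht⟩ else 0

theorem expVec_apply {t : ℝ} (ht : t ∈ Set.Icc (0 : ℝ) 1) (p : ℕ) :
    expVec t p = ((t / 2 : ℝ) : ℂ) ^ p := by
  rw [expVec, dif_pos ht]

theorem eval_expVec {t : ℝ} (ht : t ∈ Set.Icc (0 : ℝ) 1) (u : ℂ) :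
    eval (expVec t) u = Complex.exp (t * u) := by
  rw [eval, Complex.exp_eq_exp_ℂ, NormedSpace.exp_eq_tsum_div]
  refine tsum_congr fun p => ?_
  rw [expVec_apply ht, ← mul_div_assoc, ← mul_pow]
  congr 2
  push_cast
  ring

theorem abs_pow_sub_pow_le {s t : ℝ} (hs : s ∈ Set.Icc (0 : ℝ) 1) (ht : t ∈ Set.Icc (0 : ℝ) 1)
    (p : ℕ) : |t ^ p - s ^ p| ≤ p * |t - s| := by
  induction p with
  | zero => simp
  | succ p ih =>
    have h : t ^ (p + 1) - s ^ (p + 1) = t * (t ^ p - s ^ p) + (t - s) * s ^ p := by ring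
    rw [h]
    refine (abs_add_le _ _).trans ?_
    rw [abs_mul, abs_mul, abs_of_nonneg ht.1, abs_of_nonneg (pow_nonneg hs.1 p)]
    have h1 : t * |t ^ p - s ^ p| ≤ 1 * (p * |t - s|) :=
      mul_le_mul ht.2 ih (abs_nonneg _) zero_le_one
    have h2 : |t - s| * s ^ p ≤ |t - s| * 1 :=
      mul_le_mul_of_nonneg_left (pow_le_one₀ hs.1 hs.2) (abs_nonneg _)
    push_cast
    linarith

/-- `t ↦ expVec t` is Lipschitz on `[0, 1]`. The factor `2` in the definition of `eval` makes the
coefficients of `exp (t u)` geometric with ratio `t / 2`, which leaves room for differentiation in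
`t`, even at `t = 1`. -/
theorem exists_norm_expVec_sub_le : ∃ C : ℝ, 0 < C ∧ ∀ s ∈ Set.Icc (0 : ℝ) 1,
    ∀ t ∈ Set.Icc (0 : ℝ) 1, ‖expVec t - expVec s‖ ≤ C * |t - s| := by
  have hsum : Summable fun p : ℕ => (p : ℝ) ^ 2 * (1 / 4 : ℝ) ^ p :=
    summable_pow_mul_geometric_of_norm_lt_one 2 (by norm_num)
  set K := ∑' p : ℕ, (p : ℝ) ^ 2 * (1 / 4 : ℝ) ^ p with hK
  have hK0 : 0 ≤ K := tsum_nonneg fun p => by positivity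
  refine ⟨Real.sqrt K + 1, by positivity, fun s hs t ht => ?_⟩
  refine le_trans (lp.norm_le_of_forall_sum_le (p := 2) (by norm_num)
    (C := Real.sqrt K * |t - s|) (by positivity) fun F => ?_) (by nlinarith [abs_nonneg (t - s)])
  rw [ENNReal.toReal_ofNat, Real.rpow_two, mul_pow, Real.sq_sqrt hK0]
  calc ∑ p ∈ F, ‖(expVec t - expVec s : CoeffSpace) p‖ ^ (2 : ℝ)
      ≤ ∑ p ∈ F, ((p : ℝ) ^ 2 * (1 / 4 : ℝ) ^ p) * |t - s| ^ 2 := by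
        refine Finset.sum_le_sum fun p _ => ?_
        rw [Real.rpow_two, lp.coeFn_sub, Pi.sub_apply, expVec_apply ht, expVec_apply hs,
          ← Complex.ofReal_pow, ← Complex.ofReal_pow, ← Complex.ofReal_sub, Complex.norm_real,
          Real.norm_eq_abs, div_pow, div_pow, ← sub_div, abs_div, abs_of_pos (show (0 : ℝ) < 2 ^ p by positivity)]
        have h1 : (1 / 4 : ℝ) ^ p = ((2 : ℝ) ^ p)⁻¹ ^ 2 := by
          rw [← inv_pow, ← pow_mul, mul_comm p 2, pow_mul]
          norm_num
        rw [h1, div_eq_mul_inv, mul_pow]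
        have h2 := pow_le_pow_left₀ (abs_nonneg _) (abs_pow_sub_pow_le hs ht p) 2
        have h3 : (0 : ℝ) ≤ ((2 : ℝ) ^ p)⁻¹ ^ 2 := by positivity
        calc |t ^ p - s ^ p| ^ 2 * ((2 : ℝ) ^ p)⁻¹ ^ 2
            ≤ (p * |t - s|) ^ 2 * ((2 : ℝ) ^ p)⁻¹ ^ 2 := mul_le_mul_of_nonneg_right h2 h3
          _ = _ := by ring
    _ = (∑ p ∈ F, (p : ℝ) ^ 2 * (1 / 4 : ℝ) ^ p) * |t - s| ^ 2 := by rw [Finset.sum_mul]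
    _ ≤ K * |t - s| ^ 2 := by
        gcongr
        exact hsum.sum_le_tsum F fun p _ => by positivity

theorem toEntire_add_eq_affineExp (p N : ℂ) :
    toEntire (p • expVec 0 + N • expVec 1) = affineExp p N := by
  refine Subtype.ext (ContinuousMap.ext fun u => ?_)
  change eval (p • expVec 0 + N • expVec 1) u = p + Complex.exp u * N
  rw [eval_add, eval_smul, eval_smul, eval_expVec (by simp), eval_expVec (by simp)]
  simp [mul_comm]

theorem natCast_div_mem_Icc {k n : ℕ} (h : k ≤ n) : (k / n : ℝ) ∈ Set.Icc (0 : ℝ) 1 :=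
  ⟨by positivity, div_le_one_of_le₀ (by exact_mod_cast h) (by positivity)⟩

theorem toEntire_sum_eq_windowPoly (b : ℝ → ℝ) (x : ℕ → ℂ) (a : ℝ) (n : ℕ) (ψ : ℝ) :
    toEntire (∑ k ∈ Finset.range (n + 1), x k • (((b k : ℂ) * Complex.exp (ψ * Complex.I) ^ k)
      • (Real.exp (a * k / (2 * n)) : ℂ) • expVec (k / n))) = windowPoly b x a n ψ := by
  refine Subtype.ext (ContinuousMap.ext fun u => ?_)
  change evalLinear u _ = weightedPoly b x n (windowPoint a n ψ u)
  rw [map_sum, weightedPoly]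
  refine Finset.sum_congr rfl fun k hk => ?_
  have hkn : k ≤ n := Nat.lt_succ_iff.mp (Finset.mem_range.mp hk)
  rw [map_smul, map_smul, map_smul]
  change x k * (_ * (_ * eval (expVec (k / n)) u)) = _
  rw [eval_expVec (natCast_div_mem_Icc hkn), windowPoint, ← Complex.exp_nat_mul,
    ← Complex.exp_nat_mul, Complex.ofReal_exp]
  have h : (k : ℂ) * ((a : ℂ) / (2 * (n : ℂ)) + u / (n : ℂ) + (ψ : ℂ) * Complex.I)
      = (k * (ψ * Complex.I)) + (((a * k / (2 * n) : ℝ) : ℂ) + (((k / n : ℝ) : ℂ) * u)) := by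
    push_cast
    ring
  rw [h, Complex.exp_add, Complex.exp_add]
  ring

end CoeffSpace

/-! ### Convergence in the space of entire functions -/

theorem integral_conj_mul_of_iIndepFun {Ω : Type*} [MeasurableSpace Ω] {μ : Measure Ω}
    {ξ : ℕ → Ω → ℂ} (hm : ∀ k, Measurable (ξ k)) (hind : iIndepFun ξ μ)
    (hid : ∀ k, IdentDistrib (ξ k) (ξ 0) μ μ) (h0 : ∫ ω, ξ 0 ω ∂μ = 0) (i j : ℕ) :
    ∫ ω, (starRingEnd ℂ) (ξ i ω) * ξ j ω ∂μ
      = if i = j then ((∫ ω, ‖ξ 0 ω‖ ^ 2 ∂μ : ℝ) : ℂ) else 0 := by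
  split_ifs with hij
  · subst hij
    rw [← integral_norm_sq_eq_of_identDistrib hid i, ← integral_complex_ofReal]
    refine integral_congr_ae (ae_of_all _ fun ω => ?_)
    simp only [mul_comm _ (ξ i ω), Complex.mul_conj, Complex.normSq_eq_norm_sq]
  · have h1 : IndepFun (fun ω => (starRingEnd ℂ) (ξ i ω)) (ξ j) μ :=
      (hind.indepFun hij).comp (φ := fun z => (starRingEnd ℂ) z) (ψ := id)
        Complex.continuous_conj.measurable measurable_id
    rw [h1.integral_fun_mul_eq_mul_integral
      (Complex.continuous_conj.measurable.comp (hm i)).aestronglyMeasurable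
      (hm j).aestronglyMeasurable, (hid j).integral_eq, h0, mul_zero]

theorem integral_norm_sum_smul_sq {Ω : Type*} [MeasurableSpace Ω] {μ : Measure Ω}
    {H : Type*} [NormedAddCommGroup H] [InnerProductSpace ℂ H]
    {ξ : ℕ → Ω → ℂ} (hm : ∀ k, Measurable (ξ k)) (hind : iIndepFun ξ μ)
    (hid : ∀ k, IdentDistrib (ξ k) (ξ 0) μ μ) (h0 : ∫ ω, ξ 0 ω ∂μ = 0) (h2 : MemLp (ξ 0) 2 μ)
    (w : ℕ → H) (s : Finset ℕ) :
    ∫ ω, ‖∑ k ∈ s, ξ k ω • w k‖ ^ 2 ∂μ = (∫ ω, ‖ξ 0 ω‖ ^ 2 ∂μ) * ∑ k ∈ s, ‖w k‖ ^ 2 := by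
  have hint : ∀ i j, Integrable
      (fun ω => (starRingEnd ℂ) (ξ i ω) * ξ j ω * inner ℂ (w i) (w j)) μ := by
    intro i j
    have h3 : MemLp (ξ i) 2 μ := (hid i).memLp_iff.mpr h2
    have h4 : MemLp (ξ j) 2 μ := (hid j).memLp_iff.mpr h2
    have h5 : MemLp (fun ω => (starRingEnd ℂ) (ξ i ω)) 2 μ := h3.star
    exact (h5.integrable_mul h4).mul_const _
  have hexp : ∀ ω, ((‖∑ k ∈ s, ξ k ω • w k‖ ^ 2 : ℝ) : ℂ)
      = ∑ i ∈ s, ∑ j ∈ s, (starRingEnd ℂ) (ξ i ω) * ξ j ω * inner ℂ (w i) (w j) := by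
    intro ω
    rw [Complex.ofReal_pow]
    have h3 := inner_self_eq_norm_sq_to_K (𝕜 := ℂ) (∑ k ∈ s, ξ k ω • w k)
    simp only [Complex.coe_algebraMap] at h3
    rw [← h3, sum_inner]
    refine Finset.sum_congr rfl fun i _ => ?_
    rw [inner_sum]
    refine Finset.sum_congr rfl fun j _ => ?_
    rw [inner_smul_left, inner_smul_right, mul_assoc]
  have h : ((∫ ω, ‖∑ k ∈ s, ξ k ω • w k‖ ^ 2 ∂μ : ℝ) : ℂ)
      = (((∫ ω, ‖ξ 0 ω‖ ^ 2 ∂μ) * ∑ k ∈ s, ‖w k‖ ^ 2 : ℝ) : ℂ) := by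
    rw [← integral_complex_ofReal]
    have h3 : ∫ ω, ((‖∑ k ∈ s, ξ k ω • w k‖ ^ 2 : ℝ) : ℂ) ∂μ
        = ∑ i ∈ s, ∑ j ∈ s, (∫ ω, (starRingEnd ℂ) (ξ i ω) * ξ j ω ∂μ) * inner ℂ (w i) (w j) := by
      simp_rw [hexp]
      rw [integral_finsetSum _ fun i _ => integrable_finsetSum _ fun j _ => hint i j]
      refine Finset.sum_congr rfl fun i _ => ?_
      rw [integral_finsetSum _ fun j _ => hint i j]
      exact Finset.sum_congr rfl fun j _ => integral_mul_const _ _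
    refine h3.trans ?_
    simp_rw [integral_conj_mul_of_iIndepFun hm hind hid h0]
    push_cast
    rw [Finset.mul_sum]
    refine Finset.sum_congr rfl fun i hi => ?_
    rw [Finset.sum_eq_single_of_mem i hi fun j _ hij => by rw [if_neg hij.symm, zero_mul],
      if_pos rfl]
    have h4 := inner_self_eq_norm_sq_to_K (𝕜 := ℂ) (w i)
    simp only [Complex.coe_algebraMap] at h4
    rw [h4]
  exact_mod_cast h

section

variable {Ω : Type*} [MeasurableSpace Ω] {μ : Measure Ω} [IsProbabilityMeasure μ]

/-- Convergence in distribution of independent pairs follows from that of the components. -/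
theorem tendstoInDistribution_prodMk_of_indepFun {ι E F Ω₁ Ω₂ : Type*} {l : Filter ι}
    [MeasurableSpace Ω₁] [MeasurableSpace Ω₂] {μ₁ : Measure Ω₁} [IsProbabilityMeasure μ₁]
    {μ₂ : Measure Ω₂} [IsProbabilityMeasure μ₂]
    [TopologicalSpace E] [SecondCountableTopology E] [TopologicalSpace.PseudoMetrizableSpace E]
    [MeasurableSpace E] [BorelSpace E]
    [TopologicalSpace F] [SecondCountableTopology F] [TopologicalSpace.PseudoMetrizableSpace F]
    [MeasurableSpace F] [BorelSpace F]
    {X : ι → Ω → E} {Y : ι → Ω → F} {A : Ω₁ → E} {B : Ω₂ → F}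
    (hX : TendstoInDistribution X l A (fun _ => μ) μ₁)
    (hY : TendstoInDistribution Y l B (fun _ => μ) μ₂)
    (hA : Measurable A) (hB : Measurable B) (h : ∀ n, IndepFun (X n) (Y n) μ) :
    TendstoInDistribution (fun n ω => (X n ω, Y n ω)) l (fun p : Ω₁ × Ω₂ => (A p.1, B p.2))
      (fun _ => μ) (μ₁.prod μ₂) := by
  have hAB : AEMeasurable (fun p : Ω₁ × Ω₂ => (A p.1, B p.2)) (μ₁.prod μ₂) := by fun_prop
  refine ⟨fun n => (hX.forall_aemeasurable n).prodMk (hY.forall_aemeasurable n), hAB, ?_⟩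
  have hlim : (⟨(μ₁.prod μ₂).map (fun p : Ω₁ × Ω₂ => (A p.1, B p.2)),
      Measure.isProbabilityMeasure_map hAB⟩ : ProbabilityMeasure (E × F))
      = ProbabilityMeasure.prod
        ⟨μ₁.map A, Measure.isProbabilityMeasure_map hX.aemeasurable_limit⟩
        ⟨μ₂.map B, Measure.isProbabilityMeasure_map hY.aemeasurable_limit⟩ :=
    Subtype.ext (Measure.map_prod_map μ₁ μ₂ hA hB).symm
  rw [hlim]
  refine ((ProbabilityMeasure.continuous_prod.tendsto _).comp
    (hX.tendsto.prodMk_nhds hY.tendsto)).congr fun n => ?_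
  refine Subtype.ext ?_
  exact ((h n).map_prod_eq_prod_map_map (hX.forall_aemeasurable n) (hY.forall_aemeasurable n)).symm

/-- The coefficient of `x k` in the difference of `P_n (exp (a / (2 n) + u / n + i ψ))` and
`P_{n/2} (exp (i ψ)) + e^u * highPart b x a n ψ`, as a function of `u`. -/
def remainderVec (b : ℝ → ℝ) (a : ℝ) (n : ℕ) (ψ : ℝ) (k : ℕ) : CoeffSpace :=
  ((b k : ℂ) * Complex.exp (ψ * Complex.I) ^ k) •
    if k ≤ n / 2 then
      (Real.exp (a * k / (2 * n)) : ℂ) • CoeffSpace.expVec (k / n) - CoeffSpace.expVec 0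
    else (Real.exp (a * k / (2 * n)) : ℂ) • (CoeffSpace.expVec (k / n) - CoeffSpace.expVec 1)

theorem sum_range_eq_sum_low_add_sum_high {M : Type*} [AddCommMonoid M] (f : ℕ → M) (n : ℕ) :
    ∑ k ∈ Finset.range (n + 1), f k
      = ∑ k ∈ Finset.range (n / 2 + 1), f k + ∑ k ∈ Finset.Ioc (n / 2) n, f k := by
  have h : Finset.Ioc (n / 2) n = Finset.Ico (n / 2 + 1) (n + 1) := by
    ext k
    simp only [Finset.mem_Ioc, Finset.mem_Ico]
    omega
  rw [h, Finset.sum_range_add_sum_Ico f (by omega)]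

theorem sum_smul_expVec_eq (b : ℝ → ℝ) (x : ℕ → ℂ) (a : ℝ) (n : ℕ) (ψ : ℝ) :
    ∑ k ∈ Finset.range (n + 1), x k • (((b k : ℂ) * Complex.exp (ψ * Complex.I) ^ k)
      • (Real.exp (a * k / (2 * n)) : ℂ) • CoeffSpace.expVec (k / n))
    = (weightedPoly b x (n / 2) (Complex.exp (ψ * Complex.I)) • CoeffSpace.expVec 0
        + highPart b x a n ψ • CoeffSpace.expVec 1)
      + ∑ k ∈ Finset.range (n + 1), x k • remainderVec b a n ψ k := by
  rw [sum_range_eq_sum_low_add_sum_high,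
    sum_range_eq_sum_low_add_sum_high (fun k => x k • remainderVec b a n ψ k),
    weightedPoly, highPart, Finset.sum_smul, Finset.sum_smul, add_add_add_comm,
    ← Finset.sum_add_distrib, ← Finset.sum_add_distrib]
  congr 1
  · refine Finset.sum_congr rfl fun k hk => ?_
    rw [remainderVec, if_pos (Nat.lt_succ_iff.mp (Finset.mem_range.mp hk))]
    module
  · refine Finset.sum_congr rfl fun k hk => ?_
    rw [remainderVec, if_neg (not_le.mpr (Finset.mem_Ioc.mp hk).1)]
    push_cast
    module

/-- Up to the factor `E|ξ 0|²`, the second moment of the remainder. In the lower half each term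
converges to `0` and is dominated by `b k ^ 2 * exp (a n * k / n)`; in the upper half the Lipschitz
bound for `expVec` supplies the factor `(1 - k / n) ^ 2`. -/
theorem tendsto_sum_norm_remainderVec_sq {b : ℝ → ℝ} {α : ℝ} (hb : IsRegularlyVarying b α)
    (hs : Summable fun k : ℕ => b k ^ 2) {a : ℕ → ℝ} (ha : IsCentering b a) (ψ : ℝ) :
    Tendsto (fun n : ℕ => ∑ k ∈ Finset.range (n + 1), ‖remainderVec b (a n) n ψ k‖ ^ 2) atTop
      (𝓝 0) := by
  obtain ⟨C, hC, hlip⟩ := CoeffSpace.exists_norm_expVec_sub_le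
  set M : ℝ := ‖CoeffSpace.expVec 0‖ + C with hM
  have hM0 : 0 < M := by positivity
  have hbd : ∀ t ∈ Set.Icc (0 : ℝ) 1, ‖CoeffSpace.expVec t‖ ≤ M := by
    intro t ht
    have h1 := hlip 0 (by simp) t ht
    rw [sub_zero, abs_of_nonneg ht.1] at h1
    have h2 : C * t ≤ C := mul_le_of_le_one_right hC.le ht.2
    calc ‖CoeffSpace.expVec t‖ = ‖CoeffSpace.expVec 0 + (CoeffSpace.expVec t - CoeffSpace.expVec 0)‖ := by
          rw [add_sub_cancel]
      _ ≤ M := (norm_add_le _ _).trans (by rw [hM]; linarith)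
  -- `θ` is normalised by `4 M²` so that it is at most `exp (a n * k / n)`
  set v : ℕ → ℕ → CoeffSpace := fun n k =>
    (Real.exp (a n * k / (2 * n)) : ℂ) • CoeffSpace.expVec (k / n) - CoeffSpace.expVec 0 with hv
  set θ : ℕ → ℕ → ℝ := fun n k => ‖v n k‖ ^ 2 / (4 * M ^ 2) with hθ
  have hlow : Tendsto (fun n : ℕ => ∑ k ∈ Finset.range (n / 2 + 1), b k ^ 2 * θ n k) atTop (𝓝 0) := by
    refine ha.tendsto_sum_low hb hs (fun n k => by positivity) ?_ ?_
    · filter_upwards [ha.tendsto_atTop.eventually_ge_atTop 0] with n hn k hk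
      have hE : 1 ≤ Real.exp (a n * k / (2 * n)) := Real.one_le_exp (by positivity)
      have h1 : ‖v n k‖ ≤ 2 * M * Real.exp (a n * k / (2 * n)) := by
        refine (norm_sub_le _ _).trans ?_
        rw [norm_smul, Complex.norm_real, Real.norm_eq_abs, abs_of_pos (Real.exp_pos _)]
        have h2 := hbd _ (CoeffSpace.natCast_div_mem_Icc (hk.trans (Nat.div_le_self n 2)))
        have h3 := hbd 0 (by simp)
        nlinarith [mul_le_mul_of_nonneg_left h2 (zero_le_one.trans hE),
          mul_le_mul_of_nonneg_left hE hM0.le]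
      rw [hθ]
      simp only
      rw [div_le_iff₀ (by positivity), ← sq_exp_half]
      calc ‖v n k‖ ^ 2 ≤ (2 * M * Real.exp (a n * k / (2 * n))) ^ 2 :=
            pow_le_pow_left₀ (norm_nonneg _) h1 2
        _ = _ := by ring
    · intro k
      have h1 : Tendsto (fun n : ℕ => (k / n : ℝ)) atTop (𝓝 0) :=
        tendsto_const_div_atTop_nhds_zero_nat (k : ℝ)
      have h2 : Tendsto (fun n : ℕ => Real.exp (a n * k / (2 * n))) atTop (𝓝 1) := by
        have h3 := (ha.tendsto_div.mul_const (k / 2 : ℝ))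
        rw [zero_mul] at h3
        have h4 := (Real.continuous_exp.tendsto 0).comp h3
        rw [Real.exp_zero] at h4
        refine h4.congr fun n => ?_
        simp only [Function.comp_apply]
        congr 1
        rw [div_mul_div_comm, mul_comm (n : ℝ) 2]
      have h3 : Tendsto (fun n : ℕ => CoeffSpace.expVec (k / n)) atTop (𝓝 (CoeffSpace.expVec 0)) := by
        rw [tendsto_iff_norm_sub_tendsto_zero]
        have h4 := h1.const_mul C
        rw [mul_zero] at h4
        refine squeeze_zero' (Eventually.of_forall fun n => norm_nonneg _) ?_ h4
        filter_upwards [eventually_ge_atTop k] with n hn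
        have h5 := CoeffSpace.natCast_div_mem_Icc hn
        have h6 := hlip 0 (by simp) _ h5
        rwa [sub_zero, abs_of_nonneg h5.1] at h6
      have h4 : Tendsto (fun n => v n k) atTop (𝓝 0) := by
        have h5 := (((Complex.continuous_ofReal.tendsto 1).comp h2).smul h3).sub_const
          (CoeffSpace.expVec 0)
        rw [Complex.ofReal_one, one_smul, sub_self] at h5
        exact h5
      have h5 := (h4.norm.pow 2).div_const (4 * M ^ 2)
      simpa using h5
  have hup := (hlow.const_mul (4 * M ^ 2)).add ((ha.tendsto_sum_high_sq hb).const_mul (C ^ 2))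
  rw [mul_zero, mul_zero, add_zero] at hup
  refine squeeze_zero (fun n => Finset.sum_nonneg fun k _ => by positivity) (fun n => ?_) hup
  rw [sum_range_eq_sum_low_add_sum_high, Finset.mul_sum, Finset.mul_sum]
  refine add_le_add (le_of_eq ?_) ?_
  · refine Finset.sum_congr rfl fun k hk => ?_
    rw [remainderVec, if_pos (Nat.lt_succ_iff.mp (Finset.mem_range.mp hk)), norm_smul,
      norm_mul_exp_mul_I_pow, mul_pow, sq_abs]
    simp only [hθ, hv]
    field_simp
  · refine Finset.sum_le_sum fun k hk => ?_
    have hk' := Finset.mem_Ioc.mp hk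
    rw [remainderVec, if_neg (not_le.mpr hk'.1), norm_smul, norm_smul,
      norm_mul_exp_mul_I_pow, mul_pow, mul_pow, sq_abs, Complex.norm_real, Real.norm_eq_abs, sq_abs,
      sq_exp_half]
    have h1 := CoeffSpace.natCast_div_mem_Icc hk'.2
    have h2 := hlip 1 (by simp) _ h1
    rw [abs_sub_comm, abs_of_nonneg (by linarith [h1.2])] at h2
    have h3 := pow_le_pow_left₀ (norm_nonneg _) h2 2
    calc b k ^ 2 * (Real.exp (a n * k / n) * ‖CoeffSpace.expVec (k / n) - CoeffSpace.expVec 1‖ ^ 2)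
        ≤ b k ^ 2 * (Real.exp (a n * k / n) * (C * (1 - k / n)) ^ 2) := by gcongr
      _ = _ := by ring

end

theorem indepFun_weightedPoly_highPart {Ω : Type*} [MeasurableSpace Ω] {μ : Measure Ω} {m : ℕ}
    {ξ : ℕ → Ω → ℂ} (hm : ∀ k, Measurable (ξ k))
    (hind : iIndepFun ξ μ) (b : ℝ → ℝ) (a : ℝ) (n : ℕ) (ψ : Fin m → ℝ) :
    IndepFun (fun ω (j : Fin m) => weightedPoly b (fun k => ξ k ω) (n / 2)
        (Complex.exp (ψ j * Complex.I)))
      (fun ω (j : Fin m) => highPart b (fun k => ξ k ω) a n (ψ j)) μ := by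
  have hdisj : Disjoint (Finset.range (n / 2 + 1)) (Finset.Ioc (n / 2) n) := by
    rw [Finset.disjoint_left]
    intro k hk hk'
    rw [Finset.mem_range] at hk
    rw [Finset.mem_Ioc] at hk'
    omega
  have h := (hind.indepFun_finset _ _ hdisj hm).comp
    (φ := fun y (j : Fin m) => ∑ k : Finset.range (n / 2 + 1),
      (b (k : ℕ) : ℂ) * y k * Complex.exp (ψ j * Complex.I) ^ (k : ℕ))
    (ψ := fun y (j : Fin m) => ∑ k : Finset.Ioc (n / 2) n,
      ((b (k : ℕ) * Real.exp (a * (k : ℕ) / (2 * n)) : ℝ) : ℂ) * y k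
        * Complex.exp (ψ j * Complex.I) ^ (k : ℕ))
    (by fun_prop) (by fun_prop)
  convert h using 1
  · funext ω j
    exact (Finset.sum_coe_sort (Finset.range (n / 2 + 1)) fun k =>
      (b k : ℂ) * ξ k ω * Complex.exp (ψ j * Complex.I) ^ k).symm
  · funext ω j
    exact (Finset.sum_coe_sort (Finset.Ioc (n / 2) n) fun k =>
      ((b k * Real.exp (a * k / (2 * n)) : ℝ) : ℂ) * ξ k ω
        * Complex.exp (ψ j * Complex.I) ^ k).symm

section

variable {Ω : Type*} [MeasurableSpace Ω] {μ : Measure Ω} [IsProbabilityMeasure μ] {m : ℕ}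

theorem tendstoInMeasure_of_tendsto_integral_norm_sq {E : Type*} [SeminormedAddCommGroup E]
    {R : ℕ → Ω → Fin m → E} (hint : ∀ n j, Integrable (fun ω => ‖R n ω j‖ ^ 2) μ)
    (h : ∀ j, Tendsto (fun n => ∫ ω, ‖R n ω j‖ ^ 2 ∂μ) atTop (𝓝 0)) :
    TendstoInMeasure μ R atTop 0 := by
  rw [tendstoInMeasure_iff_measureReal_norm]
  intro ε hε
  have hsum : Tendsto (fun n => (∑ j, ∫ ω, ‖R n ω j‖ ^ 2 ∂μ) / ε ^ 2) atTop (𝓝 0) := by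
    have := (tendsto_finsetSum Finset.univ fun j _ => h j).div_const (ε ^ 2)
    simpa using this
  refine squeeze_zero (fun n => measureReal_nonneg) (fun n => ?_) hsum
  rw [le_div_iff₀ (by positivity), mul_comm, ← integral_finsetSum _ fun j _ => hint n j]
  refine le_trans ?_ (mul_meas_ge_le_integral_of_nonneg (ae_of_all _ fun ω =>
    Finset.sum_nonneg fun j _ => by positivity) (integrable_finsetSum _ fun j _ => hint n j) (ε ^ 2))
  refine mul_le_mul_of_nonneg_left (measureReal_mono ?_ (measure_ne_top _ _)) (by positivity)
  intro ω hω
  simp only [Pi.zero_apply, sub_zero, Set.mem_ofPred_eq] at hω ⊢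
  by_contra! hlt
  refine absurd hω (not_le.mpr ?_)
  rw [pi_norm_lt_iff hε]
  intro j
  have h1 : ‖R n ω j‖ ^ 2 < ε ^ 2 :=
    (Finset.single_le_sum (f := fun j => ‖R n ω j‖ ^ 2) (fun j _ => by positivity)
      (Finset.mem_univ j)).trans_lt hlt
  exact lt_of_pow_lt_pow_left₀ 2 hε.le h1

/-- Joint convergence in distribution of the rescaled polynomials, as random entire functions. -/
theorem tendstoInDistribution_windowPoly {ξ : ℕ → Ω → ℂ} (hm : ∀ k, Measurable (ξ k)) (hind : iIndepFun ξ μ)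
    (hid : ∀ k, IdentDistrib (ξ k) (ξ 0) μ μ) (h0 : ∫ ω, ξ 0 ω ∂μ = 0) (h2 : MemLp (ξ 0) 2 μ)
    {σ₁ σ₂ : ℝ} (hσ₁ : σ₁ ^ 2 = ∫ ω, (ξ 0 ω).re ^ 2 ∂μ) (hσ₂ : σ₂ ^ 2 = ∫ ω, (ξ 0 ω).im ^ 2 ∂μ)
    (hcov : cov[fun ω => (ξ 0 ω).re, fun ω => (ξ 0 ω).im; μ] = 0)
    {b : ℝ → ℝ} {α : ℝ} (hb : IsRegularlyVarying b α) (hs : Summable fun k : ℕ => b k ^ 2)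
    {a : ℕ → ℝ} (ha : IsCentering b a)
    {ψ : Fin m → ℝ} (hψ_mono : StrictMono ψ) (hψ : ∀ j, ψ j ∈ Set.Ico 0 (2 * Real.pi)) :
    TendstoInDistribution (E := Fin m → EntireFun)
      (fun n ω j => windowPoly b (fun k => ξ k ω) (a n) n (ψ j)) atTop
      (fun p : Ω × (Fin m → ℂ) => fun j =>
        affineExp (weightedSeries b (fun k => ξ k p.1) (Complex.exp (ψ j * Complex.I))) (p.2 j))
      (fun _ => μ) (μ.prod (limitGaussian ψ σ₁ σ₂)) := by
  have hA : TendstoInDistribution (fun (n : ℕ) ω (j : Fin m) => weightedPoly b (fun k => ξ k ω) (n / 2)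
      (Complex.exp (ψ j * Complex.I))) atTop
      (fun ω j => weightedSeries b (fun k => ξ k ω) (Complex.exp (ψ j * Complex.I)))
      (fun _ => μ) μ := by
    refine tendstoInDistribution_of_ae_tendsto
      (fun n => (measurable_pi_lambda _ fun j => measurable_weightedPoly hm b _ _).aemeasurable)
      (measurable_pi_lambda _ fun j => measurable_weightedSeries hm b _).aemeasurable ?_
    have h := fun j => ae_tendsto_weightedPoly hm hind hid h0 h2 hs (ψ j)
    filter_upwards [ae_all_iff.mpr h] with ω hω
    exact tendsto_pi_nhds.mpr fun j => (hω j).comp (Nat.tendsto_div_const_atTop two_ne_zero)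
  have hAB := tendstoInDistribution_prodMk_of_indepFun hA
    (tendstoInDistribution_highPart hm hind hid h0 h2 hσ₁ hσ₂ hcov hb ha hψ_mono hψ)
    (measurable_pi_lambda _ fun j => measurable_weightedSeries hm b _) measurable_id
    (fun n => indepFun_weightedPoly_highPart hm hind b (a n) n ψ)
  have hX := hAB.continuous_comp (F := Fin m → CoeffSpace)
    (g := fun q : (Fin m → ℂ) × (Fin m → ℂ) => fun j =>
      q.1 j • CoeffSpace.expVec 0 + q.2 j • CoeffSpace.expVec 1) (by fun_prop)
  set Y : ℕ → Ω → Fin m → CoeffSpace := fun n ω j => ∑ k ∈ Finset.range (n + 1),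
    ξ k ω • (((b k : ℂ) * Complex.exp (ψ j * Complex.I) ^ k)
      • (Real.exp (a n * k / (2 * n)) : ℂ) • CoeffSpace.expVec (k / n)) with hY
  have hYm : ∀ n, Measurable (Y n) := fun n => measurable_pi_lambda _ fun j => by
    refine Finset.measurable_fun_sum _ fun k _ => ?_
    exact (hm k).smul_const _
  have hR : ∀ n ω j, Y n ω j - (weightedPoly b (fun k => ξ k ω) (n / 2)
      (Complex.exp (ψ j * Complex.I)) • CoeffSpace.expVec 0
        + highPart b (fun k => ξ k ω) (a n) n (ψ j) • CoeffSpace.expVec 1)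
      = ∑ k ∈ Finset.range (n + 1), ξ k ω • remainderVec b (a n) n (ψ j) k := by
    intro n ω j
    rw [sub_eq_iff_eq_add']
    exact sum_smul_expVec_eq b (fun k => ξ k ω) (a n) n (ψ j)
  -- Slutsky: the remainder tends to `0` in `L²`
  have hYlim := tendstoInDistribution_of_tendstoInMeasure_sub Y _ hX (by
    refine tendstoInMeasure_of_tendsto_integral_norm_sq (fun n j => ?_) fun j => ?_
    · have h3 : MemLp (fun ω => ∑ k ∈ Finset.range (n + 1),
          ξ k ω • remainderVec b (a n) n (ψ j) k) 2 μ := by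
        refine memLp_finsetSum _ fun k _ => ?_
        have h4 : MemLp (ξ k) 2 μ := (hid k).memLp_iff.mpr h2
        exact (ContinuousLinearMap.toSpanSingleton ℂ (remainderVec b (a n) n (ψ j) k)).comp_memLp' h4
      refine (h3.integrable_norm_pow two_ne_zero).congr (ae_of_all _ fun ω => ?_)
      simp only [Pi.sub_apply]
      rw [← hR n ω j]
      rfl
    · have h3 := (tendsto_sum_norm_remainderVec_sq hb hs ha (ψ j)).const_mul (∫ ω, ‖ξ 0 ω‖ ^ 2 ∂μ)
      rw [mul_zero] at h3
      refine h3.congr fun n => ?_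
      rw [← integral_norm_sum_smul_sq hm hind hid h0 h2]
      refine integral_congr_ae (ae_of_all _ fun ω => ?_)
      simp only [Pi.sub_apply]
      rw [← hR n ω j]
      rfl) fun n => (hYm n).aemeasurable
  have hfin := hYlim.continuous_comp (F := Fin m → EntireFun)
    (g := fun w : Fin m → CoeffSpace => fun j => CoeffSpace.toEntire (w j))
    (continuous_pi fun j => CoeffSpace.continuous_toEntire.comp (continuous_apply j))
  have e1 : (fun n => (fun w : Fin m → CoeffSpace => fun j => CoeffSpace.toEntire (w j)) ∘ Y n)
      = fun n ω j => windowPoly b (fun k => ξ k ω) (a n) n (ψ j) := by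
    funext n ω j
    exact CoeffSpace.toEntire_sum_eq_windowPoly b (fun k => ξ k ω) (a n) n (ψ j)
  rw [e1] at hfin
  convert hfin using 1
  funext p j
  exact (CoeffSpace.toEntire_add_eq_affineExp _ _).symm

end

/-! ### Counting zeros in a disc -/

namespace EntireFun

theorem ext_toFun {f g : EntireFun} (h : f.toFun = g.toFun) : f = g :=
  Subtype.ext (ContinuousMap.ext fun z => congrFun h z)

theorem analyticAt (f : EntireFun) (z : ℂ) : AnalyticAt ℂ f.toFun z := f.differentiable.analyticAt z

theorem analyticOrderAt_ne_top {f : EntireFun} (hf : f.toFun ≠ 0) (z : ℂ) :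
    analyticOrderAt f.toFun z ≠ ⊤ := by
  rwa [Ne, AnalyticOnNhd.analyticOrderAt_eq_top_iff_eq_zero z f.analyticAt]

theorem exists_eq_sub_mul (f : EntireFun) {z₀ : ℂ} (hz : f.toFun z₀ = 0) :
    ∃ h : EntireFun, f.toFun = (fun z => z - z₀) * h.toFun := by
  refine ⟨ofDifferentiable (dslope f.toFun z₀) ?_, ?_⟩
  · rw [← differentiableOn_univ, Complex.differentiableOn_dslope univ_mem]
    exact f.differentiable.differentiableOn
  · funext z
    have := sub_smul_dslope f.toFun z₀ z
    rw [hz, sub_zero] at this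
    exact this.symm

theorem tendstoLocallyUniformly (f : EntireFun) :
    TendstoLocallyUniformly (fun g : EntireFun => g.toFun) f.toFun (𝓝 f) :=
  ContinuousMap.tendsto_iff_tendstoLocallyUniformly.mp (isInducing_val.continuous.tendsto f)

theorem eventually_forall_ne_zero {f : EntireFun} {K : Set ℂ} (hK : IsCompact K)
    (h : ∀ z ∈ K, f.toFun z ≠ 0) : ∀ᶠ g in 𝓝 f, ∀ z ∈ K, g.toFun z ≠ 0 := by
  have ho : IsOpen {g : C(ℂ, ℂ) | Set.MapsTo g K {0}ᶜ} :=
    ContinuousMap.isOpen_setOfPred_mapsTo hK isOpen_compl_singleton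
  exact (ho.preimage isInducing_val.continuous).mem_nhds (fun z hz => h z hz)

end EntireFun

theorem zeroMeasure_apply_eq_zero {f : EntireFun} {B : Set ℂ} (hB : MeasurableSet B)
    (h : ∀ z ∈ B, f.toFun z ≠ 0) : zeroMeasure f B = 0 := by
  rw [zeroMeasure, Measure.sum_apply _ hB, ENNReal.tsum_eq_zero]
  intro z
  by_cases hz : z ∈ B
  · have : analyticOrderNatAt f.toFun z = 0 := by
      by_contra hne
      exact h z hz (apply_eq_zero_of_analyticOrderNatAt_ne_zero hne)
    simp [this]
  · simp [Measure.dirac_apply' _ hB, hz]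

theorem zeroMeasure_eq_add_dirac {f h : EntireFun} (hf : f.toFun ≠ 0) {z₀ : ℂ}
    (hfh : f.toFun = (fun z => z - z₀) * h.toFun) :
    zeroMeasure f = zeroMeasure h + Measure.dirac z₀ := by
  have hh : h.toFun ≠ 0 := by
    intro h0
    exact hf (by rw [hfh, h0, mul_zero])
  have hd : Measure.dirac z₀ = Measure.sum fun z : ℂ => (if z = z₀ then (1 : ℝ≥0∞) else 0) • Measure.dirac z := by
    ext s hs
    rw [Measure.sum_apply _ hs, tsum_eq_single z₀ (fun z hz => by simp [hz])]
    simp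
  rw [hd, zeroMeasure, zeroMeasure, Measure.sum_add_sum]
  congr 1
  funext z
  rw [← add_smul]
  congr 1
  have h1 : AnalyticAt ℂ (fun z : ℂ => z - z₀) z := by fun_prop
  have h2 : analyticOrderAt (fun z : ℂ => z - z₀) z = if z = z₀ then 1 else 0 := by
    split_ifs with hz
    · rw [hz, analyticOrderAt_id_sub_const_self]
    · rw [analyticOrderAt_id_sub_const_of_ne hz]
  rw [hfh, analyticOrderNatAt_mul h1 (h.analyticAt z) (by rw [h2]; split_ifs <;> simp)
    (EntireFun.analyticOrderAt_ne_top hh z), add_comm, Nat.cast_add]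
  congr 1
  rw [analyticOrderNatAt, h2]
  split_ifs <;> simp

/-- The argument principle on a disc, by induction on the number of zeros. -/
theorem circleIntegral_logDeriv_eq {c : ℂ} {r : ℝ} (hr : 0 < r) (n : ℕ) :
    ∀ f : EntireFun, (∀ z ∈ Metric.sphere c r, f.toFun z ≠ 0) → zeroMeasure f (Metric.ball c r) = n →
      (∮ z in C(c, r), deriv f.toFun z / f.toFun z) = 2 * Real.pi * Complex.I * n := by
  have hne : ∀ f : EntireFun, (∀ z ∈ Metric.sphere c r, f.toFun z ≠ 0) → f.toFun ≠ 0 := by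
    intro f hf h0
    obtain ⟨z, hz⟩ := NormedSpace.sphere_nonempty (x := c).mpr hr.le
    exact hf z hz (by rw [h0]; rfl)
  have hdd : ∀ f : EntireFun, Differentiable ℂ (deriv f.toFun) := fun f => by
    rw [← differentiableOn_univ]
    exact f.differentiable.differentiableOn.deriv isOpen_univ
  induction n with
  | zero =>
    intro f hf h0
    have hball : ∀ z ∈ Metric.closedBall c r, f.toFun z ≠ 0 := by
      intro z hz h1
      rw [← Metric.ball_union_sphere] at hz
      rcases hz with hz | hz
      · obtain ⟨h, hh⟩ := f.exists_eq_sub_mul h1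
        rw [zeroMeasure_eq_add_dirac (hne f hf) hh, Measure.add_apply, Nat.cast_zero, add_eq_zero,
          Measure.dirac_apply_of_mem hz] at h0
        exact one_ne_zero h0.2
      · exact hf z hz h1
    rw [Nat.cast_zero, mul_zero]
    refine Complex.circleIntegral_eq_zero_of_differentiable_on_off_countable hr.le
      Set.countable_empty ((hdd f).continuous.continuousOn.div
        f.differentiable.continuous.continuousOn hball) fun z hz => ?_
    exact (hdd f z).div (f.differentiable z) (hball z (Metric.ball_subset_closedBall hz.1))
  | succ n ih =>
    intro f hf hn
    obtain ⟨z₀, hz₀, h1⟩ : ∃ z₀ ∈ Metric.ball c r, f.toFun z₀ = 0 := by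
      by_contra! hcon
      rw [zeroMeasure_apply_eq_zero measurableSet_ball hcon] at hn
      exact absurd hn.symm (by simp)
    obtain ⟨h, hh⟩ := f.exists_eq_sub_mul h1
    have hh0 : ∀ z ∈ Metric.sphere c r, h.toFun z ≠ 0 := by
      intro z hz h2
      refine hf z hz ?_
      rw [hh, Pi.mul_apply, h2, mul_zero]
    have hz₀s : ∀ z ∈ Metric.sphere c r, z - z₀ ≠ 0 := by
      intro z hz h2
      refine hf z hz ?_
      rw [hh, Pi.mul_apply, h2, zero_mul]
    have hn' : zeroMeasure h (Metric.ball c r) = n := by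
      rw [zeroMeasure_eq_add_dirac (hne f hf) hh, Measure.add_apply,
        Measure.dirac_apply_of_mem hz₀, Nat.cast_add, Nat.cast_one] at hn
      exact (ENNReal.add_left_inj ENNReal.one_ne_top).mp hn
    have hcongr : (∮ z in C(c, r), deriv f.toFun z / f.toFun z)
        = ∮ z in C(c, r), ((z - z₀)⁻¹ + deriv h.toFun z / h.toFun z) := by
      refine circleIntegral.integral_congr hr.le fun z hz => ?_
      have hd : deriv f.toFun z = h.toFun z + (z - z₀) * deriv h.toFun z := by
        have h3 : HasDerivAt (fun z => (z - z₀) * h.toFun z)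
            (1 * h.toFun z + (z - z₀) * deriv h.toFun z) z :=
          ((hasDerivAt_id z).sub_const z₀).mul (h.differentiable z).hasDerivAt
        rw [one_mul] at h3
        rw [hh]
        exact h3.deriv
      have h4 := hz₀s z hz
      have h5 := hh0 z hz
      rw [hd, hh, Pi.mul_apply]
      field_simp
    have hi1 : CircleIntegrable (fun z => (z - z₀)⁻¹) c r := by
      refine ContinuousOn.circleIntegrable hr.le ?_
      exact (continuousOn_id.sub continuousOn_const).inv₀ hz₀s
    have hi2 : CircleIntegrable (fun z => deriv h.toFun z / h.toFun z) c r := by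
      refine ContinuousOn.circleIntegrable hr.le ?_
      exact (hdd h).continuous.continuousOn.div h.differentiable.continuous.continuousOn hh0
    rw [hcongr, circleIntegral.integral_add hi1 hi2, ih h hh0 hn',
      circleIntegral.integral_sub_inv_of_mem_ball hz₀]
    push_cast
    ring

/-- Hurwitz: near `f`, the number of zeros in a disc without zeros of `f` on its boundary is
constant. -/
theorem eventually_zeroMeasure_ball_eq {f : EntireFun} {c : ℂ} {r : ℝ} (hr : 0 < r)
    (hf : ∀ z ∈ Metric.sphere c r, f.toFun z ≠ 0) :
    ∀ᶠ g in 𝓝 f, zeroMeasure g (Metric.ball c r) = zeroMeasure f (Metric.ball c r) := by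
  have hdd : ∀ f : EntireFun, Differentiable ℂ (deriv f.toFun) := fun f => by
    rw [← differentiableOn_univ]
    exact f.differentiable.differentiableOn.deriv isOpen_univ
  have hev := EntireFun.eventually_forall_ne_zero (isCompact_sphere c r) hf
  have hloc : TendstoLocallyUniformlyOn (fun g : EntireFun => g.toFun) f.toFun (𝓝 f) Set.univ :=
    tendstoLocallyUniformlyOn_univ.mpr f.tendstoLocallyUniformly
  have hderiv := (hloc.deriv (Eventually.of_forall fun g => g.differentiable.differentiableOn)
    isOpen_univ).mono (Set.subset_univ (Metric.sphere c r))
  have hdiv := hderiv.div₀ (hloc.mono (Set.subset_univ (Metric.sphere c r)))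
    (hdd f).continuous.continuousOn f.differentiable.continuous.continuousOn hf
  rw [tendstoLocallyUniformlyOn_iff_tendstoUniformlyOn_of_compact (isCompact_sphere c r)] at hdiv
  have hint := hdiv.tendsto_circleIntegral_of_continuousOn hr.le (by
    filter_upwards [hev] with g hg
    exact (hdd g).continuous.continuousOn.div g.differentiable.continuous.continuousOn hg)
  obtain ⟨k, hk⟩ := zeroMeasure_isBounded f (Metric.ball c r) Metric.isBounded_ball measurableSet_ball
  have h1 := Metric.tendsto_nhds.mp hint (2 * Real.pi) (by positivity)
  filter_upwards [h1, hev] with g hg hg0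
  obtain ⟨l, hl⟩ := zeroMeasure_isBounded g (Metric.ball c r) Metric.isBounded_ball measurableSet_ball
  have h2 : (∮ z in C(c, r), deriv g.toFun z / g.toFun z) = 2 * Real.pi * Complex.I * l :=
    circleIntegral_logDeriv_eq hr l g hg0 hl
  have h3 : (∮ z in C(c, r), deriv f.toFun z / f.toFun z) = 2 * Real.pi * Complex.I * k :=
    circleIntegral_logDeriv_eq hr k f hf hk
  have h4 : dist ((2 : ℂ) * Real.pi * Complex.I * l) (2 * Real.pi * Complex.I * k) < 2 * Real.pi := by
    rw [← h2, ← h3]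
    exact hg
  rw [dist_eq_norm, ← mul_sub, norm_mul, norm_mul, norm_mul, Complex.norm_I, Complex.norm_ofNat,
    Complex.norm_real, Real.norm_eq_abs, abs_of_pos Real.pi_pos, mul_one] at h4
  have h5 : ‖(l : ℂ) - k‖ < 1 := by
    by_contra! hcon
    nlinarith [Real.pi_pos]
  have h6 : ‖(((l : ℤ) - (k : ℤ) : ℤ) : ℂ)‖ < 1 := by
    push_cast
    exact h5
  rw [Complex.norm_intCast] at h6
  have h7 : |(l : ℤ) - (k : ℤ)| < 1 := by exact_mod_cast h6
  have h8 : (l : ℤ) - k = 0 := Int.abs_lt_one_iff.mp h7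
  have h9 : l = k := by omega
  rw [hl, hk, h9]

/-! ### Continuity of the zeros in the vague topology -/

instance (f : EntireFun) : IsFiniteMeasureOnCompacts (zeroMeasure f) where
  lt_top_of_isCompact K hK := by
    obtain ⟨k, hk⟩ := zeroMeasure_isBounded f K hK.isBounded hK.measurableSet
    rw [hk]
    exact ENNReal.natCast_lt_top k

theorem eventually_disjoint_ball {X : Type*} [MetricSpace X] {x y : X} (h : x ≠ y) :
    ∀ᶠ r : ℝ in 𝓝[>] 0, Disjoint (Metric.ball x r) (Metric.ball y r) := by
  filter_upwards [Ioo_mem_nhdsGT (half_pos (dist_pos.mpr h))] with r hr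
  exact Metric.ball_disjoint_ball (by linarith [hr.2])

/-- If `ν` charges only the discs `ball z r`, `z ∈ F`, within the support of `φ`, and `φ` oscillates
by at most `ε` on each of them, then `∫ φ dν` is close to `∑ φ z * ν (ball z r)`. -/
theorem abs_integral_sub_sum_le (ν : Measure ℂ) [IsFiniteMeasureOnCompacts ν] (φ : C_c(ℂ, ℝ))
    (F : Finset ℂ) {r ε : ℝ}
    (hdisj : (F : Set ℂ).Pairwise fun z w => Disjoint (Metric.ball z r) (Metric.ball w r))
    (hosc : ∀ z ∈ F, ∀ x ∈ Metric.closedBall z r, |φ x - φ z| ≤ ε)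
    (hν : ν (tsupport φ \ ⋃ z ∈ F, Metric.ball z r) = 0) :
    |∫ x, φ x ∂ν - ∑ z ∈ F, φ z * ν.real (Metric.ball z r)|
      ≤ ε * ∑ z ∈ F, ν.real (Metric.ball z r) := by
  have hint : Integrable (fun x => φ x) ν :=
    φ.continuous.integrable_of_hasCompactSupport φ.hasCompactSupport
  have hfin : ∀ z, ν (Metric.ball z r) < ∞ := fun z =>
    (measure_mono Metric.ball_subset_closedBall).trans_lt
      (isCompact_closedBall z r).measure_lt_top
  have h1 : ∫ x, φ x ∂ν = ∑ z ∈ F, ∫ x in Metric.ball z r, φ x ∂ν := by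
    rw [← integral_biUnion_finset F (fun z _ => measurableSet_ball) hdisj
      (fun z _ => hint.integrableOn)]
    refine (setIntegral_eq_integral_of_ae_compl_eq_zero ?_).symm
    have hae : ∀ᵐ x ∂ν, x ∉ tsupport φ \ ⋃ z ∈ F, Metric.ball z r := measure_eq_zero_iff_ae_notMem.mp hν
    filter_upwards [hae] with x hx hxT
    by_contra hne
    exact hx ⟨subset_tsupport _ hne, hxT⟩
  rw [h1, ← Finset.sum_sub_distrib, Finset.mul_sum]
  refine (Finset.abs_sum_le_sum_abs _ _).trans (Finset.sum_le_sum fun z hz => ?_)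
  have h2 : ∫ x in Metric.ball z r, φ x ∂ν - φ z * ν.real (Metric.ball z r)
      = ∫ x in Metric.ball z r, (φ x - φ z) ∂ν := by
    rw [integral_sub hint.integrableOn (integrableOn_const (hfin z).ne), setIntegral_const,
      smul_eq_mul, mul_comm]
  rw [h2, ← Real.norm_eq_abs]
  exact norm_setIntegral_le_of_norm_le_const (hfin z) fun x hx =>
    hosc z hz x (Metric.ball_subset_closedBall hx)

/-- The zeros of `f` in the support of `φ` are enclosed in small disjoint discs. Near `f` each disc
keeps its number of zeros, by Hurwitz, and no zero lies in the rest of the support. -/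
theorem continuousAt_integral_zeroMeasure {f : EntireFun} (hf : f.toFun ≠ 0) (φ : C_c(ℂ, ℝ)) :
    ContinuousAt (fun g => ∫ x, φ x ∂zeroMeasure g) f := by
  have hK : IsCompact (tsupport φ) := φ.hasCompactSupport
  set F : Finset ℂ := (finite_zeros_of_isBounded f hK.isBounded).toFinset with hF
  have hFmem : ∀ z ∈ tsupport φ, f.toFun z = 0 → z ∈ F := by
    intro z hz h0
    rw [hF, Set.Finite.mem_toFinset]
    refine ⟨hz, fun h1 => ?_⟩
    rw [analyticOrderNatAt, ENat.toNat_eq_zero] at h1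
    rcases h1 with h1 | h1
    · exact (f.analyticAt z).analyticOrderAt_ne_zero.mpr h0 h1
    · exact EntireFun.analyticOrderAt_ne_top hf z h1
  -- the discs of radius `1` bound the number of zeros in smaller discs before `r` is chosen
  set M : ℝ := ∑ z ∈ F, (zeroMeasure f).real (Metric.ball z 1) with hM
  have hM0 : 0 ≤ M := Finset.sum_nonneg fun z _ => measureReal_nonneg
  rw [ContinuousAt, Metric.tendsto_nhds]
  intro η hη
  set ε : ℝ := η / (2 * (M + 1)) with hε
  have hε0 : 0 < ε := by positivity
  obtain ⟨r, hr1, hdisj, hosc, hne, hr0⟩ : ∃ r : ℝ, r ≤ 1 ∧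
      ((F : Set ℂ).Pairwise fun z w => Disjoint (Metric.ball z r) (Metric.ball w r)) ∧
      (∀ z ∈ F, ∀ x ∈ Metric.closedBall z r, |φ x - φ z| ≤ ε) ∧
      (∀ z ∈ F, ∀ x ∈ Metric.closedBall z r, x ≠ z → f.toFun x ≠ 0) ∧ 0 < r := by
    have e1 : ∀ᶠ r : ℝ in 𝓝[>] 0, r ≤ 1 := by
      filter_upwards [Ioo_mem_nhdsGT one_pos] with r hr using hr.2.le
    have e2 : ∀ᶠ r : ℝ in 𝓝[>] 0, ∀ z ∈ F, ∀ w ∈ F, z ≠ w →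
        Disjoint (Metric.ball z r) (Metric.ball w r) := by
      rw [Finset.eventually_all]
      intro z _
      rw [Finset.eventually_all]
      intro w _
      by_cases h : z = w
      · exact Eventually.of_forall fun r hne => absurd h hne
      · exact (eventually_disjoint_ball h).mono fun r hr _ => hr
    have e3 : ∀ᶠ r : ℝ in 𝓝[>] 0, ∀ z ∈ F, ∀ x ∈ Metric.closedBall z r, |φ x - φ z| ≤ ε := by
      rw [Finset.eventually_all]
      intro z _
      have h : {x | |φ x - φ z| ≤ ε} ∈ 𝓝 z := by
        filter_upwards [Metric.tendsto_nhds.mp (φ.continuous.tendsto z) ε hε0] with x hx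
        rw [Real.dist_eq] at hx
        exact hx.le
      filter_upwards [(eventually_closedBall_subset h).filter_mono nhdsWithin_le_nhds] with r hr
      exact fun x hx => hr hx
    have e4 : ∀ᶠ r : ℝ in 𝓝[>] 0, ∀ z ∈ F, ∀ x ∈ Metric.closedBall z r,
        x ≠ z → f.toFun x ≠ 0 := by
      rw [Finset.eventually_all]
      intro z _
      have h : {x | x ≠ z → f.toFun x ≠ 0} ∈ 𝓝 z := by
        rcases (f.analyticAt z).eventually_eq_zero_or_eventually_ne_zero with h | h
        · exact absurd (analyticOrderAt_eq_top.mpr h) (EntireFun.analyticOrderAt_ne_top hf z)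
        · exact eventually_nhdsWithin_iff.mp h
      filter_upwards [(eventually_closedBall_subset h).filter_mono nhdsWithin_le_nhds] with r hr
      exact fun x hx => hr hx
    obtain ⟨r, h⟩ := (e1.and (e2.and (e3.and (e4.and self_mem_nhdsWithin)))).exists
    exact ⟨r, h.1, fun z hz w hw hzw => h.2.1 z hz w hw hzw, h.2.2.1, h.2.2.2.1, h.2.2.2.2⟩
  have hT : IsCompact (tsupport φ \ ⋃ z ∈ F, Metric.ball z r) :=
    hK.diff (isOpen_biUnion fun z _ => Metric.isOpen_ball)
  have hKne : ∀ z ∈ tsupport φ \ ⋃ z ∈ F, Metric.ball z r, f.toFun z ≠ 0 := by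
    rintro z ⟨hz1, hz2⟩ h0
    refine hz2 (Set.mem_biUnion (hFmem z hz1 h0) (Metric.mem_ball_self hr0))
  have hev1 := EntireFun.eventually_forall_ne_zero hT hKne
  have hev2 : ∀ᶠ g in 𝓝 f, ∀ z ∈ F,
      zeroMeasure g (Metric.ball z r) = zeroMeasure f (Metric.ball z r) := by
    rw [Finset.eventually_all]
    intro z hz
    refine eventually_zeroMeasure_ball_eq hr0 fun x hx => hne z hz x
      (Metric.sphere_subset_closedBall hx) ?_
    rintro rfl
    rw [Metric.mem_sphere, dist_self] at hx
    exact hr0.ne hx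
  have key : ∀ g : EntireFun, (∀ z ∈ tsupport φ \ ⋃ z ∈ F, Metric.ball z r, g.toFun z ≠ 0) →
      (∀ z ∈ F, zeroMeasure g (Metric.ball z r) = zeroMeasure f (Metric.ball z r)) →
      |∫ x, φ x ∂zeroMeasure g - ∑ z ∈ F, φ z * (zeroMeasure f).real (Metric.ball z r)| ≤ ε * M := by
    intro g hg1 hg2
    have h1 := abs_integral_sub_sum_le (zeroMeasure g) φ F hdisj hosc
      (zeroMeasure_apply_eq_zero hT.measurableSet hg1)
    have h2 : ∀ z ∈ F, (zeroMeasure g).real (Metric.ball z r)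
        = (zeroMeasure f).real (Metric.ball z r) := fun z hz => by
      rw [measureReal_def, measureReal_def, hg2 z hz]
    rw [Finset.sum_congr rfl h2, Finset.sum_congr rfl fun z hz => by rw [h2 z hz]] at h1
    refine h1.trans (mul_le_mul_of_nonneg_left (Finset.sum_le_sum fun z _ => ?_) hε0.le)
    exact measureReal_mono (Metric.ball_subset_ball hr1)
      ((measure_mono Metric.ball_subset_closedBall).trans_lt
        (isCompact_closedBall z 1).measure_lt_top).ne
  have hεM : 2 * (ε * M) < η := by
    have : ε * (2 * (M + 1)) = η := by rw [hε]; field_simp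
    nlinarith
  have hfkey := key f hKne fun z _ => rfl
  filter_upwards [hev1, hev2] with g hg1 hg2
  have hgkey := key g hg1 hg2
  rw [Real.dist_eq]
  rw [abs_sub_comm] at hfkey
  calc |∫ x, φ x ∂zeroMeasure g - ∫ x, φ x ∂zeroMeasure f|
      ≤ ε * M + ε * M := (abs_sub_le _ _ _).trans (add_le_add hgkey hfkey)
    _ < η := by linarith

theorem continuousAt_zeros {f : EntireFun} (hf : f.toFun ≠ 0) : ContinuousAt zeros f := by
  have hind : Topology.IsInducing
      (fun (ν : PointMeasure) (φ : C_c(ℂ, ℝ)) => ∫ z, φ z ∂ν.1) := ⟨rfl⟩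
  rw [hind.continuousAt_iff, continuousAt_pi]
  exact fun φ => continuousAt_integral_zeroMeasure hf φ

/-! ### Convergence of the point processes of zeros -/

instance : TopologicalSpace.PseudoMetrizableSpace EntireFun :=
  EntireFun.isInducing_val.pseudoMetrizableSpace

instance : T2Space EntireFun :=
  T2Space.of_injective_continuous (f := fun f : EntireFun => (f.1 : C(ℂ, ℂ)))
    Subtype.val_injective EntireFun.isInducing_val.continuous

/-- The joint zeros of a tuple of entire functions. -/
def tupleZeros {m : ℕ} (f : Fin m → EntireFun) : PointMeasureTuple m := fun j => zeros (f j)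

theorem isClosed_setOf_toFun_eq_zero : IsClosed {f : EntireFun | f.toFun = 0} := by
  have h : {f : EntireFun | f.toFun = 0} = {EntireFun.ofDifferentiable 0 (differentiable_const 0)} := by
    ext f
    exact ⟨fun hf => EntireFun.ext_toFun hf, fun hf => by rw [Set.mem_singleton_iff.mp hf]; rfl⟩
  rw [h]
  exact isClosed_singleton

theorem continuousOn_tupleZeros {m : ℕ} (S : Set (Fin m)) :
    ContinuousOn tupleZeros {f : Fin m → EntireFun | ∀ j, (f j).toFun = 0 ↔ j ∈ S} := by
  change ContinuousOn (fun (f : Fin m → EntireFun) (j : Fin m) => zeros (f j)) _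
  rw [continuousOn_pi]
  intro j
  by_cases hj : j ∈ S
  · have h0 : ∀ f ∈ {f : Fin m → EntireFun | ∀ j, (f j).toFun = 0 ↔ j ∈ S},
        f j = EntireFun.ofDifferentiable 0 (differentiable_const 0) :=
      fun f hf => EntireFun.ext_toFun ((hf j).mpr hj)
    exact continuousOn_const.congr fun f hf => congrArg zeros (h0 f hf)
  · intro f hf
    have h1 : (f j).toFun ≠ 0 := fun h => hj ((hf j).mp h)
    exact ((continuousAt_zeros h1).comp (f := fun f : Fin m → EntireFun => f j)
      (continuous_apply j).continuousAt).continuousWithinAt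

/-- The zeros depend measurably on the functions: they depend continuously on them on each of the
finitely many measurable sets where a given subset of the functions vanishes identically. -/
theorem measurable_tupleZeros {m : ℕ} : Measurable (tupleZeros (m := m)) := by
  refine measurable_of_isOpen fun O hO => ?_
  have hD : ∀ S : Set (Fin m),
      MeasurableSet {f : Fin m → EntireFun | ∀ j, (f j).toFun = 0 ↔ j ∈ S} := by
    intro S
    rw [Set.ofPred_forall]
    refine MeasurableSet.iInter fun j => ?_
    have h : MeasurableSet {f : Fin m → EntireFun | (f j).toFun = 0} :=
      isClosed_setOf_toFun_eq_zero.measurableSet.preimage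
        (measurable_pi_apply (X := fun _ : Fin m => EntireFun) j)
    by_cases hj : j ∈ S
    · simpa only [hj, iff_true] using h
    · simp only [hj, iff_false]
      exact h.compl
  have hU : tupleZeros ⁻¹' O = ⋃ S : Set (Fin m),
      tupleZeros ⁻¹' O ∩ {f : Fin m → EntireFun | ∀ j, (f j).toFun = 0 ↔ j ∈ S} := by
    rw [← Set.inter_iUnion]
    refine (Set.inter_eq_left.mpr fun f _ => ?_).symm
    exact Set.mem_iUnion.mpr ⟨{j | (f j).toFun = 0}, fun j => Iff.rfl⟩
  rw [hU]
  refine MeasurableSet.iUnion fun S => ?_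
  obtain ⟨u, hu, hu'⟩ := continuousOn_iff'.mp (continuousOn_tupleZeros S) O hO
  rw [hu']
  exact hu.measurableSet.inter (hD S)

/-- The continuous mapping theorem for a measurable map that is continuous on an open set which
carries the limit. -/
theorem tendstoInDistribution_comp_of_continuousOn {ι E F Ω' : Type*} {Ω : ι → Type*}
    {mΩ : ∀ i, MeasurableSpace (Ω i)} {μ : ∀ i, Measure (Ω i)} [∀ i, IsProbabilityMeasure (μ i)]
    [MeasurableSpace Ω'] {μ' : Measure Ω'} [IsProbabilityMeasure μ']
    [TopologicalSpace E] [MeasurableSpace E] [BorelSpace E] [HasOuterApproxClosed E]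
    [TopologicalSpace F] [MeasurableSpace F] [BorelSpace F]
    {X : ∀ i, Ω i → E} {l : Filter ι} [l.IsCountablyGenerated] {Z : Ω' → E}
    (h : TendstoInDistribution X l Z μ μ') {g : E → F} (hg : Measurable g) {U : Set E}
    (hU : IsOpen U) (hgU : ContinuousOn g U) (hZ : ∀ᵐ ω ∂μ', Z ω ∈ U) :
    TendstoInDistribution (fun i ω => g (X i ω)) l (fun ω => g (Z ω)) μ μ' := by
  have hXm : ∀ i, AEMeasurable (fun ω => g (X i ω)) (μ i) := fun i =>
    hg.comp_aemeasurable (h.forall_aemeasurable i)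
  have hZm : AEMeasurable (fun ω => g (Z ω)) μ' := hg.comp_aemeasurable h.aemeasurable_limit
  refine ⟨hXm, hZm, tendsto_of_forall_isOpen_le_liminf' fun O hO => ?_⟩
  have hopen : IsOpen (U ∩ g ⁻¹' O) := hgU.isOpen_inter_preimage hU hO
  have h1 := ProbabilityMeasure.le_liminf_measure_open_of_tendsto h.tendsto hopen
  simp only [ProbabilityMeasure.coe_mk] at h1 ⊢
  calc (μ'.map fun ω => g (Z ω)) O = μ' ((fun ω => g (Z ω)) ⁻¹' O) :=
        Measure.map_apply_of_aemeasurable hZm hO.measurableSet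
    _ ≤ μ' (Z ⁻¹' (U ∩ g ⁻¹' O)) := by
        refine measure_mono_ae ?_
        filter_upwards [hZ] with ω hω hω'
        exact ⟨hω, hω'⟩
    _ = μ'.map Z (U ∩ g ⁻¹' O) :=
        (Measure.map_apply_of_aemeasurable h.aemeasurable_limit hopen.measurableSet).symm
    _ ≤ _ := h1
    _ ≤ _ := by
        refine liminf_le_liminf (Eventually.of_forall fun i => ?_)
        rw [Measure.map_apply_of_aemeasurable (hXm i) hO.measurableSet,
          Measure.map_apply_of_aemeasurable (h.forall_aemeasurable i) hopen.measurableSet]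
        exact measure_mono fun ω hω => hω.2

theorem tendstoInDistribution_tupleZeros {Ω Ω' : Type*} [MeasurableSpace Ω] [MeasurableSpace Ω']
    {μ : Measure Ω} [IsProbabilityMeasure μ] {μ' : Measure Ω'} [IsProbabilityMeasure μ'] {m : ℕ}
    {X : ℕ → Ω → Fin m → EntireFun} {Z : Ω' → Fin m → EntireFun}
    (h : TendstoInDistribution X atTop Z (fun _ => μ) μ')
    (hZ : ∀ᵐ ω ∂μ', ∀ j, (Z ω j).toFun ≠ 0) :
    TendstoInDistribution (fun n ω => tupleZeros (X n ω)) atTop (fun ω => tupleZeros (Z ω))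
      (fun _ => μ) μ' := by
  have hU : {f : Fin m → EntireFun | ∀ j, (f j).toFun = 0 ↔ j ∈ (∅ : Set (Fin m))}
      = ⋂ j, (fun f : Fin m → EntireFun => f j) ⁻¹' {f : EntireFun | f.toFun = 0}ᶜ := by
    ext f
    simp
  refine tendstoInDistribution_comp_of_continuousOn h measurable_tupleZeros ?_
    (continuousOn_tupleZeros ∅) ?_
  · rw [hU]
    exact isOpen_iInter_of_finite fun j =>
      isClosed_setOf_toFun_eq_zero.isOpen_compl.preimage (continuous_apply j)
  · filter_upwards [hZ] with ω hω j
    simp [hω j]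

/-! ### The zeros of the limit -/

theorem toFun_affineExp (p N u : ℂ) : (affineExp p N).toFun u = p + Complex.exp u * N := rfl

theorem affineExp_toFun_ne_zero (p : ℂ) {N : ℂ} (hN : N ≠ 0) : (affineExp p N).toFun ≠ 0 := by
  intro h
  have h0 := congrFun h 0
  have h1 := congrFun h (Real.pi * Complex.I)
  simp only [toFun_affineExp, Pi.zero_apply, Complex.exp_zero, Complex.exp_pi_mul_I] at h0 h1
  have : 2 * N = 0 := by linear_combination h0 - h1
  exact hN (by simpa using this)

theorem affineExp_eq_zero_iff {p N : ℂ} (hp : p ≠ 0) (hN : N ≠ 0) (u : ℂ) :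
    (affineExp p N).toFun u = 0
      ↔ ∃ k : ℤ, Complex.log (-p / N) + 2 * (Real.pi : ℂ) * Complex.I * (k : ℂ) = u := by
  have h1 : (affineExp p N).toFun u = 0 ↔ Complex.exp u = Complex.exp (Complex.log (-p / N)) := by
    rw [Complex.exp_log (div_ne_zero (neg_ne_zero.mpr hp) hN), toFun_affineExp, eq_div_iff hN]
    constructor
    · intro h; linear_combination h
    · intro h; linear_combination h
  rw [h1, Complex.exp_eq_exp_iff_exists_int]
  refine exists_congr fun k => ⟨fun h => ?_, fun h => ?_⟩
  · rw [h]; ring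
  · rw [← h]; ring

theorem analyticOrderNatAt_affineExp {p N u : ℂ} (hN : N ≠ 0) (hu : (affineExp p N).toFun u = 0) :
    analyticOrderNatAt (affineExp p N).toFun u = 1 := by
  have hd : HasDerivAt (affineExp p N).toFun (Complex.exp u * N) u :=
    ((Complex.hasDerivAt_exp u).mul_const N).const_add p
  have h := (EntireFun.analyticAt (affineExp p N) u).analyticOrderAt_eq_one_of_zero_deriv_ne_zero hu
    (by rw [hd.deriv]; exact mul_ne_zero (Complex.exp_ne_zero u) hN)
  rw [analyticOrderNatAt, h]
  rfl

theorem zeroMeasure_affineExp {p N : ℂ} (hp : p ≠ 0) (hN : N ≠ 0) :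
    zeroMeasure (affineExp p N) = latticeMeasure (Complex.log (-p / N)) := by
  set e : ℤ → ℂ := fun k => Complex.log (-p / N) + 2 * (Real.pi : ℂ) * Complex.I * (k : ℂ) with he
  have hinj : Function.Injective e := by
    intro k l hkl
    have h1 : (2 * (Real.pi : ℂ) * Complex.I) * (k : ℂ) = 2 * (Real.pi : ℂ) * Complex.I * (l : ℂ) :=
      add_left_cancel hkl
    exact_mod_cast mul_left_cancel₀ Complex.two_pi_I_ne_zero h1
  ext s hs
  rw [zeroMeasure, latticeMeasure, Measure.sum_apply _ hs, Measure.sum_apply _ hs,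
    ← hinj.tsum_eq]
  · refine tsum_congr fun k => ?_
    rw [analyticOrderNatAt_affineExp hN ((affineExp_eq_zero_iff hp hN _).mpr ⟨k, rfl⟩)]
    simp [he]
  · intro z hz
    rw [Function.mem_support] at hz
    have h1 : analyticOrderNatAt (affineExp p N).toFun z ≠ 0 := by
      intro h
      exact hz (by simp [h])
    exact (affineExp_eq_zero_iff hp hN z).mp (apply_eq_zero_of_analyticOrderNatAt_ne_zero h1)

end

theorem theorem3p3 {Ω : Type*} [MeasurableSpace Ω] (μ : Measure Ω) [IsProbabilityMeasure μ]
    -- independent copies of a centred square-integrable complex random variable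
    (ξ : ℕ → Ω → ℂ) (hξ_meas : ∀ k, Measurable (ξ k)) (hξ_indep : iIndepFun ξ μ)
    (hξ_ident : ∀ k, IdentDistrib (ξ k) (ξ 0) μ μ)
    (hξ_mean : ∫ ω, ξ 0 ω ∂μ = 0) (hξ_sq : MemLp (ξ 0) 2 μ)
    (σ₁ σ₂ σ : ℝ) (hσ₁ : σ₁ ^ 2 = ∫ ω, (ξ 0 ω).re ^ 2 ∂μ) (hσ₂ : σ₂ ^ 2 = ∫ ω, (ξ 0 ω).im ^ 2 ∂μ)
    (hσ : σ ^ 2 = σ₁ ^ 2 + σ₂ ^ 2) (hσ_pos : 0 < σ ^ 2)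
    (hξ_cov : cov[fun ω => (ξ 0 ω).re, fun ω => (ξ 0 ω).im; μ] = 0)
    -- regularly varying coefficients
    (α : ℝ) (b : ℝ → ℝ) (hb : IsRegularlyVarying b α) (hα : α ≤ -1 / 2)
    (hb_sq : α = -1 / 2 → Summable fun k : ℕ => b k ^ 2)
    -- angles
    (m : ℕ) (ψ : Fin m → ℝ) (hψ_mono : StrictMono ψ)
    (hψ : ∀ j, ψ j ∈ Set.Ico 0 (2 * Real.pi)) :
    -- `-n b(n)^2` lies in the domain `[-1/e, 0)` of `W₋₁` for all large `n`
    (∀ᶠ n : ℕ in atTop, -(n * b n ^ 2) ∈ Set.Ico (-Real.exp (-1)) 0) ∧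
    -- the series `P_∞(e^{iψ_j})` converges almost surely
    (∀ j, ∀ᵐ ω ∂μ, Tendsto
      (fun n : ℕ => weightedPoly b (fun k => ξ k ω) n (Complex.exp (ψ j * Complex.I))) atTop
      (𝓝 (weightedSeries b (fun k => ξ k ω) (Complex.exp (ψ j * Complex.I))))) ∧
    -- `γ` is the law of `(N_1, …, N_m)`; independence of `P_∞` is expressed by `μ.prod γ`
    ∃ (γ : Measure (Fin m → ℂ)) (_ : IsGaussian γ),
      (∀ j, ∫ N, N j ∂γ = 0) ∧
      (∀ i j, ∫ N, N i * (starRingEnd ℂ) (N j) ∂γ = if i = j then ((σ ^ 2 : ℝ) : ℂ) else 0) ∧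
      (∀ i j, ∫ N, N i * N j ∂γ =
        if ψ i + ψ j = 0 ∨ ψ i + ψ j = 2 * Real.pi then ((σ₁ ^ 2 - σ₂ ^ 2 : ℝ) : ℂ) else 0) ∧
      -- either choice of the centring sequence
      (∀ a : ℕ → ℝ,
        ((∀ n : ℕ, a n = -lambertWm1 (-(n * b n ^ 2))) ∨
          (α < -1 / 2 ∧ ∀ n : ℕ, a n = -2 * Real.log (b n) - Real.log n + Real.log (Real.log n)
            + Real.log (-2 * α - 1))) →
        -- convergence in distribution on the `m`-fold product of the space of entire functions
        TendstoInDistribution (E := Fin m → EntireFun)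
          (fun n ω j => windowPoly b (fun k => ξ k ω) (a n) n (ψ j)) atTop
          (fun p : Ω × (Fin m → ℂ) => fun j =>
            affineExp (weightedSeries b (fun k => ξ k p.1) (Complex.exp (ψ j * Complex.I)))
              (p.2 j))
          (fun _ => μ) (μ.prod γ) ∧
        -- convergence in distribution of the point processes of zeros
        TendstoInDistribution (E := PointMeasureTuple m)
          (fun n ω j => zeros (windowPoly b (fun k => ξ k ω) (a n) n (ψ j))) atTop
          (fun p : Ω × (Fin m → ℂ) => fun j => zeros
            (affineExp (weightedSeries b (fun k => ξ k p.1) (Complex.exp (ψ j * Complex.I)))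
              (p.2 j)))
          (fun _ => μ) (μ.prod γ)) ∧
      -- almost surely, the limiting zeros are simple and form shifted lattices
      (∀ᵐ p ∂(μ.prod γ), ∀ j,
        zeroMeasure
          (affineExp (weightedSeries b (fun k => ξ k p.1) (Complex.exp (ψ j * Complex.I))) (p.2 j))
        = latticeMeasure (Complex.log
          (-(weightedSeries b (fun k => ξ k p.1) (Complex.exp (ψ j * Complex.I))) / p.2 j))) := by
  have hs : Summable fun k : ℕ => b k ^ 2 := hb.summable_sq hα hb_sq
  have hre_im : ∫ ω, ‖ξ 0 ω‖ ^ 2 ∂μ = σ ^ 2 := by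
    rw [← integral_re_sq_add_integral_im_sq hξ_sq, ← hσ₁, ← hσ₂, hσ]
  have hN0 : ∀ᵐ p ∂(μ.prod (limitGaussian ψ σ₁ σ₂)), ∀ j, p.2 j ≠ 0 := by
    rw [ae_all_iff]
    intro j
    exact Measure.quasiMeasurePreserving_snd.ae
      (ae_ne_zero_limitGaussian hψ_mono hψ (hσ ▸ hσ_pos) j)
  have hP0 : ∀ᵐ p ∂(μ.prod (limitGaussian ψ σ₁ σ₂)), ∀ j,
      weightedSeries b (fun k => ξ k p.1) (Complex.exp (ψ j * Complex.I)) ≠ 0 := by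
    rw [ae_all_iff]
    intro j
    exact Measure.quasiMeasurePreserving_fst.ae
      (ae_weightedSeries_ne_zero hξ_meas hξ_indep hξ_ident hξ_mean hξ_sq (hre_im ▸ hσ_pos) hs
        (hb.eventually_pos.mono fun n hn => hn.ne') (ψ j))
  refine ⟨eventually_neg_mem_Ico hb hs, fun j =>
    ae_tendsto_weightedPoly hξ_meas hξ_indep hξ_ident hξ_mean hξ_sq hs (ψ j),
    limitGaussian ψ σ₁ σ₂, inferInstance, fun j => integral_limitGaussian ψ σ₁ σ₂ j,
    fun i j => ?_, fun i j => integral_mul_self_limitGaussian hψ_mono hψ σ₁ σ₂ i j,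
    fun a ha => ?_, ?_⟩
  · rw [hσ]
    exact integral_mul_conj_limitGaussian hψ_mono hψ σ₁ σ₂ i j
  · have hcent : IsCentering b a := by
      rcases ha with ha | ⟨hα', ha⟩
      · exact isCentering_lambert hb hs ha
      · exact isCentering_log hb hα' ha
    have hlim := tendstoInDistribution_windowPoly hξ_meas hξ_indep hξ_ident hξ_mean hξ_sq hσ₁ hσ₂
      hξ_cov hb hs hcent hψ_mono hψ
    refine ⟨hlim, tendstoInDistribution_tupleZeros hlim ?_⟩
    filter_upwards [hN0] with p hp j
    exact affineExp_toFun_ne_zero _ (hp j)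
  · filter_upwards [hN0, hP0] with p hN hP j
    exact zeroMeasure_affineExp (hP j) (hN j)
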